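/- **Setting.** Let $f=\frac1N\sum_{i=1}^N f_i$ with $f_i:\mathbb R^d\to\mathbb R$ differentiable and $L$-smooth: $\|\nabla f_i(x)-\nabla f_i(y)\|\le L\|x-y\|$ for all $x,y,i$ ($L\ge 0$). Client $i$ has an unbiased stochastic gradient oracle $\tilde\nabla f_i$ with $\mathbb E\|\tilde\nabla f_i(x)-\nabla f_i(x)\|^2\le\sigma^2$ for all $x$; $\tilde\nabla_b f_i$ denotes the average of $b\ge1$ independent oracle answers. Let $\mathcal C$ be a randomized $\omega$-compression operator: $\mathbb E\,\mathcal C(x)=x$ and $\mathbb E\|\mathcal C(x)-x\|^2\le\omega\|x\|^2$ for all $x$ ($\omega\ge 0$). Let $1\le S\le N$ and $\epsilon>0$. **COFIG** with step size $\eta$ and shift step size $\alpha=\frac1{1+\omega}$ starts from arbitrary $x^0,h_1^0,\dots,h_N^0\in\mathbb R^d$ and $h^0=\frac1N\sum_i h_i^0$. In round $t$ it draws two independent uniformly random sets of clients $\mathcal S^t,\tilde{\mathcal S}^t\subseteq\{1,\dots,N\}$ of size $S$, computes $u_i^t=\mathcal C(\tilde\nabla_b f_i(x^t)-h_i^t)$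 for $i\in\mathcal S^t$ and, with independent compression randomness (and with either the same or a fresh minibatch), $v_i^t=\mathcal C(\tilde\nabla_b f_i(x^t)-h_i^t)$ for $i\in\tilde{\mathcal S}^t$, and sets $$h_i^{t+1}=h_i^t+\alpha u_i^t\ (i\in\mathcal S^t),\quad h_i^{t+1}=h_i^t\ (i\notin\mathcal S^t),\quad h^{t+1}=h^t+\tfrac{\alpha}{N}\sum_{i\in\mathcal S^t}u_i^t,$$ $$x^{t+1}=x^t-\eta\Big(\tfrac1S\sum_{i\in\tilde{\mathcal S}^t}v_i^t+h^t\Big).$$ The output after $T$ rounds is an iterate $x$ drawn uniformly from $x^0,\dots,x^T$. Put $G_0=\frac1N\sum_{i=1}^N\|h_i^0-\nabla f_i(x^0)\|^2$. (If $L=0$, the bounds below are read as $0$ rounds.) **Nonconvex case.** There is an absolute constant $c$ such that, if $b\ge\frac{\sigma^2}{\epsilon^2N^{2/3}}$, then for a suitable $\eta>0$ depending only on $N,S,b,L,\omega,\sigma,\epsilon$, whenever $f^*=\inf f>-\infty$, COFIG outputs $x$ with $\mathbb E\|\nabla f(x)\|\le\epsilon$ after some number $T$ of rounds with $$T\le c\,\Big(f(x^0)-f^*+\frac{G_0}{L}\Big)\Big(\frac{L}{\epsilon^2}+\frac{L(1+\omega)N^{2/3}}{S\epsilon^2}+\frac{L(1+\omega)^{3/2}\sqrt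 N}{S\epsilon^2}\Big).$$ **Convex case.** There is an absolute constant $c$ such that, if $b\ge\frac{\sigma^2}{\epsilon^2\sqrt N}$, then for a suitable $\eta>0$ depending only on $N,S,b,L,\omega,\sigma,\epsilon$, whenever $f$ is convex with a minimizer $x^*$, $f^*=f(x^*)$ and $R=\|x^0-x^*\|$, COFIG outputs $x$ with $\mathbb E f(x)-f^*\le\epsilon$ after some number $T$ of rounds with $$T\le c\,(1+R^2)\Big(R^2+\frac{G_0}{L^2}\Big)\Big(\frac{L}{\epsilon}+\frac{(1+\omega)\sqrt N\,L}{S\epsilon}\Big).$$ -/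

import Mathlib

open MeasureTheory ProbabilityTheory

/-- The Euclidean space `ℝ^d`. -/
abbrev Vec (d : ℕ) : Type := EuclideanSpace ℝ (Fin d)

/-- The global objective `f = (1/N) ∑ i, f i`. -/
noncomputable def avgLoss {d N : ℕ} (f : Fin N → Vec d → ℝ) (x : Vec d) : ℝ :=
  (N : ℝ)⁻¹ * ∑ i, f i x

/-- The functions `f i` are differentiable with `L`-Lipschitz gradients. -/
structure IsSmoothFamily {d N : ℕ} (f : Fin N → Vec d → ℝ) (L : ℝ) : Prop where
  differentiable : ∀ i, Differentiable ℝ (f i)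
  lipschitz : ∀ i x y, ‖gradient (f i) x - gradient (f i) y‖ ≤ L * ‖x - y‖

/-- `G i x a`, with the data point `a` drawn from the local distribution `D i`, is an unbiased
stochastic gradient of `f i` at `x`, of variance at most `σ ^ 2`. -/
structure IsGradientOracle {d N : ℕ} {A : Type*} [MeasurableSpace A] (f : Fin N → Vec d → ℝ)
    (D : Fin N → Measure A) (G : Fin N → Vec d → A → Vec d) (σ : ℝ) : Prop where
  measurable : ∀ i, Measurable (Function.uncurry (G i))
  memLp : ∀ i x, MemLp (G i x) 2 (D i)
  unbiased : ∀ i x, ∫ a, G i x a ∂(D i) = gradient (f i) x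
  variance_le : ∀ i x, ∫ a, ‖G i x a - gradient (f i) x‖ ^ 2 ∂(D i) ≤ σ ^ 2

/-- The randomized map `x ↦ C x z`, with seed `z` of law `κ`, is an `ω`-compression operator. -/
structure IsCompressor {d : ℕ} {Z : Type*} [MeasurableSpace Z] (κ : Measure Z)
    (C : Vec d → Z → Vec d) (ω : ℝ) : Prop where
  measurable : Measurable (Function.uncurry C)
  memLp : ∀ x, MemLp (C x) 2 κ
  unbiased : ∀ x, ∫ z, C x z ∂κ = x
  variance_le : ∀ x, ∫ z, ‖C x z - x‖ ^ 2 ∂κ ≤ ω * ‖x‖ ^ 2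

/-- The randomness of one communication round: the two sets of clients, and for every client two
minibatches of `b` data points and two seeds of the compression operator. In each pair the first
component belongs to the update of the shifts, the second one to the update of the model. -/
abbrev RoundDraw (N b : ℕ) (A Z : Type*) : Type _ :=
  (Finset (Fin N) × Finset (Fin N)) ×
    ((Fin N → Fin b → A) × (Fin N → Fin b → A)) × ((Fin N → Z) × (Fin N → Z))

/-- The law of the randomness of a round: everything is independent, the sets of clients are
uniform among the sets of size `S`, data points of client `i` have law `D i`, seeds law `κ`. -/
noncomputable def roundLaw {N : ℕ} (S b : ℕ) {A Z : Type*} [MeasurableSpace A] [MeasurableSpace Z]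
    (D : Fin N → Measure A) (κ : Measure Z) : Measure (RoundDraw N b A Z) :=
  let clients : Measure (Finset (Fin N)) := uniformOn {s | s.card = S}
  let batches : Measure (Fin N → Fin b → A) := Measure.pi fun i => Measure.pi fun _ => D i
  let seeds : Measure (Fin N → Z) := Measure.pi fun _ => κ
  (clients.prod clients).prod ((batches.prod batches).prod (seeds.prod seeds))

/-- The rounds are independent, each with the law `roundLaw`. -/
structure IsRoundSampling {N : ℕ} (S b : ℕ) {A Z Ω : Type*} [MeasurableSpace A]
    [MeasurableSpace Z] [MeasurableSpace Ω] (D : Fin N → Measure A) (κ : Measure Z)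
    (P : Measure Ω) (ρ : ℕ → Ω → RoundDraw N b A Z) : Prop where
  measurable : ∀ t, Measurable (ρ t)
  law : ∀ t, P.map (ρ t) = roundLaw S b D κ
  indep : iIndepFun ρ P

/-- The stochastic gradient with the minibatch `ξ` of size `b`. -/
noncomputable def minibatchGrad {d b : ℕ} {A : Type*} (g : Vec d → A → Vec d) (x : Vec d)
    (ξ : Fin b → A) : Vec d :=
  (b : ℝ)⁻¹ • ∑ k, g x (ξ k)

/-- The state of COFIG: the model `x`, the local shifts `h i`, the global shift `hbar`. -/
structure CofigState (d N : ℕ) where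
  x : Vec d
  h : Fin N → Vec d
  hbar : Vec d

/-- The initial state: model `x₀`, local shifts `h₀ i`, global shift their average. -/
noncomputable def cofigInit {d N : ℕ} (x₀ : Vec d) (h₀ : Fin N → Vec d) : CofigState d N :=
  ⟨x₀, h₀, (N : ℝ)⁻¹ • ∑ i, h₀ i⟩

/-- One communication round of COFIG with step size `η` and shift step size `α`. If `reuse` holds,
a client that takes part in both updates uses the same minibatch for both messages (with two
independent compressions); otherwise it draws a new minibatch for the second message. -/
noncomputable def cofigStep {d N : ℕ} (S b : ℕ) {A Z : Type*} (G : Fin N → Vec d → A → Vec d)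
    (C : Vec d → Z → Vec d) (η α : ℝ) (reuse : Bool) (s : CofigState d N)
    (r : RoundDraw N b A Z) : CofigState d N :=
  let clients := r.1.1
  let clients' := r.1.2
  let batch := r.2.1.1
  let batch' := if reuse then r.2.1.1 else r.2.1.2
  let seed := r.2.2.1
  let seed' := r.2.2.2
  let u : Fin N → Vec d := fun i => C (minibatchGrad (G i) s.x (batch i) - s.h i) (seed i)
  let v : Fin N → Vec d := fun i => C (minibatchGrad (G i) s.x (batch' i) - s.h i) (seed' i)
  let g : Vec d := (S : ℝ)⁻¹ • ∑ i ∈ clients', v i + s.hbar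
  { x := s.x - η • g
    h := fun i => if i ∈ clients then s.h i + α • u i else s.h i
    hbar := s.hbar + (α / N) • ∑ i ∈ clients, u i }

/-- The state of COFIG after `t` communication rounds with randomness `r 0, …, r (t - 1)`. -/
noncomputable def cofig {d N : ℕ} (S b : ℕ) {A Z : Type*} (G : Fin N → Vec d → A → Vec d)
    (C : Vec d → Z → Vec d) (η α : ℝ) (reuse : Bool) (x₀ : Vec d) (h₀ : Fin N → Vec d)
    (r : ℕ → RoundDraw N b A Z) : ℕ → CofigState d N
  | 0 => cofigInit x₀ h₀
  | t + 1 => cofigStep S b G C η α reuse (cofig S b G C η α reuse x₀ h₀ r t) (r t)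

/-- The error `(1/N) ∑ i, ‖h₀ i - ∇ f i x₀‖ ^ 2` of the initial shifts. -/
noncomputable def initialShiftError {d N : ℕ} (f : Fin N → Vec d → ℝ) (x₀ : Vec d)
    (h₀ : Fin N → Vec d) : ℝ :=
  (N : ℝ)⁻¹ * ∑ i, ‖h₀ i - gradient (f i) x₀‖ ^ 2

/-- The expectation of `φ` at an iterate drawn uniformly from `x^0, …, x^T` is well defined and
at most `ε`; here `X t` is the random iterate after `t` rounds. -/
def UniformIterateLE {d : ℕ} {Ω : Type*} [MeasurableSpace Ω] (P : Measure Ω) (X : ℕ → Ω → Vec d)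
    (φ : Vec d → ℝ) (T : ℕ) (ε : ℝ) : Prop :=
  (∀ t ≤ T, Integrable (fun w => φ (X t w)) P) ∧
    (∑ t ∈ Finset.range (T + 1), ∫ w, φ (X t w) ∂P) / (T + 1) ≤ ε

/-! Write `K = (1 + ω) / S` and `q = α * S / N`, so that `q * N * K = 1`. The server's gradient
estimate is unbiased, since `hbar` stays equal to the mean of the local shifts. Its second moment is
at most `‖∇f(x)‖²` plus `K` times (mean of `‖∇f_i(x) - h_i‖²` plus `σ² / b`). Everything therefore
rests on controlling the shift error.

The shift error is not followed directly: a Young inequality for `∇f_i(x^{t+1})` against `∇f_i(x^t)`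
would multiply the whole second moment of the step by `1/q`. Instead each client carries a
fictitious `Tracker`: a probability distribution on points, updated with the same weights `α` and at
the same times as `h_i`, so that `h_i` is a noisy version of the tracked mean gradient. By
smoothness and convexity of the squared norm, `‖∇f_i(x) - h_i‖²` is at most twice `L²` times the
tracked mean squared distance from `x`, plus twice the distance of `h_i` from the tracked gradient.
The first distance is an exact quadratic in `x`, so the noise of the step enters it with factor 1
and only the drift `∇f(x)` pays `1/q` (`integral_meanSqDist_le`). The second contracts at rate `q/2`
(`integral_meanSqShift_le`). Trackers depend on the sampled sets but not on the minibatches, and no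
joint law of the shift noise and the model noise is ever needed; hence reused and fresh minibatches
are treated alike.

Nonconvex case: function gap plus multiples of the two mean errors is a Lyapunov function
(`nonconvex_potential_decrease`). The drift term with its `1/q` requires `(Lη)³K ≲ q²`, that is `LηK
N^{2/3} ≲ 1`, which is the origin of `N^{2/3}`. Convex case: convexity bounds the drift term by a
tracked function value, which removes the `1/q`; only `(Lη)²K ≲ q`, that is `LηK√N ≲ 1`, is left
(`convex_potential_decrease`). Summing the decrease over the rounds (`sum_integral_le_of_lyapunov`)
and inserting `η` gives the number of rounds. -/

open scoped RealInnerProductSpace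

/-! ### Smooth and convex functions on a Hilbert space. -/

section SmoothFunctions

variable {E : Type*} [NormedAddCommGroup E] [InnerProductSpace ℝ E] [CompleteSpace E]

theorem hasDerivAt_comp_line {F : E → ℝ} (hF : Differentiable ℝ F) (x v : E) (t : ℝ) :
    HasDerivAt (fun t : ℝ => F (x + t • v)) ⟪gradient F (x + t • v), v⟫ t := by
  have h1 : HasDerivAt (fun t : ℝ => x + t • v) v t := by
    simpa using ((hasDerivAt_id t).smul_const v).const_add x
  have h2 := (hF (x + t • v)).hasFDerivAt.comp_hasDerivAt t h1
  rw [inner_gradient_left]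
  exact h2

theorem le_quadratic_of_lipschitz_gradient {F : E → ℝ} {L : ℝ} (hF : Differentiable ℝ F)
    (hL : ∀ x y, ‖gradient F x - gradient F y‖ ≤ L * ‖x - y‖) (x y : E) :
    F y ≤ F x + ⟪gradient F x, y - x⟫ + L / 2 * ‖y - x‖ ^ 2 := by
  set v := y - x with hv
  let φ : ℝ → ℝ := fun t => F (x + t • v) - t * ⟪gradient F x, v⟫ - L / 2 * t ^ 2 * ‖v‖ ^ 2
  have hφ : ∀ t, HasDerivAt φ
      (⟪gradient F (x + t • v), v⟫ - ⟪gradient F x, v⟫ - L * t * ‖v‖ ^ 2) t := by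
    intro t
    have h1 := hasDerivAt_comp_line hF x v t
    have h2 : HasDerivAt (fun t : ℝ => t * ⟪gradient F x, v⟫) (1 * ⟪gradient F x, v⟫) t :=
      (hasDerivAt_id t).mul_const _
    have h3 : HasDerivAt (fun t : ℝ => L / 2 * t ^ 2 * ‖v‖ ^ 2)
        (L / 2 * (2 * t) * ‖v‖ ^ 2) t := by
      simpa using (((hasDerivAt_pow 2 t).const_mul (L / 2)).mul_const (‖v‖ ^ 2))
    refine ((h1.sub h2).sub h3).congr_deriv ?_
    ring
  have hanti : AntitoneOn φ (Set.Icc 0 1) := by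
    apply antitoneOn_of_deriv_nonpos (convex_Icc 0 1)
    · exact fun t _ => (hφ t).continuousAt.continuousWithinAt
    · exact fun t _ => (hφ t).differentiableAt.differentiableWithinAt
    · intro t ht
      rw [interior_Icc] at ht
      rw [(hφ t).deriv, ← inner_sub_left]
      have h1 := real_inner_le_norm (gradient F (x + t • v) - gradient F x) v
      have h2 := hL (x + t • v) x
      rw [add_sub_cancel_left, norm_smul, Real.norm_of_nonneg ht.1.le] at h2
      nlinarith [norm_nonneg v, mul_le_mul_of_nonneg_right h2 (norm_nonneg v)]
  have := hanti (Set.left_mem_Icc.2 zero_le_one) (Set.right_mem_Icc.2 zero_le_one) zero_le_one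
  simp only [φ] at this
  simp only [one_smul, zero_smul, hv, add_sub_cancel, add_zero] at this
  rw [← hv] at this
  linarith

/-- A gradient step of length `s` cannot go below `m`; `s = 1 / L` is optimal. The case `L = 0` is
kept: there arbitrarily long steps force the gradient to vanish. -/
theorem sq_norm_gradient_le_of_lower_bound {F : E → ℝ} {L m : ℝ} (hF : Differentiable ℝ F)
    (hL : ∀ x y, ‖gradient F x - gradient F y‖ ≤ L * ‖x - y‖) (hL0 : 0 ≤ L)
    (hm : ∀ x, m ≤ F x) (x : E) : ‖gradient F x‖ ^ 2 ≤ 2 * L * (F x - m) := by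
  have key : ∀ s : ℝ, s * ‖gradient F x‖ ^ 2 - L / 2 * s ^ 2 * ‖gradient F x‖ ^ 2 ≤ F x - m := by
    intro s
    have h1 := le_quadratic_of_lipschitz_gradient hF hL x (x - s • gradient F x)
    have h2 := hm (x - s • gradient F x)
    rw [sub_sub_cancel_left, inner_neg_right, inner_smul_right, real_inner_self_eq_norm_sq,
      norm_neg, norm_smul, mul_pow, Real.norm_eq_abs, sq_abs] at h1
    linarith
  rcases hL0.eq_or_lt with rfl | hpos
  · by_contra! h
    have hp : 0 < ‖gradient F x‖ ^ 2 := by linarith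
    -- With `L = 0` the decrease is linear in `s`; this `s` makes it `F x - m + 1`, one more than is
    -- available.
    have := key ((F x - m + 1) / ‖gradient F x‖ ^ 2)
    rw [div_mul_cancel₀ _ hp.ne'] at this
    linarith
  · have := key (1 / L)
    have h3 : 1 / L * ‖gradient F x‖ ^ 2 - L / 2 * (1 / L) ^ 2 * ‖gradient F x‖ ^ 2
        = ‖gradient F x‖ ^ 2 / (2 * L) := by field_simp; ring
    rw [h3, div_le_iff₀ (by positivity)] at this
    linarith

theorem ConvexOn.add_inner_gradient_le {F : E → ℝ} (hF : Differentiable ℝ F)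
    (hc : ConvexOn ℝ Set.univ F) (x y : E) : F x + ⟪gradient F x, y - x⟫ ≤ F y := by
  have hg : ConvexOn ℝ Set.univ (fun t : ℝ => F (x + t • (y - x))) := by
    have := hc.comp_affineMap (AffineMap.lineMap x y : ℝ →ᵃ[ℝ] E)
    simp only [Set.preimage_univ] at this
    refine this.congr fun t _ => ?_
    simp [AffineMap.lineMap_apply, add_comm]
  have hd := hasDerivAt_comp_line hF x (y - x) 0
  have h1 := hg.deriv_le_slope (Set.mem_univ 0) (Set.mem_univ 1) zero_lt_one hd.differentiableAt
  rw [hd.deriv, slope_def_field] at h1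
  simp only [zero_smul, add_zero, one_smul, add_sub_cancel, sub_zero, div_one] at h1
  linarith

end SmoothFunctions

namespace IsSmoothFamily

variable {d N : ℕ} {f : Fin N → Vec d → ℝ} {L : ℝ}

theorem hasGradientAt_avgLoss (hf : IsSmoothFamily f L) (x : Vec d) :
    HasGradientAt (avgLoss f) ((N : ℝ)⁻¹ • ∑ i, gradient (f i) x) x := by
  rw [hasGradientAt_iff_hasFDerivAt]
  have h : HasFDerivAt (fun y => ∑ i, f i y) (∑ i, fderiv ℝ (f i) x) x :=
    HasFDerivAt.fun_sum fun i _ => (hf.differentiable i x).hasFDerivAt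
  refine (h.const_mul (N : ℝ)⁻¹).congr_fderiv ?_
  rw [map_smulₛₗ, map_sum]
  simp [toDual_gradient]

theorem gradient_avgLoss (hf : IsSmoothFamily f L) (x : Vec d) :
    gradient (avgLoss f) x = (N : ℝ)⁻¹ • ∑ i, gradient (f i) x :=
  (hf.hasGradientAt_avgLoss x).gradient

theorem differentiable_avgLoss (hf : IsSmoothFamily f L) : Differentiable ℝ (avgLoss f) :=
  fun x => (hf.hasGradientAt_avgLoss x).differentiableAt

theorem lipschitz_avgLoss (hf : IsSmoothFamily f L) (hN : 1 ≤ N) (x y : Vec d) :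
    ‖gradient (avgLoss f) x - gradient (avgLoss f) y‖ ≤ L * ‖x - y‖ := by
  have hN' : (0 : ℝ) < N := by exact_mod_cast hN
  rw [hf.gradient_avgLoss, hf.gradient_avgLoss, ← smul_sub, ← Finset.sum_sub_distrib, norm_smul,
    norm_inv, Real.norm_natCast, inv_mul_le_iff₀ hN']
  calc ‖∑ i, (gradient (f i) x - gradient (f i) y)‖
      ≤ ∑ i, ‖gradient (f i) x - gradient (f i) y‖ := norm_sum_le _ _
    _ ≤ ∑ _i : Fin N, L * ‖x - y‖ := Finset.sum_le_sum fun i _ => hf.lipschitz i x y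
    _ = N * (L * ‖x - y‖) := by simp

theorem continuous_gradient (hf : IsSmoothFamily f L) (hL : 0 ≤ L) (i : Fin N) :
    Continuous (gradient (f i)) :=
  (LipschitzWith.of_dist_le_mul (K := L.toNNReal) fun x y => by
    rw [dist_eq_norm, dist_eq_norm, Real.coe_toNNReal L hL]
    exact hf.lipschitz i x y).continuous

theorem continuous_gradient_avgLoss (hf : IsSmoothFamily f L) (hL : 0 ≤ L) :
    Continuous (gradient (avgLoss f)) := by
  have : gradient (avgLoss f) = fun x => (N : ℝ)⁻¹ • ∑ i, gradient (f i) x :=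
    funext hf.gradient_avgLoss
  rw [this]
  have := hf.continuous_gradient hL
  fun_prop

end IsSmoothFamily

/-! ### Random iterations driven by independent draws, and the Lyapunov estimate. -/

section RandomIteration

variable {E R Ω : Type*} [MeasurableSpace E] [MeasurableSpace R] [MeasurableSpace Ω]

/-- The state after `t` steps of the random iteration `s ↦ step s (r t)`. -/
def randomIterate (step : E → R → E) (s₀ : E) (r : ℕ → R) : ℕ → E
  | 0 => s₀
  | t + 1 => step (randomIterate step s₀ r t) (r t)

variable {step : E → R → E} {s₀ : E} {P : Measure Ω} {ρ : ℕ → Ω → R}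

theorem measurable_randomIterate (hstep : Measurable (Function.uncurry step))
    (hρ : ∀ t, Measurable (ρ t)) (t : ℕ) :
    Measurable fun w => randomIterate step s₀ (fun s => ρ s w) t := by
  induction t with
  | zero => exact measurable_const
  | succ t ih => exact hstep.comp (ih.prodMk (hρ t))

/-- The state at time `t` depends measurably on the draws before `t` only, which makes it
independent of draw `t`. -/
theorem exists_randomIterate_eq (hstep : Measurable (Function.uncurry step)) (s₀ : E) (t : ℕ) :
    ∃ F : (Finset.range t → R) → E, Measurable F ∧
      ∀ r : ℕ → R, randomIterate step s₀ r t = F fun i => r i := by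
  induction t with
  | zero => exact ⟨fun _ => s₀, measurable_const, fun _ => rfl⟩
  | succ t ih =>
    obtain ⟨F, hF, hFr⟩ := ih
    refine ⟨fun r => step (F fun i => r ⟨i, Finset.range_subset_range.2 t.le_succ i.2⟩)
      (r ⟨t, Finset.self_mem_range_succ t⟩), ?_, fun r => ?_⟩
    · refine hstep.comp (Measurable.prodMk (hF.comp ?_) (measurable_pi_apply _))
      exact measurable_pi_lambda _ fun i => measurable_pi_apply _
    · simp only [randomIterate, hFr]

theorem indepFun_randomIterate (hstep : Measurable (Function.uncurry step))
    (hρ : ∀ t, Measurable (ρ t)) (hind : iIndepFun ρ P) (t : ℕ) :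
    (fun w => randomIterate step s₀ (fun s => ρ s w) t) ⟂ᵢ[P] ρ t := by
  obtain ⟨F, hF, hFr⟩ := exists_randomIterate_eq hstep s₀ t
  have h := hind.indepFun_finset (Finset.range t) {t} (by simp) hρ
  have h2 := h.comp hF (measurable_pi_apply (⟨t, Finset.mem_singleton_self t⟩ : ({t} : Finset ℕ)))
  have e : (fun w => randomIterate step s₀ (fun s => ρ s w) t)
      = F ∘ fun w (i : Finset.range t) => ρ i w := funext fun w => hFr _
  rw [e]
  exact h2

variable {ν : Measure R} [IsProbabilityMeasure P] [IsProbabilityMeasure ν]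

theorem lintegral_randomIterate_succ (hstep : Measurable (Function.uncurry step))
    (hρ : ∀ t, Measurable (ρ t)) (hind : iIndepFun ρ P) (hlaw : ∀ t, P.map (ρ t) = ν)
    {V : E → ENNReal} (hV : Measurable V) (t : ℕ) :
    ∫⁻ w, V (randomIterate step s₀ (fun s => ρ s w) (t + 1)) ∂P
      = ∫⁻ w, ∫⁻ r, V (step (randomIterate step s₀ (fun s => ρ s w) t) r) ∂ν ∂P := by
  have hm := measurable_randomIterate (s₀ := s₀) hstep hρ t
  have hprod := (indepFun_randomIterate (s₀ := s₀) hstep hρ hind t).map_prod_eq_prod_map_map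
    hm.aemeasurable (hρ t).aemeasurable
  rw [hlaw t] at hprod
  have hVs : Measurable fun p : E × R => V (step p.1 p.2) := hV.comp hstep
  have : IsProbabilityMeasure (P.map fun w => randomIterate step s₀ (fun s => ρ s w) t) :=
    Measure.isProbabilityMeasure_map hm.aemeasurable
  calc ∫⁻ w, V (randomIterate step s₀ (fun s => ρ s w) (t + 1)) ∂P
      = ∫⁻ p, V (step p.1 p.2)
          ∂(P.map fun w => (randomIterate step s₀ (fun s => ρ s w) t, ρ t w)) := by
        rw [lintegral_map hVs (hm.prodMk (hρ t))]
        rfl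
    _ = ∫⁻ s, ∫⁻ r, V (step s r) ∂ν
          ∂(P.map fun w => randomIterate step s₀ (fun s => ρ s w) t) := by
        rw [hprod, lintegral_prod _ hVs.aemeasurable]
    _ = _ := by
        rw [lintegral_map hVs.lintegral_prod_right' hm]

/-- A Foster–Lyapunov estimate: if `V` decreases in conditional mean by `W` up to an error `B`, on
a set of states `I` that the iteration does not leave, then the time averages of `W` are bounded. -/
theorem sum_integral_le_of_lyapunov (hstep : Measurable (Function.uncurry step))
    (hρ : ∀ t, Measurable (ρ t)) (hind : iIndepFun ρ P) (hlaw : ∀ t, P.map (ρ t) = ν)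
    {I : E → Prop} (hI₀ : I s₀) (hI : ∀ s r, I s → I (step s r))
    {V W : E → ℝ} (hV : Measurable V) (hW : Measurable W) (hV0 : ∀ s, I s → 0 ≤ V s)
    (hW0 : ∀ s, I s → 0 ≤ W s) {B : ℝ} (hB : 0 ≤ B)
    (hint : ∀ s, I s → Integrable (fun r => V (step s r)) ν)
    (hdec : ∀ s, I s → ∫ r, V (step s r) ∂ν + W s ≤ V s + B) :
    (∀ t, Integrable (fun w => W (randomIterate step s₀ (fun s => ρ s w) t)) P) ∧
      ∀ T, ∑ t ∈ Finset.range T, ∫ w, W (randomIterate step s₀ (fun s => ρ s w) t) ∂P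
        ≤ V s₀ + T * B := by
  set X : ℕ → Ω → E := fun t w => randomIterate step s₀ (fun s => ρ s w) t with hX
  have hXm : ∀ t, Measurable (X t) := measurable_randomIterate hstep hρ
  have hXI : ∀ t w, I (X t w) := by
    intro t w
    induction t with
    | zero => exact hI₀
    | succ t ih => exact hI _ _ ih
  -- Integrals in `[0, ∞]` avoid any a priori integrability of `V` along the iteration; finiteness
  -- comes out of the telescoped inequality, as the start is deterministic.
  have h1 : ∀ t, ∫⁻ w, ENNReal.ofReal (V (X (t + 1) w)) ∂P + ∫⁻ w, ENNReal.ofReal (W (X t w)) ∂P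
      ≤ ∫⁻ w, ENNReal.ofReal (V (X t w)) ∂P + ENNReal.ofReal B := by
    intro t
    have hWm : Measurable fun w => ENNReal.ofReal (W (X t w)) :=
      (hW.comp (hXm t)).ennreal_ofReal
    calc _ = ∫⁻ w, (∫⁻ r, ENNReal.ofReal (V (step (X t w) r)) ∂ν + ENNReal.ofReal (W (X t w)))
            ∂P := by
          rw [lintegral_add_right _ hWm]
          congr 1
          exact lintegral_randomIterate_succ hstep hρ hind hlaw hV.ennreal_ofReal t
      _ ≤ ∫⁻ w, (ENNReal.ofReal (V (X t w)) + ENNReal.ofReal B) ∂P := by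
          refine lintegral_mono fun w => ?_
          have hs := hXI t w
          rw [← ofReal_integral_eq_lintegral_ofReal (hint _ hs)
            (Filter.Eventually.of_forall fun r => hV0 _ (hI _ _ hs)),
            ← ENNReal.ofReal_add (integral_nonneg fun r => hV0 _ (hI _ _ hs)) (hW0 _ hs),
            ← ENNReal.ofReal_add (hV0 _ hs) hB]
          exact ENNReal.ofReal_le_ofReal (hdec _ hs)
      _ = _ := by
          rw [lintegral_add_right _ measurable_const]
          simp
  have h2 : ∀ T, ∫⁻ w, ENNReal.ofReal (V (X T w)) ∂P
      + ∑ t ∈ Finset.range T, ∫⁻ w, ENNReal.ofReal (W (X t w)) ∂P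
      ≤ ENNReal.ofReal (V s₀) + T * ENNReal.ofReal B := by
    intro T
    induction T with
    | zero => simp [hX, randomIterate]
    | succ T ih =>
      rw [Finset.sum_range_succ, Nat.cast_succ, add_mul, one_mul]
      calc _ = (∫⁻ w, ENNReal.ofReal (V (X (T + 1) w)) ∂P
              + ∫⁻ w, ENNReal.ofReal (W (X T w)) ∂P)
              + ∑ t ∈ Finset.range T, ∫⁻ w, ENNReal.ofReal (W (X t w)) ∂P := by ring
        _ ≤ (∫⁻ w, ENNReal.ofReal (V (X T w)) ∂P + ENNReal.ofReal B)
              + ∑ t ∈ Finset.range T, ∫⁻ w, ENNReal.ofReal (W (X t w)) ∂P :=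
            add_le_add (h1 T) le_rfl
        _ = (∫⁻ w, ENNReal.ofReal (V (X T w)) ∂P
              + ∑ t ∈ Finset.range T, ∫⁻ w, ENNReal.ofReal (W (X t w)) ∂P)
              + ENNReal.ofReal B := by ring
        _ ≤ (ENNReal.ofReal (V s₀) + T * ENNReal.ofReal B) + ENNReal.ofReal B := by gcongr
        _ = _ := by ring
  have hfin : ∀ T : ℕ, ENNReal.ofReal (V s₀) + T * ENNReal.ofReal B ≠ ⊤ := fun T =>
    ENNReal.add_ne_top.2 ⟨ENNReal.ofReal_ne_top,
      ENNReal.mul_ne_top (ENNReal.natCast_ne_top T) ENNReal.ofReal_ne_top⟩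
  have h3 : ∀ t, ∫⁻ w, ENNReal.ofReal (W (X t w)) ∂P ≠ ⊤ := by
    intro t
    refine ne_top_of_le_ne_top (hfin (t + 1)) (le_trans ?_ (h2 (t + 1)))
    exact (Finset.single_le_sum (f := fun t => ∫⁻ w, ENNReal.ofReal (W (X t w)) ∂P)
      (fun _ _ => zero_le) (Finset.self_mem_range_succ t)).trans le_add_self
  have hWi : ∀ t, Integrable (fun w => W (X t w)) P := fun t =>
    (lintegral_ofReal_ne_top_iff_integrable (hW.comp (hXm t)).aestronglyMeasurable
      (Filter.Eventually.of_forall fun w => hW0 _ (hXI t w))).1 (h3 t)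
  refine ⟨hWi, fun T => ?_⟩
  have h4 : ∑ t ∈ Finset.range T, ∫⁻ w, ENNReal.ofReal (W (X t w)) ∂P
      = ENNReal.ofReal (∑ t ∈ Finset.range T, ∫ w, W (X t w) ∂P) := by
    rw [ENNReal.ofReal_sum_of_nonneg fun t _ => integral_nonneg fun w => hW0 _ (hXI t w)]
    exact Finset.sum_congr rfl fun t _ => (ofReal_integral_eq_lintegral_ofReal (hWi t)
      (Filter.Eventually.of_forall fun w => hW0 _ (hXI t w))).symm
  have h5 : ENNReal.ofReal (V s₀) + T * ENNReal.ofReal B = ENNReal.ofReal (V s₀ + T * B) := by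
    rw [ENNReal.ofReal_add (hV0 _ hI₀) (by positivity), ENNReal.ofReal_mul (by positivity),
      ENNReal.ofReal_natCast]
  have h6 := le_add_self.trans (h2 T)
  rw [h4, h5] at h6
  exact (ENNReal.ofReal_le_ofReal_iff (add_nonneg (hV0 _ hI₀) (by positivity))).1 h6

end RandomIteration

theorem MeasureTheory.MemLp.integrable_inner_of_memLp {α E : Type*} [MeasurableSpace α]
    [NormedAddCommGroup E] [InnerProductSpace ℝ E] {μ : Measure α} {f g : α → E}
    (hf : MemLp f 2 μ) (hg : MemLp g 2 μ) : Integrable (fun a => ⟪f a, g a⟫) μ :=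
  (hf.norm.integrable_mul hg.norm).mono' (hf.1.inner hg.1)
    (Filter.Eventually.of_forall fun a => norm_inner_le_norm (f a) (g a))

/-! ### Uniform sampling of `S` clients without replacement. -/

section ClientSampling

variable {N S : ℕ}

theorem isProbabilityMeasure_uniformOn_card (hSN : S ≤ N) :
    IsProbabilityMeasure (uniformOn {s : Finset (Fin N) | s.card = S}) := by
  refine isProbabilityMeasure_uniformOn' (Set.toFinite _) ?_ (Set.toFinite _).measurableSet
  obtain ⟨s, -, hs⟩ := Finset.exists_subset_card_eq (s := (Finset.univ : Finset (Fin N))) (n := S)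
    (by simpa using hSN)
  exact ⟨s, hs⟩

theorem uniformOn_card_real_superset (t : Finset (Fin N)) (ht : t.card ≤ S) :
    (uniformOn {s : Finset (Fin N) | s.card = S}).real {s | t ⊆ s}
      = (N - t.card).choose (S - t.card) / N.choose S := by
  classical
  have h1 : {s : Finset (Fin N) | s.card = S}
      = (Finset.powersetCard S Finset.univ : Finset (Finset (Fin N))) := by
    ext s; simp
  have h2 : {s : Finset (Fin N) | t ⊆ s}
      = (Finset.univ.filter (t ⊆ ·) : Finset (Finset (Fin N))) := by
    ext s; simp
  have h3 := Finset.card_filter_powersetCard_subset t Finset.univ S (Finset.subset_univ _) ht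
  rw [measureReal_def, h1, h2, uniformOn_apply_finset, Finset.inter_filter,
    Finset.inter_univ, h3]
  simp

/-- The indicator of the event that client `i` is selected. -/
noncomputable def selected (i : Fin N) (s : Finset (Fin N)) : ℝ := if i ∈ s then 1 else 0

theorem measurable_selected (i : Fin N) : Measurable (selected i) := measurable_of_finite _

theorem integral_selected_mul_selected_eq (i j : Fin N) :
    ∫ s, selected i s * selected j s ∂(uniformOn {s : Finset (Fin N) | s.card = S})
      = (uniformOn {s : Finset (Fin N) | s.card = S}).real {s | {i, j} ⊆ s} := by
  classical
  rw [← integral_indicator_one (Set.toFinite _).measurableSet]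
  congr 1
  ext s
  by_cases hi : i ∈ s <;> by_cases hj : j ∈ s <;>
    simp [selected, hi, hj, Finset.insert_subset_iff, Set.indicator]

theorem integral_selected_mul_self (hS : 1 ≤ S) (hSN : S ≤ N) (i : Fin N) :
    ∫ s, selected i s * selected i s ∂(uniformOn {s : Finset (Fin N) | s.card = S}) = S / N := by
  rw [integral_selected_mul_selected_eq, uniformOn_card_real_superset _ (by simpa using hS)]
  obtain ⟨k, rfl⟩ : ∃ k, S = k + 1 := ⟨S - 1, by omega⟩
  obtain ⟨n, rfl⟩ : ∃ n, N = n + 1 := ⟨N - 1, by omega⟩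
  have h := Nat.add_one_mul_choose_eq n k
  have hp : 0 < (n + 1).choose (k + 1) := Nat.choose_pos hSN
  simp only [Finset.insert_eq_of_mem (Finset.mem_singleton_self i), Finset.card_singleton, Nat.add_sub_cancel]
  rw [div_eq_div_iff (by positivity) (by positivity)]
  have : ((n + 1 : ℕ) : ℝ) * n.choose k = (n + 1).choose (k + 1) * (k + 1 : ℕ) := by
    exact_mod_cast h
  linarith

theorem integral_selected (hS : 1 ≤ S) (hSN : S ≤ N) (i : Fin N) :
    ∫ s, selected i s ∂(uniformOn {s : Finset (Fin N) | s.card = S}) = S / N := by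
  rw [← integral_selected_mul_self hS hSN i]
  congr 1
  ext s
  by_cases hi : i ∈ s <;> simp [selected, hi]

/-- Sampling without replacement is negatively correlated: `p = S(S-1) / (N(N-1)) ≤ (S/N)²`. The
case `S = 1`, where `p = 0`, is separate because the superset count needs sets of at least two
elements. -/
theorem exists_integral_selected_mul_selected (hS : 1 ≤ S) (hSN : S ≤ N) :
    ∃ p : ℝ, 0 ≤ p ∧ p ≤ (S / N : ℝ) ^ 2 ∧ ∀ i j : Fin N, i ≠ j →
      ∫ s, selected i s * selected j s ∂(uniformOn {s : Finset (Fin N) | s.card = S}) = p := by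
  rcases hS.eq_or_lt with rfl | hS2
  · refine ⟨0, le_rfl, by positivity, fun i j hij => ?_⟩
    rw [integral_selected_mul_selected_eq, uniformOn, measureReal_def, cond_apply
      (Set.toFinite _).measurableSet]
    have : {s : Finset (Fin N) | s.card = 1} ∩ {s | {i, j} ⊆ s} = ∅ := by
      ext s
      simp only [Set.mem_inter_iff, Set.mem_ofPred_eq, Set.mem_empty_iff_false, iff_false, not_and]
      intro hs h
      have := Finset.card_le_card h
      rw [Finset.card_pair hij] at this
      omega
    simp [this]
  · refine ⟨(N - 2).choose (S - 2) / N.choose S, by positivity, ?_, fun i j hij => ?_⟩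
    · obtain ⟨k, rfl⟩ : ∃ k, S = k + 2 := ⟨S - 2, by omega⟩
      obtain ⟨n, rfl⟩ : ∃ n, N = n + 2 := ⟨N - 2, by omega⟩
      have h1 : ((n : ℝ) + 2) * (n + 1).choose (k + 1) = (n + 2).choose (k + 2) * (k + 2) := by
        exact_mod_cast Nat.add_one_mul_choose_eq (n + 1) (k + 1)
      have h2 : ((n : ℝ) + 1) * n.choose k = (n + 1).choose (k + 1) * (k + 1) := by
        exact_mod_cast Nat.add_one_mul_choose_eq n k
      have hp : (0 : ℝ) < (n + 2).choose (k + 2) := by exact_mod_cast Nat.choose_pos hSN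
      have hkn : (k : ℝ) ≤ n := by exact_mod_cast (by omega : k ≤ n)
      have h3 : (n.choose k : ℝ) / (n + 2).choose (k + 2)
          = (k + 2) / (n + 2) * ((k + 1) / (n + 1)) := by
        rw [div_mul_div_comm, div_eq_div_iff hp.ne' (by positivity)]
        linear_combination (n + 2) * h2 + (k + 1) * h1
      simp only [Nat.add_sub_cancel]
      push_cast
      rw [h3, pow_two]
      have h4 : ((k : ℝ) + 1) / (n + 1) ≤ (k + 2) / (n + 2) := by
        rw [div_le_div_iff₀ (by positivity) (by positivity)]
        nlinarith
      gcongr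
    · rw [integral_selected_mul_selected_eq, uniformOn_card_real_superset _
        (by rw [Finset.card_pair hij]; omega), Finset.card_pair hij]

variable {E Ω : Type*} [NormedAddCommGroup E] [InnerProductSpace ℝ E]
  [MeasurableSpace Ω]

theorem integrable_selected_smul {F : Type*} [NormedAddCommGroup F] [NormedSpace ℝ F]
    {μ : Measure Ω} [IsProbabilityMeasure μ] {c : Finset (Fin N) → ℝ} {v : Ω → F}
    (hSN : S ≤ N) (hv : Integrable v μ) :
    Integrable (fun z => c z.1 • v z.2)
      ((uniformOn {s : Finset (Fin N) | s.card = S}).prod μ) := by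
  have := isProbabilityMeasure_uniformOn_card hSN
  exact (Integrable.of_finite (f := c)).smul_prod hv

/-- The average of vectors `v i` over a random set of `S` clients. -/
noncomputable def sampleMean (S : ℕ) (v : Fin N → Ω → E) (z : Finset (Fin N) × Ω) : E :=
  (S : ℝ)⁻¹ • ∑ i, selected i z.1 • v i z.2

variable {μ : Measure Ω} [IsProbabilityMeasure μ] {v : Fin N → Ω → E} {m : Fin N → E}
  {τ : Fin N → ℝ}

theorem memLp_sampleMean (hSN : S ≤ N) (hv : ∀ i, MemLp (v i) 2 μ) :
    MemLp (sampleMean S v) 2 ((uniformOn {s : Finset (Fin N) | s.card = S}).prod μ) := by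
  have := isProbabilityMeasure_uniformOn_card hSN
  suffices h : ∀ i, MemLp (fun z : Finset (Fin N) × Ω => selected i z.1 • v i z.2) 2
      ((uniformOn {s : Finset (Fin N) | s.card = S}).prod μ) from
    (memLp_finsetSum Finset.univ fun i _ => h i).const_smul (S : ℝ)⁻¹
  intro i
  have h1 : MemLp (fun z : Finset (Fin N) × Ω => v i z.2) 2
      ((uniformOn {s : Finset (Fin N) | s.card = S}).prod μ) :=
    (hv i).comp_measurePreserving measurePreserving_snd
  have h2 : AEStronglyMeasurable (fun z : Finset (Fin N) × Ω => selected i z.1)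
      ((uniformOn {s : Finset (Fin N) | s.card = S}).prod μ) :=
    ((measurable_selected i).comp measurable_fst).aestronglyMeasurable
  refine h1.of_le (h2.smul h1.1) (Filter.Eventually.of_forall fun z => ?_)
  by_cases hi : i ∈ z.1 <;> simp [selected, hi]

theorem integral_sampleMean (hS : 1 ≤ S) (hSN : S ≤ N) (hv : ∀ i, Integrable (v i) μ)
    (hm : ∀ i, ∫ w, v i w ∂μ = m i) :
    ∫ z, sampleMean S v z ∂((uniformOn {s : Finset (Fin N) | s.card = S}).prod μ)
      = (N : ℝ)⁻¹ • ∑ i, m i := by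
  have := isProbabilityMeasure_uniformOn_card hSN
  simp only [sampleMean]
  rw [integral_smul, integral_finsetSum _ fun i _ => integrable_selected_smul hSN (hv i)]
  have : ∀ i, ∫ z, selected i z.1 • v i z.2
      ∂((uniformOn {s : Finset (Fin N) | s.card = S}).prod μ) = (S / N : ℝ) • m i := by
    intro i
    rw [integral_prod_smul, integral_selected hS hSN, hm]
  simp only [this]
  rw [← Finset.smul_sum, smul_smul]
  congr 1
  have : (S : ℝ) ≠ 0 := by positivity
  field_simp

/-- Expanding the square, pairs `i ≠ j` have weight `p` and the diagonal has weight `S/N`.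
Completing the off-diagonal sum to `p * ‖∑ m i‖²` leaves `-p * ∑ ‖m i‖²`, which is dropped, and `p ≤
(S/N)²` finishes. -/
theorem integral_sq_norm_sampleMean_le (hS : 1 ≤ S) (hSN : S ≤ N) (hv : ∀ i, MemLp (v i) 2 μ)
    (hcross : ∀ i j, i ≠ j → ∫ w, ⟪v i w, v j w⟫ ∂μ = ⟪m i, m j⟫)
    (hτ : ∀ i, ∫ w, ‖v i w‖ ^ 2 ∂μ ≤ τ i) :
    ∫ z, ‖sampleMean S v z‖ ^ 2 ∂((uniformOn {s : Finset (Fin N) | s.card = S}).prod μ)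
      ≤ ‖(N : ℝ)⁻¹ • ∑ i, m i‖ ^ 2 + (S : ℝ)⁻¹ * ((N : ℝ)⁻¹ * ∑ i, τ i) := by
  have := isProbabilityMeasure_uniformOn_card hSN
  obtain ⟨p, hp0, hp, hpij⟩ := exists_integral_selected_mul_selected hS hSN
  have hS0 : (0 : ℝ) < S := by exact_mod_cast hS
  have hN0 : (0 : ℝ) < N := by exact_mod_cast hS.trans hSN
  have hint : ∀ i j, Integrable (fun w => ⟪v i w, v j w⟫) μ := fun i j =>
    (hv i).integrable_inner_of_memLp (hv j)
  have e1 : ∀ z, ‖sampleMean S v z‖ ^ 2 = ((S : ℝ)⁻¹) ^ 2 *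
      ∑ i, ∑ j, (selected i z.1 * selected j z.1) • ⟪v i z.2, v j z.2⟫ := by
    intro z
    rw [sampleMean, norm_smul, mul_pow, Real.norm_of_nonneg (by positivity),
      ← real_inner_self_eq_norm_sq (∑ i, _), sum_inner]
    simp only [inner_sum, inner_smul_left, inner_smul_right, smul_eq_mul]
    congr 1
    refine Finset.sum_congr rfl fun i _ => Finset.sum_congr rfl fun j _ => ?_
    simp
    ring
  -- The diagonal is written as the off-diagonal formula plus a correction, so that the double sum
  -- closes up to a square.
  have e2 : ∀ i j, ∫ z, (selected i z.1 * selected j z.1) • ⟪v i z.2, v j z.2⟫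
      ∂((uniformOn {s : Finset (Fin N) | s.card = S}).prod μ)
      ≤ p * ⟪m i, m j⟫ + if i = j then (S / N * τ i - p * ‖m i‖ ^ 2 : ℝ) else 0 := by
    intro i j
    rw [integral_prod_smul (fun s => selected i s * selected j s) (fun w => ⟪v i w, v j w⟫),
      smul_eq_mul]
    by_cases hij : i = j
    · subst hij
      rw [integral_selected_mul_self hS hSN, if_pos rfl]
      simp only [real_inner_self_eq_norm_sq]
      have := mul_le_mul_of_nonneg_left (hτ i) (by positivity : (0 : ℝ) ≤ S / N)
      linarith
    · rw [hpij i j hij, if_neg hij, hcross i j hij, add_zero]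
  simp only [e1]
  rw [integral_const_mul, integral_finsetSum _ fun i _ =>
    integrable_finsetSum _ fun j _ => integrable_selected_smul
      (c := fun s => selected i s * selected j s) hSN (hint i j)]
  have e3 : ∑ i, ∫ z, ∑ j, (selected i z.1 * selected j z.1) • ⟪v i z.2, v j z.2⟫
      ∂((uniformOn {s : Finset (Fin N) | s.card = S}).prod μ)
      ≤ (S / N : ℝ) ^ 2 * ‖∑ i, m i‖ ^ 2 + S / N * ∑ i, τ i := by
    calc _ ≤ ∑ i, ∑ j, (p * ⟪m i, m j⟫
          + if i = j then (S / N * τ i - p * ‖m i‖ ^ 2 : ℝ) else 0) := by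
          refine Finset.sum_le_sum fun i _ => ?_
          rw [integral_finsetSum _ fun j _ => integrable_selected_smul
            (c := fun s => selected i s * selected j s) hSN (hint i j)]
          exact Finset.sum_le_sum fun j _ => e2 i j
      _ = p * ‖∑ i, m i‖ ^ 2 + (S / N * ∑ i, τ i - p * ∑ i, ‖m i‖ ^ 2) := by
          simp only [Finset.sum_add_distrib, Finset.sum_ite_eq, Finset.mem_univ, if_true,
            Finset.sum_sub_distrib, ← Finset.mul_sum]
          rw [← real_inner_self_eq_norm_sq (∑ i, m i), sum_inner]
          simp only [inner_sum]
      _ ≤ _ := by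
          have h1 : 0 ≤ p * ∑ i, ‖m i‖ ^ 2 := by positivity
          have h2 := mul_le_mul_of_nonneg_right hp (sq_nonneg ‖∑ i, m i‖)
          linarith
  refine (mul_le_mul_of_nonneg_left e3 (by positivity)).trans_eq ?_
  rw [norm_smul, mul_pow, Real.norm_of_nonneg (by positivity)]
  field_simp

end ClientSampling

/-! ### Second moments of random vectors, minibatches and compressed vectors. -/

section SecondMoments

variable {Ω E : Type*} [MeasurableSpace Ω] [NormedAddCommGroup E] [InnerProductSpace ℝ E]
  {μ : Measure Ω} {X Y : Ω → E}

theorem integral_sq_norm_sub_const [CompleteSpace E] [IsProbabilityMeasure μ] (hX : MemLp X 2 μ) (a : E) :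
    ∫ w, ‖X w - a‖ ^ 2 ∂μ = ∫ w, ‖X w‖ ^ 2 ∂μ - 2 * ⟪a, ∫ w, X w ∂μ⟫ + ‖a‖ ^ 2 := by
  have h1 : Integrable X μ := hX.integrable one_le_two
  have h2 : Integrable (fun w => ‖X w‖ ^ 2) μ := hX.integrable_norm_pow two_ne_zero
  have h3 : Integrable (fun w => 2 * ⟪a, X w⟫) μ := (h1.const_inner a).const_mul 2
  have e : ∀ w, ‖X w - a‖ ^ 2 = ‖X w‖ ^ 2 - 2 * ⟪a, X w⟫ + ‖a‖ ^ 2 := by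
    intro w
    rw [norm_sub_sq_real, real_inner_comm]
  simp only [e]
  rw [integral_add (f := fun w => ‖X w‖ ^ 2 - 2 * ⟪a, X w⟫) (h2.sub h3) (integrable_const _),
    integral_sub h2 h3, integral_const_mul, integral_inner h1]
  simp

theorem integral_sq_norm_eq_add_integral_sq_norm_sub [CompleteSpace E] [IsProbabilityMeasure μ]
    {a : E} (hX : MemLp X 2 μ)
    (ha : ∫ w, X w ∂μ = a) :
    ∫ w, ‖X w‖ ^ 2 ∂μ = ‖a‖ ^ 2 + ∫ w, ‖X w - a‖ ^ 2 ∂μ := by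
  rw [integral_sq_norm_sub_const hX, ha, real_inner_self_eq_norm_sq]
  ring

theorem ProbabilityTheory.IndepFun.integral_inner [CompleteSpace E] [MeasurableSpace E] [BorelSpace E]
    (h : X ⟂ᵢ[μ] Y) (hX : Integrable X μ) (hY : Integrable Y μ) :
    ∫ w, ⟪X w, Y w⟫ ∂μ = ⟪∫ w, X w ∂μ, ∫ w, Y w ∂μ⟫ :=
  h.integral_bilin hX hY (innerSL ℝ)

theorem integral_sq_norm_sum_of_orthogonal {ι : Type*} [Fintype ι] {X : ι → Ω → E}
    (hX : ∀ k, MemLp (X k) 2 μ) (horth : ∀ k l, k ≠ l → ∫ w, ⟪X k w, X l w⟫ ∂μ = 0) :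
    ∫ w, ‖∑ k, X k w‖ ^ 2 ∂μ = ∑ k, ∫ w, ‖X k w‖ ^ 2 ∂μ := by
  classical
  have hint : ∀ k l, Integrable (fun w => ⟪X k w, X l w⟫) μ := fun k l =>
    (hX k).integrable_inner_of_memLp (hX l)
  simp only [← real_inner_self_eq_norm_sq, sum_inner, inner_sum]
  rw [integral_finsetSum _ fun k _ => integrable_finsetSum _ fun l _ => hint l k]
  refine Finset.sum_congr rfl fun k _ => ?_
  rw [integral_finsetSum _ fun l _ => hint l k, Finset.sum_eq_single k]
  · exact fun l _ hl => horth l k hl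
  · simp

end SecondMoments

section Minibatch

variable {d b : ℕ} {A : Type*} [MeasurableSpace A] {D : Measure A} [IsProbabilityMeasure D]
  {g : Vec d → A → Vec d} {x γ : Vec d} {σ : ℝ}

theorem memLp_minibatchGrad (hg : MemLp (g x) 2 D) :
    MemLp (minibatchGrad (b := b) g x) 2 (Measure.pi fun _ => D) :=
  (memLp_finsetSum Finset.univ fun k _ =>
    hg.comp_measurePreserving (measurePreserving_eval (fun _ : Fin b => D) k)).const_smul (b : ℝ)⁻¹

theorem integral_minibatchGrad (hb : 1 ≤ b) (hg : MemLp (g x) 2 D) (hγ : ∫ a, g x a ∂D = γ) :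
    ∫ ξ, minibatchGrad (b := b) g x ξ ∂(Measure.pi fun _ => D) = γ := by
  have hb0 : (b : ℝ) ≠ 0 := by positivity
  simp only [minibatchGrad]
  rw [integral_smul, integral_finsetSum]
  · have : ∀ k : Fin b, ∫ ξ : Fin b → A, g x (ξ k) ∂(Measure.pi fun _ => D) = γ := fun k => by
      rw [← hγ]
      exact integral_comp_eval (μ := fun _ : Fin b => D) hg.1
    simp only [this]
    simp [← Nat.cast_smul_eq_nsmul ℝ, smul_smul, hb0]
  · exact fun k _ => (hg.comp_measurePreserving
      (measurePreserving_eval (fun _ : Fin b => D) k)).integrable one_le_two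

theorem integral_sq_norm_minibatchGrad_sub_le (hb : 1 ≤ b) (hg : MemLp (g x) 2 D)
    (hγ : ∫ a, g x a ∂D = γ) (hσ : ∫ a, ‖g x a - γ‖ ^ 2 ∂D ≤ σ ^ 2) :
    ∫ ξ, ‖minibatchGrad (b := b) g x ξ - γ‖ ^ 2 ∂(Measure.pi fun _ => D) ≤ σ ^ 2 / b := by
  have hb0 : (0 : ℝ) < b := by positivity
  have hsub : MemLp (fun a => g x a - γ) 2 D := hg.sub (memLp_const γ)
  have hmp := measurePreserving_eval (fun _ : Fin b => D)
  have hX : ∀ k : Fin b, MemLp (fun ξ : Fin b → A => g x (ξ k) - γ) 2 (Measure.pi fun _ => D) :=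
    fun k => hsub.comp_measurePreserving (hmp k)
  have hmean : ∫ a, (g x a - γ) ∂D = 0 := by
    rw [integral_sub (hg.integrable one_le_two) (integrable_const _), hγ]
    simp
  have e : ∀ ξ : Fin b → A, ‖minibatchGrad g x ξ - γ‖ ^ 2
      = ((b : ℝ)⁻¹) ^ 2 * ‖∑ k, (g x (ξ k) - γ)‖ ^ 2 := by
    intro ξ
    rw [← Real.norm_of_nonneg (inv_nonneg.2 hb0.le), ← mul_pow, ← norm_smul,
      Finset.sum_sub_distrib, smul_sub, minibatchGrad]
    simp [← Nat.cast_smul_eq_nsmul ℝ, smul_smul, hb0.ne']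
  simp only [e]
  rw [integral_const_mul, integral_sq_norm_sum_of_orthogonal hX]
  · have : ∀ k : Fin b, ∫ ξ : Fin b → A, ‖g x (ξ k) - γ‖ ^ 2 ∂(Measure.pi fun _ => D) ≤ σ ^ 2 := by
      intro k
      refine le_trans (le_of_eq ?_) hσ
      exact integral_comp_eval (μ := fun _ : Fin b => D) (f := fun a => ‖g x a - γ‖ ^ 2)
        (hsub.1.norm.pow 2)
    calc _ ≤ ((b : ℝ)⁻¹) ^ 2 * ∑ _k : Fin b, σ ^ 2 := by gcongr with k; exact this k
      _ = σ ^ 2 / b := by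
        simp
        field_simp
  · intro k l hkl
    have hind : iIndepFun (fun (k : Fin b) (ξ : Fin b → A) => g x (ξ k) - γ)
        (Measure.pi fun _ => D) := iIndepFun_pi fun _ => hsub.1.aemeasurable
    have hz : ∀ k : Fin b, ∫ ξ : Fin b → A, (g x (ξ k) - γ) ∂(Measure.pi fun _ => D) = 0 :=
      fun k => (integral_comp_eval (μ := fun _ : Fin b => D) hsub.1).trans hmean
    rw [(hind.indepFun hkl).integral_inner ((hX k).integrable one_le_two)
      ((hX l).integrable one_le_two), hz, inner_zero_left]

end Minibatch

namespace IsCompressor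

variable {d : ℕ} {Z : Type*} [MeasurableSpace Z] {κ : Measure Z} [IsProbabilityMeasure κ]
  {C : Vec d → Z → Vec d} {ω : ℝ}

theorem integral_sq_norm_le (hC : IsCompressor κ C ω) (y : Vec d) :
    ∫ z, ‖C y z‖ ^ 2 ∂κ ≤ (1 + ω) * ‖y‖ ^ 2 := by
  rw [integral_sq_norm_eq_add_integral_sq_norm_sub (hC.memLp y) (hC.unbiased y)]
  linarith [hC.variance_le y]

variable {Ω : Type*} [MeasurableSpace Ω] {μ : Measure Ω} {Y : Ω → Vec d}

theorem integrable_sq_norm_comp (hC : IsCompressor κ C ω) (hYm : Measurable Y)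
    (hY : MemLp Y 2 μ) : Integrable (fun p : Ω × Z => ‖C (Y p.1) p.2‖ ^ 2) (μ.prod κ) := by
  have hm : Measurable fun p : Ω × Z => C (Y p.1) p.2 :=
    hC.measurable.comp ((hYm.comp measurable_fst).prodMk measurable_snd)
  rw [integrable_prod_iff (hm.norm.pow_const 2).aestronglyMeasurable]
  refine ⟨Filter.Eventually.of_forall fun w => (hC.memLp (Y w)).integrable_norm_pow two_ne_zero, ?_⟩
  refine ((hY.integrable_norm_pow two_ne_zero).const_mul (1 + ω)).mono'
    ((hm.norm.pow_const 2).norm.stronglyMeasurable.integral_prod_right').aestronglyMeasurable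
    (Filter.Eventually.of_forall fun w => ?_)
  rw [Real.norm_of_nonneg (integral_nonneg fun _ => norm_nonneg _)]
  simp only [norm_pow, norm_norm]
  exact hC.integral_sq_norm_le (Y w)

theorem memLp_comp [SFinite μ] (hC : IsCompressor κ C ω) (hYm : Measurable Y) (hY : MemLp Y 2 μ) :
    MemLp (fun p : Ω × Z => C (Y p.1) p.2) 2 (μ.prod κ) := by
  have hm : Measurable fun p : Ω × Z => C (Y p.1) p.2 :=
    hC.measurable.comp ((hYm.comp measurable_fst).prodMk measurable_snd)
  exact (memLp_two_iff_integrable_sq_norm hm.aestronglyMeasurable).2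
    (hC.integrable_sq_norm_comp hYm hY)

theorem integral_comp [IsProbabilityMeasure μ] (hC : IsCompressor κ C ω) (hYm : Measurable Y) (hY : MemLp Y 2 μ) :
    ∫ p : Ω × Z, C (Y p.1) p.2 ∂(μ.prod κ) = ∫ w, Y w ∂μ := by
  rw [integral_prod _ ((hC.memLp_comp hYm hY).integrable one_le_two)]
  simp only [hC.unbiased]

theorem integral_sq_norm_comp_le [SFinite μ] (hC : IsCompressor κ C ω) (hYm : Measurable Y)
    (hY : MemLp Y 2 μ) :
    ∫ p : Ω × Z, ‖C (Y p.1) p.2‖ ^ 2 ∂(μ.prod κ) ≤ (1 + ω) * ∫ w, ‖Y w‖ ^ 2 ∂μ := by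
  have hi := hC.integrable_sq_norm_comp hYm hY
  rw [integral_prod _ hi, ← integral_const_mul]
  exact integral_mono hi.integral_prod_left
    ((hY.integrable_norm_pow two_ne_zero).const_mul (1 + ω))
    fun w => hC.integral_sq_norm_le (Y w)

end IsCompressor

/-! ### Moments of the compressed messages of the clients. -/

section Messages

variable {d N b : ℕ} {A Z : Type*} [MeasurableSpace A] [MeasurableSpace Z]
  {f : Fin N → Vec d → ℝ} {D : Fin N → Measure A}
  {G : Fin N → Vec d → A → Vec d} {κ : Measure Z}
  {C : Vec d → Z → Vec d} {σ ω : ℝ}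

theorem IsGradientOracle.measurable_minibatchGrad (hG : IsGradientOracle f D G σ) (i : Fin N) :
    Measurable fun p : Vec d × (Fin b → A) => minibatchGrad (G i) p.1 p.2 := by
  refine Measurable.const_smul (Finset.measurable_fun_sum _ fun k _ => ?_) (b : ℝ)⁻¹
  exact (hG.measurable i).comp
    (measurable_fst.prodMk ((measurable_pi_apply k).comp measurable_snd))

/-- The compressed message of client `i` when the model is `x` and the shifts are `h`. -/
noncomputable def message (G : Fin N → Vec d → A → Vec d) (C : Vec d → Z → Vec d) (x : Vec d)
    (h : Fin N → Vec d) (i : Fin N) (z : (Fin N → Fin b → A) × (Fin N → Z)) : Vec d :=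
  C (minibatchGrad (G i) x (z.1 i) - h i) (z.2 i)

/-- The law of one minibatch and one seed for every client. -/
noncomputable def messageLaw (b : ℕ) (D : Fin N → Measure A) (κ : Measure Z) :
    Measure ((Fin N → Fin b → A) × (Fin N → Z)) :=
  (Measure.pi fun i => Measure.pi fun _ => D i).prod (Measure.pi fun _ => κ)

theorem measurable_message (hG : IsGradientOracle f D G σ) (hC : IsCompressor κ C ω)
    (i : Fin N) :
    Measurable fun p : (Vec d × (Fin N → Vec d)) × ((Fin N → Fin b → A) × (Fin N → Z)) =>
      message G C p.1.1 p.1.2 i p.2 := by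
  have h1 : Measurable fun p : (Vec d × (Fin N → Vec d)) × ((Fin N → Fin b → A) × (Fin N → Z)) =>
      (p.1.1, p.2.1 i) := by fun_prop
  have h2 : Measurable fun p : (Vec d × (Fin N → Vec d)) × ((Fin N → Fin b → A) × (Fin N → Z)) =>
      p.1.2 i := by fun_prop
  have h3 : Measurable fun p : (Vec d × (Fin N → Vec d)) × ((Fin N → Fin b → A) × (Fin N → Z)) =>
      p.2.2 i := by fun_prop
  exact hC.measurable.comp ((((hG.measurable_minibatchGrad i).comp h1).sub h2).prodMk h3)

theorem measurable_clientMessage (hG : IsGradientOracle f D G σ) (hC : IsCompressor κ C ω)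
    (x a : Vec d) (i : Fin N) :
    Measurable fun p : (Fin b → A) × Z => C (minibatchGrad (G i) x p.1 - a) p.2 :=
  hC.measurable.comp ((((hG.measurable_minibatchGrad i).comp
    (measurable_const.prodMk measurable_fst)).sub_const a).prodMk measurable_snd)

variable [IsProbabilityMeasure κ] [∀ i, IsProbabilityMeasure (D i)]

instance : IsProbabilityMeasure (messageLaw b D κ) :=
  inferInstanceAs (IsProbabilityMeasure
    ((Measure.pi fun i => Measure.pi fun _ => D i).prod (Measure.pi fun _ => κ)))

theorem measurePreserving_clientDraw (i : Fin N) :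
    MeasurePreserving (fun z : (Fin N → Fin b → A) × (Fin N → Z) => (z.1 i, z.2 i))
      (messageLaw b D κ) ((Measure.pi fun _ => D i).prod κ) :=
  (measurePreserving_eval (fun i => Measure.pi fun _ : Fin b => D i) i).prod
    (measurePreserving_eval (fun _ : Fin N => κ) i)

/-- Regrouping the minibatches and seeds by client turns the law into a product over clients, whose
coordinates are independent. -/
theorem integral_inner_comp_clientDraw {φ ψ : (Fin b → A) × Z → Vec d} {i j : Fin N} (hij : i ≠ j)
    (hφm : Measurable φ) (hψm : Measurable ψ)
    (hφ : Integrable φ ((Measure.pi fun _ => D i).prod κ))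
    (hψ : Integrable ψ ((Measure.pi fun _ => D j).prod κ)) :
    ∫ z, ⟪φ (z.1 i, z.2 i), ψ (z.1 j, z.2 j)⟫ ∂(messageLaw b D κ)
      = ⟪∫ p, φ p ∂((Measure.pi fun _ => D i).prod κ),
          ∫ p, ψ p ∂((Measure.pi fun _ => D j).prod κ)⟫ := by
  let Q : Fin N → Measure ((Fin b → A) × Z) := fun i => (Measure.pi fun _ => D i).prod κ
  have hmp := measurePreserving_arrowProdEquivProdArrow (Fin b → A) Z (Fin N)
    (fun i => Measure.pi fun _ : Fin b => D i) (fun _ => κ)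
  have h1 : ∫ z, ⟪φ (z.1 i, z.2 i), ψ (z.1 j, z.2 j)⟫ ∂(messageLaw b D κ)
      = ∫ p, ⟪φ (p i), ψ (p j)⟫ ∂(Measure.pi Q) :=
    (hmp.integral_comp (MeasurableEquiv.measurableEmbedding _)
      fun z => ⟪φ (z.1 i, z.2 i), ψ (z.1 j, z.2 j)⟫).symm
  have hind : iIndepFun (fun (i : Fin N) (p : Fin N → (Fin b → A) × Z) => p i) (Measure.pi Q) :=
    iIndepFun_pi (X := fun _ p => p) fun _ => aemeasurable_id
  have hi : Integrable (fun p : Fin N → (Fin b → A) × Z => φ (p i)) (Measure.pi Q) :=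
    ((measurePreserving_eval Q i).integrable_comp hφ.1).2 hφ
  have hj : Integrable (fun p : Fin N → (Fin b → A) × Z => ψ (p j)) (Measure.pi Q) :=
    ((measurePreserving_eval Q j).integrable_comp hψ.1).2 hψ
  rw [h1]
  refine (((hind.indepFun hij).comp hφm hψm).integral_inner hi hj).trans ?_
  congr 1
  · exact integral_comp_eval (μ := Q) hφ.1
  · exact integral_comp_eval (μ := Q) hψ.1

/-- Compression keeps the mean and multiplies the second moment by at most `1 + ω`; the uncompressed
second moment splits into squared bias and minibatch variance. -/
theorem clientMessage_moments (hG : IsGradientOracle f D G σ) (hC : IsCompressor κ C ω)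
    (hω : 0 ≤ ω) (hb : 1 ≤ b) (x a : Vec d) (i : Fin N) :
    MemLp (fun p : (Fin b → A) × Z => C (minibatchGrad (G i) x p.1 - a) p.2) 2
        ((Measure.pi fun _ => D i).prod κ) ∧
      ∫ p : (Fin b → A) × Z, C (minibatchGrad (G i) x p.1 - a) p.2
        ∂((Measure.pi fun _ => D i).prod κ) = gradient (f i) x - a ∧
      ∫ p : (Fin b → A) × Z, ‖C (minibatchGrad (G i) x p.1 - a) p.2‖ ^ 2
        ∂((Measure.pi fun _ => D i).prod κ)
        ≤ (1 + ω) * (‖gradient (f i) x - a‖ ^ 2 + σ ^ 2 / b) := by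
  have hYm : Measurable fun ξ : Fin b → A => minibatchGrad (G i) x ξ - a :=
    ((hG.measurable_minibatchGrad i).comp (measurable_const.prodMk measurable_id)).sub_const _
  have hB : MemLp (minibatchGrad (b := b) (G i) x) 2 (Measure.pi fun _ => D i) :=
    memLp_minibatchGrad (hG.memLp i x)
  have hY : MemLp (fun ξ : Fin b → A => minibatchGrad (G i) x ξ - a) 2 (Measure.pi fun _ => D i) :=
    hB.sub (memLp_const _)
  have hmean : ∫ ξ : Fin b → A, (minibatchGrad (G i) x ξ - a) ∂(Measure.pi fun _ => D i)
      = gradient (f i) x - a := by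
    rw [integral_sub (hB.integrable one_le_two) (integrable_const _),
      integral_minibatchGrad hb (hG.memLp i x) (hG.unbiased i x)]
    simp
  refine ⟨hC.memLp_comp hYm hY, (hC.integral_comp hYm hY).trans hmean,
    (hC.integral_sq_norm_comp_le hYm hY).trans ?_⟩
  refine mul_le_mul_of_nonneg_left ?_ (by linarith)
  rw [integral_sq_norm_eq_add_integral_sq_norm_sub hY hmean]
  simp only [sub_sub_sub_cancel_right, add_le_add_iff_left]
  exact integral_sq_norm_minibatchGrad_sub_le hb (hG.memLp i x) (hG.unbiased i x)
    (hG.variance_le i x)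

theorem memLp_message (hG : IsGradientOracle f D G σ) (hC : IsCompressor κ C ω) (hω : 0 ≤ ω)
    (hb : 1 ≤ b) (x : Vec d) (h : Fin N → Vec d) (i : Fin N) :
    MemLp (message G C x h i) 2 (messageLaw b D κ) := by
  have h1 := (clientMessage_moments hG hC hω hb x (h i) i).1.comp_measurePreserving
    (measurePreserving_clientDraw (b := b) (D := D) (κ := κ) i)
  exact h1

theorem integral_message (hG : IsGradientOracle f D G σ) (hC : IsCompressor κ C ω) (hω : 0 ≤ ω)
    (hb : 1 ≤ b) (x : Vec d) (h : Fin N → Vec d) (i : Fin N) :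
    ∫ z, message G C x h i z ∂(messageLaw b D κ) = gradient (f i) x - h i := by
  have hmp := measurePreserving_clientDraw (b := b) (D := D) (κ := κ) i
  rw [← (clientMessage_moments hG hC hω hb x (h i) i).2.1, ← hmp.map_eq,
    integral_map hmp.measurable.aemeasurable
      (measurable_clientMessage hG hC x (h i) i).aestronglyMeasurable]
  rfl

theorem integral_sq_norm_message_le (hG : IsGradientOracle f D G σ) (hC : IsCompressor κ C ω)
    (hω : 0 ≤ ω) (hb : 1 ≤ b) (x : Vec d) (h : Fin N → Vec d) (i : Fin N) :
    ∫ z, ‖message G C x h i z‖ ^ 2 ∂(messageLaw b D κ)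
      ≤ (1 + ω) * (‖gradient (f i) x - h i‖ ^ 2 + σ ^ 2 / b) := by
  have hmp := measurePreserving_clientDraw (b := b) (D := D) (κ := κ) i
  refine le_trans (le_of_eq ?_) (clientMessage_moments hG hC hω hb x (h i) i).2.2
  rw [← hmp.map_eq, integral_map hmp.measurable.aemeasurable
    ((measurable_clientMessage hG hC x (h i) i).norm.pow_const 2).aestronglyMeasurable]
  rfl

theorem integral_inner_message (hG : IsGradientOracle f D G σ) (hC : IsCompressor κ C ω)
    (hω : 0 ≤ ω) (hb : 1 ≤ b) (x : Vec d) (h : Fin N → Vec d) {i j : Fin N} (hij : i ≠ j) :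
    ∫ z, ⟪message G C x h i z, message G C x h j z⟫ ∂(messageLaw b D κ)
      = ⟪gradient (f i) x - h i, gradient (f j) x - h j⟫ := by
  have hi := clientMessage_moments hG hC hω hb x (h i) i
  have hj := clientMessage_moments hG hC hω hb x (h j) j
  rw [← hi.2.1, ← hj.2.1]
  exact integral_inner_comp_clientDraw hij (measurable_clientMessage hG hC x (h i) i)
    (measurable_clientMessage hG hC x (h j) j) (hi.1.integrable one_le_two)
    (hj.1.integrable one_le_two)

end Messages

/-! ### Marginals of the law of one round. -/

section RoundLaw

variable {N S b : ℕ} {A Z : Type*} [MeasurableSpace A] [MeasurableSpace Z]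

/-- The minibatches and seeds used for the update of the shifts. -/
def shiftDraw (r : RoundDraw N b A Z) : (Fin N → Fin b → A) × (Fin N → Z) := (r.2.1.1, r.2.2.1)

/-- The minibatches and seeds used for the update of the model. -/
def modelDraw (reuse : Bool) (r : RoundDraw N b A Z) : (Fin N → Fin b → A) × (Fin N → Z) :=
  (if reuse then r.2.1.1 else r.2.1.2, r.2.2.2)

theorem measurable_shiftDraw : Measurable (shiftDraw : RoundDraw N b A Z → _) := by
  unfold shiftDraw
  fun_prop

theorem measurable_modelDraw (reuse : Bool) :
    Measurable (modelDraw reuse : RoundDraw N b A Z → _) := by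
  unfold modelDraw
  cases reuse <;> simp <;> fun_prop

variable {D : Fin N → Measure A} [∀ i, IsProbabilityMeasure (D i)] {κ : Measure Z}
  [IsProbabilityMeasure κ]

theorem isProbabilityMeasure_roundLaw (hSN : S ≤ N) :
    IsProbabilityMeasure (roundLaw S b D κ) := by
  have := isProbabilityMeasure_uniformOn_card hSN
  unfold roundLaw
  infer_instance

theorem measurePreserving_shiftDraw (hSN : S ≤ N) :
    MeasurePreserving (fun r : RoundDraw N b A Z => (r.1.1, shiftDraw r)) (roundLaw S b D κ)
      ((uniformOn {s : Finset (Fin N) | s.card = S}).prod (messageLaw b D κ)) := by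
  have := isProbabilityMeasure_uniformOn_card hSN
  exact measurePreserving_fst.prod (measurePreserving_fst.prod measurePreserving_fst)

/-- Reusing the minibatch correlates the model noise with the shift noise, but not with the set
`r.1.1` of clients that update their shifts. This product law is all that is needed about the model
side. -/
theorem measurePreserving_modelDraw (hSN : S ≤ N) (reuse : Bool) :
    MeasurePreserving (fun r : RoundDraw N b A Z => (r.1.1, r.1.2, modelDraw reuse r))
      (roundLaw S b D κ)
      ((uniformOn {s : Finset (Fin N) | s.card = S}).prod
        ((uniformOn {s : Finset (Fin N) | s.card = S}).prod (messageLaw b D κ))) := by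
  have := isProbabilityMeasure_uniformOn_card hSN
  have h := (measurePreserving_prodAssoc (uniformOn {s : Finset (Fin N) | s.card = S})
    (uniformOn {s : Finset (Fin N) | s.card = S}) (messageLaw b D κ))
  cases reuse
  · exact h.comp ((MeasurePreserving.id _).prod (measurePreserving_snd.prod measurePreserving_snd))
  · exact h.comp ((MeasurePreserving.id _).prod (measurePreserving_fst.prod measurePreserving_snd))

end RoundLaw

/-! ### The gradient estimate of the server: mean and second moment. -/

section ModelUpdate

variable {d N S b : ℕ} {A Z : Type*} [MeasurableSpace A] [MeasurableSpace Z]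
  {f : Fin N → Vec d → ℝ} {D : Fin N → Measure A}
  {G : Fin N → Vec d → A → Vec d} {κ : Measure Z}
  {C : Vec d → Z → Vec d} {σ ω L : ℝ}

/-- The gradient estimate of the server, for given sets of clients, minibatches and seeds. -/
noncomputable def gradEstimate (S : ℕ) (G : Fin N → Vec d → A → Vec d) (C : Vec d → Z → Vec d)
    (x : Vec d) (h : Fin N → Vec d)
    (u : Finset (Fin N) × ((Fin N → Fin b → A) × (Fin N → Z))) : Vec d :=
  sampleMean S (message G C x h) u + (N : ℝ)⁻¹ • ∑ i, h i

theorem measurable_gradEstimate (hG : IsGradientOracle f D G σ) (hC : IsCompressor κ C ω) :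
    Measurable fun p : (Vec d × (Fin N → Vec d)) ×
      (Finset (Fin N) × ((Fin N → Fin b → A) × (Fin N → Z))) =>
        gradEstimate S G C p.1.1 p.1.2 p.2 := by
  unfold gradEstimate sampleMean
  have h1 : Measurable fun p : (Vec d × (Fin N → Vec d)) ×
      (Finset (Fin N) × ((Fin N → Fin b → A) × (Fin N → Z))) =>
        ∑ i, selected i p.2.1 • message G C p.1.1 p.1.2 i p.2.2 := by
    refine Finset.measurable_fun_sum _ fun i _ => ?_
    have h2 : Measurable fun p : (Vec d × (Fin N → Vec d)) ×
        (Finset (Fin N) × ((Fin N → Fin b → A) × (Fin N → Z))) => (p.1, p.2.2) := by fun_prop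
    have h3 : Measurable fun p : (Vec d × (Fin N → Vec d)) ×
        (Finset (Fin N) × ((Fin N → Fin b → A) × (Fin N → Z))) => p.2.1 := by fun_prop
    have h5 := (measurable_message (b := b) hG hC i).comp h2
    have h6 := (measurable_selected i).comp h3
    exact h6.smul h5
  have h4 : Measurable fun p : (Vec d × (Fin N → Vec d)) ×
      (Finset (Fin N) × ((Fin N → Fin b → A) × (Fin N → Z))) => ∑ i, p.1.2 i :=
    Finset.measurable_fun_sum _ fun i _ => by fun_prop
  exact (h1.const_smul (S : ℝ)⁻¹).add (h4.const_smul (N : ℝ)⁻¹)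

variable [∀ i, IsProbabilityMeasure (D i)] [IsProbabilityMeasure κ]

theorem memLp_gradEstimate (hG : IsGradientOracle f D G σ) (hC : IsCompressor κ C ω) (hω : 0 ≤ ω)
    (hb : 1 ≤ b) (hSN : S ≤ N) (x : Vec d) (h : Fin N → Vec d) :
    MemLp (gradEstimate S G C x h) 2
      ((uniformOn {s : Finset (Fin N) | s.card = S}).prod (messageLaw b D κ)) := by
  have := isProbabilityMeasure_uniformOn_card hSN
  exact (memLp_sampleMean hSN (memLp_message hG hC hω hb x h)).add (memLp_const _)

theorem integral_gradEstimate (hf : IsSmoothFamily f L) (hG : IsGradientOracle f D G σ)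
    (hC : IsCompressor κ C ω) (hω : 0 ≤ ω) (hb : 1 ≤ b) (hS : 1 ≤ S) (hSN : S ≤ N) (x : Vec d)
    (h : Fin N → Vec d) :
    ∫ u, gradEstimate S G C x h u
      ∂((uniformOn {s : Finset (Fin N) | s.card = S}).prod (messageLaw b D κ))
      = gradient (avgLoss f) x := by
  have := isProbabilityMeasure_uniformOn_card hSN
  have h1 := memLp_sampleMean hSN (memLp_message hG hC hω hb x h)
  simp only [gradEstimate]
  rw [integral_add (h1.integrable one_le_two) (integrable_const _),
    integral_sampleMean hS hSN (fun i => (memLp_message hG hC hω hb x h i).integrable one_le_two)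
      (integral_message hG hC hω hb x h), hf.gradient_avgLoss]
  simp [Finset.sum_sub_distrib, smul_sub]

/-- The estimate differs from the sample mean by a constant, so both have the same variance; for the
sample mean the squared mean cancels from the second moment bound and only the `1/S` term remains.
-/
theorem integral_sq_norm_gradEstimate_le (hf : IsSmoothFamily f L) (hG : IsGradientOracle f D G σ)
    (hC : IsCompressor κ C ω) (hω : 0 ≤ ω) (hb : 1 ≤ b) (hS : 1 ≤ S) (hSN : S ≤ N) (x : Vec d)
    (h : Fin N → Vec d) :
    ∫ u, ‖gradEstimate S G C x h u‖ ^ 2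
      ∂((uniformOn {s : Finset (Fin N) | s.card = S}).prod (messageLaw b D κ))
      ≤ ‖gradient (avgLoss f) x‖ ^ 2 + (1 + ω) / S *
          ((N : ℝ)⁻¹ * ∑ i, ‖gradient (f i) x - h i‖ ^ 2 + σ ^ 2 / b) := by
  have := isProbabilityMeasure_uniformOn_card hSN
  have hN0 : (0 : ℝ) < N := by exact_mod_cast hS.trans hSN
  have hm := memLp_message hG hC hω hb x h
  have h1 := memLp_sampleMean hSN hm
  have h2 := integral_sampleMean hS hSN (fun i => (hm i).integrable one_le_two)
    (integral_message hG hC hω hb x h)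
  have h3 := integral_sq_norm_sampleMean_le hS hSN hm
    (fun i j hij => integral_inner_message hG hC hω hb x h hij)
    (integral_sq_norm_message_le hG hC hω hb x h)
  rw [integral_sq_norm_eq_add_integral_sq_norm_sub h1 h2] at h3
  rw [integral_sq_norm_eq_add_integral_sq_norm_sub (memLp_gradEstimate hG hC hω hb hSN x h)
    (integral_gradEstimate hf hG hC hω hb hS hSN x h)]
  have e : ∀ u : Finset (Fin N) × ((Fin N → Fin b → A) × (Fin N → Z)),
      gradEstimate S G C x h u - gradient (avgLoss f) x
        = sampleMean S (message G C x h) u - (N : ℝ)⁻¹ • ∑ i, (gradient (f i) x - h i) := by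
    intro u
    rw [gradEstimate, hf.gradient_avgLoss, Finset.sum_sub_distrib, smul_sub]
    abel
  simp only [e]
  have h4 : (S : ℝ)⁻¹ * ((N : ℝ)⁻¹ * ∑ i, (1 + ω) * (‖gradient (f i) x - h i‖ ^ 2 + σ ^ 2 / b))
      = (1 + ω) / S * ((N : ℝ)⁻¹ * ∑ i, ‖gradient (f i) x - h i‖ ^ 2 + σ ^ 2 / b) := by
    rw [← Finset.mul_sum, Finset.sum_add_distrib]
    simp
    field_simp
  rw [h4] at h3
  linarith

end ModelUpdate

/-! ### Trackers: weighted averages over points, updated in step with the shifts. -/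

section TrackedState

/-- For one client: a weighted average of past gradients `∇ f i (x s)`, the weighted averages of
`x s` and of `‖x s‖ ^ 2`, and a weighted average of `φ (x s)`, all with the same weights. -/
abbrev Tracker (d : ℕ) : Type := Vec d × Vec d × ℝ × ℝ

/-- The model, the shifts, and a tracker for every client. -/
abbrev TrackedState (d N : ℕ) : Type := (Vec d × (Fin N → Vec d)) × (Fin N → Tracker d)

namespace Tracker

variable {d : ℕ}

/-- The tracker that puts all the weight on the point `x`. -/
noncomputable def dirac (F φ : Vec d → ℝ) (x : Vec d) : Tracker d :=
  (gradient F x, x, ‖x‖ ^ 2, φ x)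

/-- The weighted average of `‖y - x s‖ ^ 2`. -/
noncomputable def sqDist (a : Tracker d) (y : Vec d) : ℝ :=
  ‖y‖ ^ 2 - 2 * ⟪y, a.2.1⟫ + a.2.2.1

/-- Bias and variance: the second summand does not depend on `y`, so moving `y` only affects the
distance to the tracked mean point. -/
theorem sqDist_eq (a : Tracker d) (y : Vec d) :
    a.sqDist y = ‖y - a.2.1‖ ^ 2 + (a.2.2.1 - ‖a.2.1‖ ^ 2) := by
  rw [sqDist, norm_sub_sq_real]
  ring

theorem sqDist_dirac (F φ : Vec d → ℝ) (x y : Vec d) : (dirac F φ x).sqDist y = ‖y - x‖ ^ 2 := by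
  rw [sqDist_eq]
  simp [dirac]

theorem sqDist_update (a a' : Tracker d) (J : ℝ) (y : Vec d) :
    (a + J • (a' - a)).sqDist y = a.sqDist y + J * (a'.sqDist y - a.sqDist y) := by
  simp only [sqDist, Prod.fst_add, Prod.snd_add, Prod.smul_fst, Prod.smul_snd, Prod.fst_sub,
    Prod.snd_sub, inner_add_right, inner_smul_right, inner_sub_right, smul_eq_mul]
  ring

/-- Inequalities that hold for every weighted average. -/
structure Valid (F : Vec d → ℝ) (L : ℝ) (a : Tracker d) : Prop where
  sq_norm_sub_le : ∀ y, ‖gradient F y - a.1‖ ^ 2 ≤ L ^ 2 * a.sqDist y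
  sq_norm_le : ‖a.2.1‖ ^ 2 ≤ a.2.2.1

theorem sq_norm_add_smul_sub_le {E : Type*} [NormedAddCommGroup E] [InnerProductSpace ℝ E]
    (u v : E) {J : ℝ} (h0 : 0 ≤ J) (h1 : J ≤ 1) :
    ‖u + J • (v - u)‖ ^ 2 ≤ ‖u‖ ^ 2 + J * (‖v‖ ^ 2 - ‖u‖ ^ 2) := by
  have h2 : ‖u + J • (v - u)‖ ^ 2
      = ‖u‖ ^ 2 + J * (‖v‖ ^ 2 - ‖u‖ ^ 2) - J * (1 - J) * ‖v - u‖ ^ 2 := by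
    rw [norm_add_sq_real, norm_smul, mul_pow, Real.norm_eq_abs, sq_abs, inner_smul_right,
      norm_sub_sq_real, inner_sub_right, real_inner_self_eq_norm_sq, real_inner_comm u v]
    ring
  have h3 : 0 ≤ J * (1 - J) * ‖v - u‖ ^ 2 :=
    mul_nonneg (mul_nonneg h0 (by linarith)) (sq_nonneg _)
  linarith

theorem Valid.sq_dist_le {F : Vec d → ℝ} {L : ℝ} {a : Tracker d} (ha : a.Valid F L) (y : Vec d) :
    ‖y - a.2.1‖ ^ 2 ≤ a.sqDist y := by
  rw [sqDist_eq]
  linarith [ha.sq_norm_le]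

theorem Valid.sqDist_nonneg {F : Vec d → ℝ} {L : ℝ} {a : Tracker d} (ha : a.Valid F L)
    (y : Vec d) : 0 ≤ a.sqDist y :=
  (sq_nonneg _).trans (ha.sq_dist_le y)

theorem valid_dirac {F : Vec d → ℝ} {L : ℝ}
    (hL : ∀ x y, ‖gradient F x - gradient F y‖ ≤ L * ‖x - y‖) (φ : Vec d → ℝ) (x : Vec d) :
    (dirac F φ x).Valid F L where
  sq_norm_sub_le y := by
    rw [sqDist_dirac, ← mul_pow]
    exact pow_le_pow_left₀ (norm_nonneg _) (hL y x) 2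
  sq_norm_le := le_rfl

/-- In both inequalities the left side is convex in the tracker and the right side is affine, so
they survive convex combinations. -/
theorem Valid.update {F : Vec d → ℝ} {L J : ℝ} {a a' : Tracker d} (ha : a.Valid F L)
    (ha' : a'.Valid F L) (h0 : 0 ≤ J) (h1 : J ≤ 1) : (a + J • (a' - a)).Valid F L where
  sq_norm_sub_le y := by
    have e : gradient F y - (a + J • (a' - a)).1
        = (gradient F y - a.1) + J • ((gradient F y - a'.1) - (gradient F y - a.1)) := by
      simp only [Prod.fst_add, Prod.smul_fst, Prod.fst_sub]
      rw [sub_sub_sub_cancel_left, ← neg_sub a'.1 a.1, smul_neg]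
      abel
    rw [sqDist_update, e]
    refine (sq_norm_add_smul_sub_le _ _ h0 h1).trans ?_
    nlinarith [mul_le_mul_of_nonneg_left (ha.sq_norm_sub_le y) (sub_nonneg.2 h1),
      mul_le_mul_of_nonneg_left (ha'.sq_norm_sub_le y) h0]
  sq_norm_le := by
    refine (sq_norm_add_smul_sub_le a.2.1 a'.2.1 h0 h1).trans ?_
    simp only [Prod.snd_add, Prod.fst_add, Prod.smul_snd, Prod.smul_fst, Prod.snd_sub,
      Prod.fst_sub, smul_eq_mul]
    nlinarith [mul_le_mul_of_nonneg_left ha.sq_norm_le (sub_nonneg.2 h1),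
      mul_le_mul_of_nonneg_left ha'.sq_norm_le h0]

/-- For a convex function `F`: the inequality that follows from
`φ y + ⟪∇ F y, x s - y⟫ ≤ φ (x s)`. -/
def ConvexValid (F φ : Vec d → ℝ) (a : Tracker d) : Prop :=
  ∀ y, φ y + ⟪gradient F y, a.2.1 - y⟫ ≤ a.2.2.2

/-- Jensen: taking `y` to be the tracked mean point removes the inner product. -/
theorem ConvexValid.value_nonneg {F φ : Vec d → ℝ} {a : Tracker d} (ha : a.ConvexValid F φ)
    (hφ : ∀ x, 0 ≤ φ x) : 0 ≤ a.2.2.2 := by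
  have h := ha a.2.1
  rw [sub_self, inner_zero_right, add_zero] at h
  exact (hφ _).trans h

theorem ConvexValid.update {F φ : Vec d → ℝ} {J : ℝ} {a a' : Tracker d} (ha : a.ConvexValid F φ)
    (ha' : a'.ConvexValid F φ) (h0 : 0 ≤ J) (h1 : J ≤ 1) :
    (a + J • (a' - a)).ConvexValid F φ := by
  intro y
  have h2 := ha y
  have h3 := ha' y
  simp only [Prod.snd_add, Prod.fst_add, Prod.smul_snd, Prod.smul_fst, Prod.snd_sub,
    Prod.fst_sub, smul_eq_mul, inner_sub_right, inner_add_right, inner_smul_right] at h2 h3 ⊢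
  nlinarith [mul_le_mul_of_nonneg_left h2 (sub_nonneg.2 h1), mul_le_mul_of_nonneg_left h3 h0]

end Tracker

end TrackedState

/-! ### One round on tracked states: expectations for a single client. -/

section TrackedStep

variable {d N S b : ℕ} {A Z : Type*} {f : Fin N → Vec d → ℝ} {φ : Vec d → ℝ}
  {G : Fin N → Vec d → A → Vec d} {C : Vec d → Z → Vec d} {σ ω L η α : ℝ} {reuse : Bool}

/-- One round of COFIG on tracked states. -/
noncomputable def trackedStep (S b : ℕ) (G : Fin N → Vec d → A → Vec d) (C : Vec d → Z → Vec d)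
    (f : Fin N → Vec d → ℝ) (φ : Vec d → ℝ) (η α : ℝ) (reuse : Bool) (s : TrackedState d N)
    (r : RoundDraw N b A Z) : TrackedState d N :=
  ((s.1.1 - η • gradEstimate S G C s.1.1 s.1.2 (r.1.2, modelDraw reuse r),
    fun i => s.1.2 i + (α * selected i r.1.1) • message G C s.1.1 s.1.2 i (shiftDraw r)),
    fun i => s.2 i + (α * selected i r.1.1) • (Tracker.dirac (f i) φ s.1.1 - s.2 i))

/-- The trackers never feed back into the model or the shifts, so their initial value `a₀` is free;
the two cases below choose it differently. The global shift is recovered as the mean of the local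
ones. -/
theorem cofig_eq_randomIterate (hN : 1 ≤ N) (x₀ : Vec d) (h₀ : Fin N → Vec d)
    (a₀ : Fin N → Tracker d) (r : ℕ → RoundDraw N b A Z) (t : ℕ) :
    cofig S b G C η α reuse x₀ h₀ r t =
      let s := randomIterate (trackedStep S b G C f φ η α reuse) ((x₀, h₀), a₀) r t
      ⟨s.1.1, s.1.2, (N : ℝ)⁻¹ • ∑ i, s.1.2 i⟩ := by
  induction t with
  | zero => rfl
  | succ t ih =>
    simp only [cofig, randomIterate]
    rw [ih]
    simp only [cofigStep, trackedStep, CofigState.mk.injEq]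
    refine ⟨?_, ?_, ?_⟩
    · simp only [gradEstimate, sampleMean, selected, ite_smul, one_smul, zero_smul,
        Finset.sum_ite_mem, Finset.univ_inter, message, modelDraw]
    · ext1 i
      by_cases hi : i ∈ (r t).1.1 <;> simp [selected, hi, message, shiftDraw]
    · have hN0 : (N : ℝ) ≠ 0 := by positivity
      simp only [Finset.sum_add_distrib, smul_add, selected, mul_ite, mul_one,
        mul_zero, ite_smul, zero_smul, Finset.sum_ite_mem, Finset.univ_inter, message, shiftDraw,
        ← Finset.smul_sum, smul_smul, div_eq_inv_mul]

theorem mul_selected_nonneg (hα : 0 ≤ α) (i : Fin N) (s : Finset (Fin N)) :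
    0 ≤ α * selected i s := by
  unfold selected
  split_ifs <;> simp [hα]

theorem mul_selected_le_one (hα : α ≤ 1) (i : Fin N) (s : Finset (Fin N)) :
    α * selected i s ≤ 1 := by
  unfold selected
  split_ifs <;> simp [hα]

theorem valid_trackedStep (hf : IsSmoothFamily f L) (hα0 : 0 ≤ α) (hα1 : α ≤ 1)
    {s : TrackedState d N} (hs : ∀ i, (s.2 i).Valid (f i) L) (r : RoundDraw N b A Z) (i : Fin N) :
    ((trackedStep S b G C f φ η α reuse s r).2 i).Valid (f i) L :=
  (hs i).update (Tracker.valid_dirac (hf.lipschitz i) φ s.1.1) (mul_selected_nonneg hα0 i _)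
    (mul_selected_le_one hα1 i _)

theorem convexValid_trackedStep {F : Vec d → ℝ} (hα0 : 0 ≤ α) (hα1 : α ≤ 1)
    (hφ : ∀ x y, φ y + ⟪gradient F y, x - y⟫ ≤ φ x)
    {s : TrackedState d N} (hs : ∀ i, (s.2 i).ConvexValid F φ) (r : RoundDraw N b A Z)
    (i : Fin N) : ((trackedStep S b G C f φ η α reuse s r).2 i).ConvexValid F φ :=
  (hs i).update (a' := Tracker.dirac (f i) φ s.1.1) (hφ s.1.1) (mul_selected_nonneg hα0 i _)
    (mul_selected_le_one hα1 i _)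

variable [MeasurableSpace A] [MeasurableSpace Z] {D : Fin N → Measure A} {κ : Measure Z}

theorem measurable_trackedStep (hL : 0 ≤ L) (hf : IsSmoothFamily f L) (hφ : Measurable φ)
    (hG : IsGradientOracle f D G σ) (hC : IsCompressor κ C ω) :
    Measurable (Function.uncurry (trackedStep S b G C f φ η α reuse)) := by
  have hgrad := fun i => (hf.continuous_gradient hL i).measurable
  have h1 : Measurable fun p : TrackedState d N × RoundDraw N b A Z =>
      (p.1.1, (p.2.1.2, modelDraw reuse p.2)) :=
    (measurable_fst.comp measurable_fst).prodMk
      ((measurable_snd.comp (measurable_fst.comp measurable_snd)).prodMk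
        ((measurable_modelDraw reuse).comp measurable_snd))
  have h2 : Measurable fun p : TrackedState d N × RoundDraw N b A Z => (p.1.1, shiftDraw p.2) :=
    (measurable_fst.comp measurable_fst).prodMk (measurable_shiftDraw.comp measurable_snd)
  have h3 : ∀ i, Measurable fun p : TrackedState d N × RoundDraw N b A Z =>
      α * selected i p.2.1.1 := fun i =>
    ((measurable_selected i).comp (measurable_fst.comp (measurable_fst.comp measurable_snd))).const_mul
      α
  have h4 := (measurable_gradEstimate (S := S) (b := b) hG hC).comp h1
  have h5 := fun i => (measurable_message (b := b) hG hC i).comp h2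
  have h6 : ∀ i, Measurable fun p : TrackedState d N × RoundDraw N b A Z =>
      Tracker.dirac (f i) φ p.1.1.1 := by
    intro i
    have hx : Measurable fun p : TrackedState d N × RoundDraw N b A Z => p.1.1.1 := by fun_prop
    exact ((hgrad i).comp hx).prodMk (hx.prodMk ((hx.norm.pow_const 2).prodMk (hφ.comp hx)))
  have h7 : Measurable fun p : TrackedState d N × RoundDraw N b A Z => p.1.1.1 := by fun_prop
  refine Measurable.prodMk (Measurable.prodMk (h7.sub (h4.const_smul η)) ?_) ?_
  · refine measurable_pi_lambda _ fun i => ?_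
    have h8 : Measurable fun p : TrackedState d N × RoundDraw N b A Z => p.1.1.2 i := by fun_prop
    have h9 := h8.add ((h3 i).smul (h5 i))
    exact h9
  · refine measurable_pi_lambda _ fun i => ?_
    have h8 : Measurable fun p : TrackedState d N × RoundDraw N b A Z => p.1.2 i := by fun_prop
    have h9 := h8.add ((h3 i).smul ((h6 i).sub h8))
    exact h9

variable [∀ i, IsProbabilityMeasure (D i)] [IsProbabilityMeasure κ]

/-- The second moment of the gradient estimate in the state `s`. -/
noncomputable def gradSecondMoment (S b : ℕ) (D : Fin N → Measure A) (κ : Measure Z)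
    (G : Fin N → Vec d → A → Vec d) (C : Vec d → Z → Vec d) (s : TrackedState d N) : ℝ :=
  ∫ u, ‖gradEstimate (b := b) S G C s.1.1 s.1.2 u‖ ^ 2
    ∂((uniformOn {t : Finset (Fin N) | t.card = S}).prod (messageLaw b D κ))

theorem integral_sq_norm_model_sub (hf : IsSmoothFamily f L) (hG : IsGradientOracle f D G σ)
    (hC : IsCompressor κ C ω) (hω : 0 ≤ ω) (hb : 1 ≤ b) (hS : 1 ≤ S) (hSN : S ≤ N)
    (s : TrackedState d N) (y : Vec d) :
    Integrable (fun u : Finset (Fin N) × ((Fin N → Fin b → A) × (Fin N → Z)) =>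
        ‖s.1.1 - η • gradEstimate S G C s.1.1 s.1.2 u - y‖ ^ 2)
        ((uniformOn {t : Finset (Fin N) | t.card = S}).prod (messageLaw b D κ)) ∧
      ∫ u, ‖s.1.1 - η • gradEstimate S G C s.1.1 s.1.2 u - y‖ ^ 2
        ∂((uniformOn {t : Finset (Fin N) | t.card = S}).prod (messageLaw b D κ))
      = ‖s.1.1 - y‖ ^ 2 - 2 * η * ⟪gradient (avgLoss f) s.1.1, s.1.1 - y⟫
        + η ^ 2 * gradSecondMoment S b D κ G C s := by
  have := isProbabilityMeasure_uniformOn_card hSN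
  have hg := memLp_gradEstimate hG hC hω hb hSN s.1.1 s.1.2
  have hg' := hg.const_smul η
  have e : ∀ u : Finset (Fin N) × ((Fin N → Fin b → A) × (Fin N → Z)),
      ‖s.1.1 - η • gradEstimate S G C s.1.1 s.1.2 u - y‖ ^ 2
        = ‖η • gradEstimate S G C s.1.1 s.1.2 u - (s.1.1 - y)‖ ^ 2 := by
    intro u
    rw [← norm_neg]
    congr 2
    abel
  simp only [e]
  refine ⟨(hg'.sub (memLp_const (s.1.1 - y))).integrable_norm_pow two_ne_zero, ?_⟩
  have h1 := integral_sq_norm_sub_const hg' (s.1.1 - y)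
  simp only [Pi.smul_apply] at h1
  rw [h1, integral_smul, integral_gradEstimate hf hG hC hω hb hS hSN, inner_smul_right,
    real_inner_comm, gradSecondMoment]
  simp only [norm_smul, mul_pow, Real.norm_eq_abs, sq_abs]
  rw [integral_const_mul]
  ring

/-- The new model is independent of the set of clients updating their shifts, hence the expectation
factors. -/
theorem integral_model (hSN : S ≤ N) (s : TrackedState d N) {ψ : Vec d → ℝ}
    (hψ : Integrable (fun u : Finset (Fin N) × ((Fin N → Fin b → A) × (Fin N → Z)) =>
        ψ (s.1.1 - η • gradEstimate S G C s.1.1 s.1.2 u))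
        ((uniformOn {t : Finset (Fin N) | t.card = S}).prod (messageLaw b D κ)))
    (c : Finset (Fin N) → ℝ) :
    Integrable (fun r => c r.1.1 * ψ (trackedStep S b G C f φ η α reuse s r).1.1)
        (roundLaw S b D κ) ∧
      ∫ r, c r.1.1 * ψ (trackedStep S b G C f φ η α reuse s r).1.1 ∂(roundLaw S b D κ)
      = (∫ t, c t ∂(uniformOn {t : Finset (Fin N) | t.card = S})) *
        ∫ u, ψ (s.1.1 - η • gradEstimate S G C s.1.1 s.1.2 u)
          ∂((uniformOn {t : Finset (Fin N) | t.card = S}).prod (messageLaw b D κ)) := by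
  have := isProbabilityMeasure_uniformOn_card hSN
  have hmp := measurePreserving_modelDraw (b := b) (D := D) (κ := κ) hSN reuse
  have hi := (Integrable.of_finite (f := c)
    (μ := uniformOn {t : Finset (Fin N) | t.card = S})).mul_prod hψ
  refine ⟨(hmp.integrable_comp hi.1).2 hi, ?_⟩
  rw [← integral_prod_mul, ← hmp.map_eq, integral_map hmp.measurable.aemeasurable]
  · rfl
  · rw [hmp.map_eq]
    exact hi.1

/-- The squared distance is affine in the tracker: it mixes the distance of the new model to the old
tracker with `‖x' - x‖²`, which is `η²‖g‖²`. Both contain the second moment of the step with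
coefficient `η²`, so together it appears exactly once. -/
theorem integral_sqDist_trackedStep (hf : IsSmoothFamily f L) (hG : IsGradientOracle f D G σ)
    (hC : IsCompressor κ C ω) (hω : 0 ≤ ω) (hb : 1 ≤ b) (hS : 1 ≤ S) (hSN : S ≤ N)
    (s : TrackedState d N) (i : Fin N) :
    Integrable (fun r => ((trackedStep S b G C f φ η α reuse s r).2 i).sqDist
        (trackedStep S b G C f φ η α reuse s r).1.1) (roundLaw S b D κ) ∧
      ∫ r, ((trackedStep S b G C f φ η α reuse s r).2 i).sqDist
        (trackedStep S b G C f φ η α reuse s r).1.1 ∂(roundLaw S b D κ)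
      = (1 - α * (S / N)) * ((s.2 i).sqDist s.1.1
          - 2 * η * ⟪gradient (avgLoss f) s.1.1, s.1.1 - (s.2 i).2.1⟫)
        + η ^ 2 * gradSecondMoment S b D κ G C s := by
  have := isProbabilityMeasure_uniformOn_card hSN
  have hx := integral_sq_norm_model_sub (η := η) hf hG hC hω hb hS hSN s s.1.1
  have hc := integral_sq_norm_model_sub (η := η) hf hG hC hω hb hS hSN s (s.2 i).2.1
  have hq : Integrable (fun u : Finset (Fin N) × ((Fin N → Fin b → A) × (Fin N → Z)) =>
        (s.2 i).sqDist (s.1.1 - η • gradEstimate S G C s.1.1 s.1.2 u))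
        ((uniformOn {t : Finset (Fin N) | t.card = S}).prod (messageLaw b D κ)) ∧
      ∫ u, (s.2 i).sqDist (s.1.1 - η • gradEstimate S G C s.1.1 s.1.2 u)
        ∂((uniformOn {t : Finset (Fin N) | t.card = S}).prod (messageLaw b D κ))
      = (s.2 i).sqDist s.1.1 - 2 * η * ⟪gradient (avgLoss f) s.1.1, s.1.1 - (s.2 i).2.1⟫
        + η ^ 2 * gradSecondMoment S b D κ G C s := by
    simp only [Tracker.sqDist_eq]
    refine ⟨hc.1.add (integrable_const _), ?_⟩
    rw [integral_add hc.1 (integrable_const _), hc.2]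
    simp
    ring
  have h1 := integral_model (φ := φ) (f := f) (α := α) (reuse := reuse) hSN s hq.1 (fun _ => 1)
  have h2 := integral_model (φ := φ) (f := f) (α := α) (reuse := reuse) hSN s hq.1 (selected i)
  have h3 := integral_model (φ := φ) (f := f) (α := α) (reuse := reuse) hSN s
    (ψ := fun y => ‖y - s.1.1‖ ^ 2) hx.1 (selected i)
  have e : ∀ r : RoundDraw N b A Z, ((trackedStep S b G C f φ η α reuse s r).2 i).sqDist
      (trackedStep S b G C f φ η α reuse s r).1.1
      = 1 * (s.2 i).sqDist (trackedStep S b G C f φ η α reuse s r).1.1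
        + α * (selected i r.1.1 * ‖(trackedStep S b G C f φ η α reuse s r).1.1 - s.1.1‖ ^ 2
          - selected i r.1.1 * (s.2 i).sqDist (trackedStep S b G C f φ η α reuse s r).1.1) := by
    intro r
    rw [← Tracker.sqDist_dirac (f i) φ]
    refine (Tracker.sqDist_update _ _ _ _).trans ?_
    ring
  simp only [e]
  have h4 : Integrable (fun r : RoundDraw N b A Z =>
      α * (selected i r.1.1 * ‖(trackedStep S b G C f φ η α reuse s r).1.1 - s.1.1‖ ^ 2
        - selected i r.1.1 * (s.2 i).sqDist (trackedStep S b G C f φ η α reuse s r).1.1))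
      (roundLaw S b D κ) := (h3.1.sub h2.1).const_mul α
  refine ⟨h1.1.add h4, ?_⟩
  rw [integral_add h1.1 h4, integral_const_mul α,
    integral_sub h3.1 h2.1, h1.2, h2.2, h3.2, hq.2, hx.2, integral_selected hS hSN]
  simp
  ring

/-- Shift and tracked gradient move with the same weight, so a selected client's difference `n`
becomes `n + α(u - w)`, where `u` has mean `w - n`. The choice `α(1 + ω) = 1` makes the compression
noise `α²(1 + ω)‖w - n‖²` small enough to leave a contraction. -/
theorem integral_sq_norm_shift_sub_trackedStep_le
    (hG : IsGradientOracle f D G σ) (hC : IsCompressor κ C ω) (hω : 0 ≤ ω) (hb : 1 ≤ b)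
    (hS : 1 ≤ S) (hSN : S ≤ N) (hα : α = 1 / (1 + ω)) {s : TrackedState d N} (i : Fin N)
    (hs : (s.2 i).Valid (f i) L) :
    Integrable (fun r => ‖(trackedStep S b G C f φ η α reuse s r).1.2 i
        - ((trackedStep S b G C f φ η α reuse s r).2 i).1‖ ^ 2) (roundLaw S b D κ) ∧
      ∫ r, ‖(trackedStep S b G C f φ η α reuse s r).1.2 i
        - ((trackedStep S b G C f φ η α reuse s r).2 i).1‖ ^ 2 ∂(roundLaw S b D κ)
      ≤ (1 - α * (S / N) / 2) * ‖s.1.2 i - (s.2 i).1‖ ^ 2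
        + 3 * (α * (S / N)) * (L ^ 2 * (s.2 i).sqDist s.1.1) + α * (S / N) * (σ ^ 2 / b) := by
  have := isProbabilityMeasure_uniformOn_card hSN
  have hmp := measurePreserving_shiftDraw (b := b) (D := D) (κ := κ) hSN
  set x := s.1.1 with hx
  set n := s.1.2 i - (s.2 i).1 with hn
  set w := gradient (f i) x - (s.2 i).1 with hw
  set μ := gradient (f i) x - s.1.2 i with hμ
  have hμw : μ = w - n := by rw [hμ, hw, hn]; abel
  have hu := memLp_message hG hC hω hb x s.1.2 i
  have hu' := hu.const_smul α
  -- `ψ` is the change of `‖n‖²` if the client is selected; otherwise the change is zero, so the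
  -- expected change is `S/N` times the mean of `ψ`.
  set ψ : (Fin N → Fin b → A) × (Fin N → Z) → ℝ := fun z =>
    ‖α • message G C x s.1.2 i z - (α • w - n)‖ ^ 2 - ‖n‖ ^ 2 with hψ
  have hψ1 : Integrable (fun z => ‖α • message G C x s.1.2 i z - (α • w - n)‖ ^ 2)
      (messageLaw b D κ) := (hu'.sub (memLp_const (α • w - n))).integrable_norm_pow two_ne_zero
  have hψi : Integrable ψ (messageLaw b D κ) := hψ1.sub (integrable_const _)
  have hα0 : 0 < α := by rw [hα]; positivity
  have hα1 : α ≤ 1 := by rw [hα]; exact (div_le_one (by linarith)).2 (by linarith)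
  have hψint : ∫ z, ψ z ∂(messageLaw b D κ)
      ≤ -(α / 2) * ‖n‖ ^ 2 + 3 * α * (L ^ 2 * (s.2 i).sqDist x) + α * (σ ^ 2 / b) := by
    have h1 := integral_sq_norm_sub_const hu' (α • w - n)
    simp only [Pi.smul_apply] at h1
    rw [integral_smul, integral_message hG hC hω hb x s.1.2 i, ← hμ] at h1
    simp only [norm_smul, mul_pow, Real.norm_eq_abs, sq_abs] at h1
    rw [integral_const_mul] at h1
    have h2 := integral_sq_norm_message_le hG hC hω hb x s.1.2 i
    rw [← hμ] at h2
    have h3 : α ^ 2 * ∫ z, ‖message G C x s.1.2 i z‖ ^ 2 ∂(messageLaw b D κ)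
        ≤ α * (‖μ‖ ^ 2 + σ ^ 2 / b) := by
      refine (mul_le_mul_of_nonneg_left h2 (sq_nonneg α)).trans_eq ?_
      rw [hα]
      field_simp
    have h4 : ∫ z, ψ z ∂(messageLaw b D κ)
        = ∫ z, ‖α • message G C x s.1.2 i z - (α • w - n)‖ ^ 2 ∂(messageLaw b D κ) - ‖n‖ ^ 2 := by
      rw [hψ, integral_sub hψ1 (integrable_const _)]
      simp
    -- With `h3` this leaves `(1 - α)²‖n‖² + (α - α²)‖μ‖² + ασ²/b`.
    have h5 : ‖α • w - n‖ ^ 2 - 2 * ⟪α • w - n, α • μ⟫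
        = (1 - α) ^ 2 * ‖n‖ ^ 2 - α ^ 2 * ‖μ‖ ^ 2 := by
      have e : ∀ w n : Vec d, α • w - n = α • (w - n) - (1 - α) • n := by
        intro w n
        module
      rw [e, ← hμw, norm_sub_sq_real, inner_sub_left, real_inner_self_eq_norm_sq, norm_smul, norm_smul,
        mul_pow, mul_pow, Real.norm_eq_abs, Real.norm_eq_abs, sq_abs, sq_abs,
        real_inner_comm (α • μ)]
      ring
    -- The coefficient of `‖n‖²` must be below 2 for a contraction: with `3/2` one gets `(1 - α)² +
    -- (3/2)(α - α²) ≤ 1 - α/2`.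
    have h6 : ‖μ‖ ^ 2 ≤ 3 * ‖w‖ ^ 2 + 3 / 2 * ‖n‖ ^ 2 := by
      have h7 : 0 ≤ ‖(2 : ℝ) • w + n‖ ^ 2 := sq_nonneg _
      rw [norm_add_sq_real, norm_smul, inner_smul_left, mul_pow] at h7
      rw [hμw, norm_sub_sq_real]
      simp only [Real.norm_ofNat, conj_trivial] at h7
      linarith
    have h8 : ‖w‖ ^ 2 ≤ L ^ 2 * (s.2 i).sqDist x := hs.sq_norm_sub_le x
    have h9 : 0 ≤ α - α ^ 2 := by nlinarith
    have h10 := mul_le_mul_of_nonneg_left h6 h9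
    have h11 := mul_le_mul_of_nonneg_left h8 hα0.le
    have h12 := mul_nonneg (sq_nonneg α) (sq_nonneg ‖w‖)
    have h13 := mul_nonneg (sq_nonneg α) (sq_nonneg ‖n‖)
    rw [h4]
    nlinarith
  have hi : Integrable (fun p : Finset (Fin N) × ((Fin N → Fin b → A) × (Fin N → Z)) =>
      selected i p.1 * ψ p.2)
      ((uniformOn {t : Finset (Fin N) | t.card = S}).prod (messageLaw b D κ)) :=
    (Integrable.of_finite (f := selected i)).mul_prod hψi
  have hir : Integrable (fun r : RoundDraw N b A Z => selected i r.1.1 * ψ (shiftDraw r))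
      (roundLaw S b D κ) := (hmp.integrable_comp hi.1).2 hi
  have hirint : ∫ r : RoundDraw N b A Z, selected i r.1.1 * ψ (shiftDraw r) ∂(roundLaw S b D κ)
      = S / N * ∫ z, ψ z ∂(messageLaw b D κ) := by
    rw [← integral_selected hS hSN i, ← integral_prod_mul, ← hmp.map_eq,
      integral_map hmp.measurable.aemeasurable]
    rw [hmp.map_eq]
    exact hi.1
  have e : ∀ r : RoundDraw N b A Z, ‖(trackedStep S b G C f φ η α reuse s r).1.2 i
      - ((trackedStep S b G C f φ η α reuse s r).2 i).1‖ ^ 2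
      = ‖n‖ ^ 2 + selected i r.1.1 * ψ (shiftDraw r) := by
    intro r
    have e1 : (trackedStep S b G C f φ η α reuse s r).1.2 i
        - ((trackedStep S b G C f φ η α reuse s r).2 i).1
        = n + selected i r.1.1 • (α • message G C x s.1.2 i (shiftDraw r) - α • w) := by
      simp only [trackedStep, Tracker.dirac, Prod.fst_add, Prod.smul_fst, Prod.fst_sub]
      rw [hn, hw, hx, ← smul_sub, smul_smul, mul_comm (selected i _), smul_sub _ (message ..)]
      abel
    rw [e1, hψ]
    by_cases hi : i ∈ r.1.1
    · simp only [selected, hi, if_true, one_smul, one_mul]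
      rw [add_sub_cancel]
      congr 2
      abel
    · simp [selected, hi]
  have := isProbabilityMeasure_roundLaw (b := b) (D := D) (κ := κ) hSN
  simp only [e]
  refine ⟨(integrable_const _).add hir, ?_⟩
  rw [integral_add (integrable_const _) hir, hirint]
  have hp : (0 : ℝ) ≤ S / N := by positivity
  have := mul_le_mul_of_nonneg_left hψint hp
  simp
  linarith

theorem integral_value_trackedStep (hS : 1 ≤ S) (hSN : S ≤ N) (s : TrackedState d N)
    (i : Fin N) :
    Integrable (fun r => ((trackedStep S b G C f φ η α reuse s r).2 i).2.2.2)
        (roundLaw S b D κ) ∧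
      ∫ r, ((trackedStep S b G C f φ η α reuse s r).2 i).2.2.2 ∂(roundLaw S b D κ)
      = (1 - α * (S / N)) * (s.2 i).2.2.2 + α * (S / N) * φ s.1.1 := by
  have := isProbabilityMeasure_uniformOn_card hSN
  have := isProbabilityMeasure_roundLaw (b := b) (D := D) (κ := κ) hSN
  have hmp := measurePreserving_shiftDraw (b := b) (D := D) (κ := κ) hSN
  have hmp1 : MeasurePreserving (fun r : RoundDraw N b A Z => r.1.1) (roundLaw S b D κ)
    (uniformOn {t : Finset (Fin N) | t.card = S}) :=
    (measurePreserving_fst (μ := uniformOn {t : Finset (Fin N) | t.card = S})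
      (ν := messageLaw b D κ)).comp hmp
  have hi : Integrable (selected i) (uniformOn {t : Finset (Fin N) | t.card = S}) :=
    Integrable.of_finite
  have hir : Integrable (fun r : RoundDraw N b A Z => selected i r.1.1) (roundLaw S b D κ) :=
    (hmp1.integrable_comp hi.1).2 hi
  have hint : ∫ r : RoundDraw N b A Z, selected i r.1.1 ∂(roundLaw S b D κ) = S / N := by
    rw [← integral_selected hS hSN i, ← hmp1.map_eq, integral_map hmp1.measurable.aemeasurable]
    rw [hmp1.map_eq]
    exact hi.1
  have e : ∀ r : RoundDraw N b A Z, ((trackedStep S b G C f φ η α reuse s r).2 i).2.2.2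
      = (s.2 i).2.2.2 + selected i r.1.1 * (α * (φ s.1.1 - (s.2 i).2.2.2)) := by
    intro r
    simp only [trackedStep, Tracker.dirac, Prod.snd_add, Prod.smul_snd, Prod.snd_sub, smul_eq_mul]
    ring
  simp only [e]
  refine ⟨(integrable_const _).add (hir.mul_const _), ?_⟩
  rw [integral_add (integrable_const _) (hir.mul_const _), integral_mul_const, hint]
  simp
  ring

end TrackedStep

theorem integral_mean_le {Ω : Type*} [MeasurableSpace Ω] {μ : Measure Ω} {N : ℕ} (hN : 1 ≤ N)
    {g : Fin N → Ω → ℝ} {B : Fin N → ℝ} {c : ℝ}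
    (h : ∀ i, Integrable (g i) μ ∧ ∫ w, g i w ∂μ ≤ B i + c) :
    Integrable (fun w => (N : ℝ)⁻¹ * ∑ i, g i w) μ ∧
      ∫ w, (N : ℝ)⁻¹ * ∑ i, g i w ∂μ ≤ (N : ℝ)⁻¹ * ∑ i, B i + c := by
  have hN0 : (N : ℝ) ≠ 0 := by positivity
  refine ⟨(integrable_finsetSum _ fun i _ => (h i).1).const_mul _, ?_⟩
  rw [integral_const_mul, integral_finsetSum _ fun i _ => (h i).1]
  refine (mul_le_mul_of_nonneg_left (Finset.sum_le_sum fun i _ => (h i).2)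
    (by positivity)).trans_eq ?_
  simp [Finset.sum_add_distrib, mul_add, hN0]

namespace TrackedState

variable {d N : ℕ}

/-- The average over the clients of the tracked squared distance to the model. -/
noncomputable def meanSqDist (s : TrackedState d N) : ℝ :=
  (N : ℝ)⁻¹ * ∑ i, (s.2 i).sqDist s.1.1

/-- The average over the clients of the squared distance of shift and tracked gradient. -/
noncomputable def meanSqShift (s : TrackedState d N) : ℝ :=
  (N : ℝ)⁻¹ * ∑ i, ‖s.1.2 i - (s.2 i).1‖ ^ 2

/-- The average over the clients of the tracked value. -/
noncomputable def meanValue (s : TrackedState d N) : ℝ := (N : ℝ)⁻¹ * ∑ i, (s.2 i).2.2.2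

theorem meanSqShift_nonneg (s : TrackedState d N) : 0 ≤ s.meanSqShift := by
  unfold meanSqShift
  positivity

theorem measurable_meanSqDist : Measurable (meanSqDist : TrackedState d N → ℝ) := by
  unfold meanSqDist Tracker.sqDist
  fun_prop

theorem measurable_meanSqShift : Measurable (meanSqShift : TrackedState d N → ℝ) := by
  unfold meanSqShift
  fun_prop

theorem measurable_meanValue : Measurable (meanValue : TrackedState d N → ℝ) := by
  unfold meanValue
  fun_prop

end TrackedState

/-! ### Drift of the averaged quantities in one round. -/

section Drift

open TrackedState

variable {d N S b : ℕ} {A Z : Type*} {f : Fin N → Vec d → ℝ} {φ : Vec d → ℝ}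
  {G : Fin N → Vec d → A → Vec d} {C : Vec d → Z → Vec d} {σ ω L η α : ℝ} {reuse : Bool}

theorem meanSqDist_nonneg {s : TrackedState d N} (hs : ∀ i, (s.2 i).Valid (f i) L) :
    0 ≤ s.meanSqDist :=
  mul_nonneg (by positivity) (Finset.sum_nonneg fun i _ => (hs i).sqDist_nonneg _)

variable [MeasurableSpace A] [MeasurableSpace Z] {D : Fin N → Measure A} {κ : Measure Z}
  [∀ i, IsProbabilityMeasure (D i)] [IsProbabilityMeasure κ]

theorem gradSecondMoment_le (hf : IsSmoothFamily f L) (hG : IsGradientOracle f D G σ)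
    (hC : IsCompressor κ C ω) (hω : 0 ≤ ω) (hb : 1 ≤ b) (hS : 1 ≤ S) (hSN : S ≤ N)
    {s : TrackedState d N} (hs : ∀ i, (s.2 i).Valid (f i) L) :
    gradSecondMoment S b D κ G C s ≤ ‖gradient (avgLoss f) s.1.1‖ ^ 2
      + (1 + ω) / S * (2 * (L ^ 2 * s.meanSqDist) + 2 * s.meanSqShift + σ ^ 2 / b) := by
  refine (integral_sq_norm_gradEstimate_le hf hG hC hω hb hS hSN _ _).trans ?_
  have h : (N : ℝ)⁻¹ * ∑ i, ‖gradient (f i) s.1.1 - s.1.2 i‖ ^ 2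
      ≤ 2 * (L ^ 2 * s.meanSqDist) + 2 * s.meanSqShift := by
    calc _ ≤ (N : ℝ)⁻¹ * ∑ i, (2 * (L ^ 2 * (s.2 i).sqDist s.1.1)
          + 2 * ‖s.1.2 i - (s.2 i).1‖ ^ 2) := by
          refine mul_le_mul_of_nonneg_left (Finset.sum_le_sum fun i _ => ?_) (by positivity)
          have h1 := (hs i).sq_norm_sub_le s.1.1
          have h2 := parallelogram_law_with_norm ℝ (gradient (f i) s.1.1 - (s.2 i).1)
            (s.1.2 i - (s.2 i).1)
          rw [sub_sub_sub_cancel_right] at h2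
          nlinarith [mul_self_nonneg ‖gradient (f i) s.1.1 - (s.2 i).1 + (s.1.2 i - (s.2 i).1)‖]
      _ = _ := by
          simp only [meanSqDist, meanSqShift, Finset.sum_add_distrib, ← Finset.mul_sum]
          ring
  exact add_le_add le_rfl (mul_le_mul_of_nonneg_left (add_le_add h le_rfl) (by positivity))

theorem integral_meanSqShift_le (hG : IsGradientOracle f D G σ) (hC : IsCompressor κ C ω)
    (hω : 0 ≤ ω) (hb : 1 ≤ b) (hS : 1 ≤ S) (hSN : S ≤ N) (hα : α = 1 / (1 + ω))
    {s : TrackedState d N} (hs : ∀ i, (s.2 i).Valid (f i) L) :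
    Integrable (fun r => (trackedStep S b G C f φ η α reuse s r).meanSqShift)
        (roundLaw S b D κ) ∧
      ∫ r, (trackedStep S b G C f φ η α reuse s r).meanSqShift ∂(roundLaw S b D κ)
      ≤ (1 - α * (S / N) / 2) * s.meanSqShift
        + 3 * (α * (S / N)) * (L ^ 2 * s.meanSqDist) + α * (S / N) * (σ ^ 2 / b) := by
  have h := integral_mean_le (hS.trans hSN) fun i => integral_sq_norm_shift_sub_trackedStep_le (φ := φ) (η := η)
    (reuse := reuse) hG hC hω hb hS hSN hα i (hs i)
  refine ⟨h.1, h.2.trans_eq ?_⟩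
  simp only [meanSqShift, meanSqDist, Finset.sum_add_distrib, ← Finset.mul_sum]
  ring

/-- Half of the contraction `q` is spent in Young's inequality on the drift term `⟪∇f(x), x - c⟫`,
with `c` the tracked mean point. Only `‖∇f(x)‖²` acquires the factor `1/q`. -/
theorem integral_meanSqDist_le (hf : IsSmoothFamily f L) (hG : IsGradientOracle f D G σ)
    (hC : IsCompressor κ C ω) (hω : 0 ≤ ω) (hb : 1 ≤ b) (hS : 1 ≤ S) (hSN : S ≤ N)
    (hα0 : 0 < α) (hα1 : α ≤ 1) {s : TrackedState d N} (hs : ∀ i, (s.2 i).Valid (f i) L) :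
    Integrable (fun r => (trackedStep S b G C f φ η α reuse s r).meanSqDist)
        (roundLaw S b D κ) ∧
      ∫ r, (trackedStep S b G C f φ η α reuse s r).meanSqDist ∂(roundLaw S b D κ)
      ≤ (1 - α * (S / N) / 2) * s.meanSqDist
        + 2 * η ^ 2 / (α * (S / N)) * ‖gradient (avgLoss f) s.1.1‖ ^ 2
        + η ^ 2 * gradSecondMoment S b D κ G C s := by
  have hS0 : (0 : ℝ) < S := by exact_mod_cast hS
  have hN0 : (0 : ℝ) < N := by exact_mod_cast hS.trans hSN
  have hq0 : 0 < α * (S / N) := by positivity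
  have hq1 : α * (S / N) ≤ 1 :=
    mul_le_one₀ hα1 (by positivity) ((div_le_one hN0).2 (by exact_mod_cast hSN))
  set q := α * (S / N) with hq
  set γ := gradient (avgLoss f) s.1.1
  have key : ∀ i, (1 - q) * ((s.2 i).sqDist s.1.1 - 2 * η * ⟪γ, s.1.1 - (s.2 i).2.1⟫)
      ≤ (1 - q / 2) * (s.2 i).sqDist s.1.1 + 2 * η ^ 2 / q * ‖γ‖ ^ 2 := by
    intro i
    set Y := (s.2 i).sqDist s.1.1
    set v := s.1.1 - (s.2 i).2.1
    have h1 : ‖v‖ ^ 2 ≤ Y := (hs i).sq_dist_le _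
    have h2 : 0 ≤ ‖(2 * η) • γ + q • v‖ ^ 2 := sq_nonneg _
    rw [norm_add_sq_real, norm_smul, norm_smul, mul_pow, mul_pow, inner_smul_left,
      inner_smul_right, Real.norm_eq_abs, Real.norm_eq_abs, sq_abs, sq_abs] at h2
    simp only [conj_trivial] at h2
    have h3 : -(2 * η * ⟪γ, v⟫) ≤ q / 2 * Y + 2 * η ^ 2 / q * ‖γ‖ ^ 2 := by
      have h4 : 0 ≤ ((2 * η) ^ 2 * ‖γ‖ ^ 2 + 2 * (2 * η * (q * ⟪γ, v⟫)) + q ^ 2 * ‖v‖ ^ 2)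
          / (2 * q) := by positivity
      have h5 : ((2 * η) ^ 2 * ‖γ‖ ^ 2 + 2 * (2 * η * (q * ⟪γ, v⟫)) + q ^ 2 * ‖v‖ ^ 2)
          / (2 * q) = 2 * η ^ 2 / q * ‖γ‖ ^ 2 + 2 * η * ⟪γ, v⟫ + q / 2 * ‖v‖ ^ 2 := by
        field_simp
      rw [h5] at h4
      have := mul_le_mul_of_nonneg_left h1 (by positivity : 0 ≤ q / 2)
      linarith
    have h6 : 0 ≤ 2 * η ^ 2 / q * ‖γ‖ ^ 2 := by positivity
    have h7 : 0 ≤ Y := (sq_nonneg _).trans h1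
    have h8 := mul_le_mul_of_nonneg_left h3 (by linarith : 0 ≤ 1 - q)
    have h9 := mul_nonneg hq0.le h6
    have h10 := mul_nonneg (mul_nonneg hq0.le hq0.le) h7
    nlinarith
  have h := integral_mean_le (hS.trans hSN) fun i => (integral_sqDist_trackedStep (φ := φ) (η := η)
    (α := α) (reuse := reuse) hf hG hC hω hb hS hSN s i).imp_right fun e => (e.trans_le
      (add_le_add (key i) le_rfl)).trans_eq (add_assoc _ _ _)
  refine ⟨h.1, h.2.trans_eq ?_⟩
  simp only [meanSqDist, ← Finset.mul_sum]
  ring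

/-- Convexity bounds `-⟪∇f(x), x - c⟫`, with `c` the tracked mean point, by the tracked value. The
full contraction `q` survives and no `1/q` appears. -/
theorem integral_meanSqDist_le_of_convex (hf : IsSmoothFamily f L) (hG : IsGradientOracle f D G σ)
    (hC : IsCompressor κ C ω) (hω : 0 ≤ ω) (hb : 1 ≤ b) (hS : 1 ≤ S) (hSN : S ≤ N)
    (hα0 : 0 < α) (hα1 : α ≤ 1) (hη : 0 ≤ η) (hφ : ∀ x, 0 ≤ φ x) {s : TrackedState d N}
    (hs : ∀ i, (s.2 i).ConvexValid (avgLoss f) φ) :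
    Integrable (fun r => (trackedStep S b G C f φ η α reuse s r).meanSqDist)
        (roundLaw S b D κ) ∧
      ∫ r, (trackedStep S b G C f φ η α reuse s r).meanSqDist ∂(roundLaw S b D κ)
      ≤ (1 - α * (S / N)) * s.meanSqDist + 2 * η * s.meanValue
        + η ^ 2 * gradSecondMoment S b D κ G C s := by
  have hS0 : (0 : ℝ) < S := by exact_mod_cast hS
  have hN0 : (0 : ℝ) < N := by exact_mod_cast hS.trans hSN
  have hq0 : 0 < α * (S / N) := by positivity
  have hq1 : α * (S / N) ≤ 1 :=
    mul_le_one₀ hα1 (by positivity) ((div_le_one hN0).2 (by exact_mod_cast hSN))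
  set q := α * (S / N) with hq
  set γ := gradient (avgLoss f) s.1.1 with hγ
  have key : ∀ i, (1 - q) * ((s.2 i).sqDist s.1.1 - 2 * η * ⟪γ, s.1.1 - (s.2 i).2.1⟫)
      ≤ (1 - q) * (s.2 i).sqDist s.1.1 + 2 * η * (s.2 i).2.2.2 := by
    intro i
    have h1 := hs i s.1.1
    rw [← neg_sub, inner_neg_right, ← hγ] at h1
    have h3 : -⟪γ, s.1.1 - (s.2 i).2.1⟫ ≤ (s.2 i).2.2.2 := by linarith [hφ s.1.1]
    have h4 : 0 ≤ (s.2 i).2.2.2 := (hs i).value_nonneg hφ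
    have h5 := mul_le_mul_of_nonneg_left h3
      (mul_nonneg (mul_nonneg zero_le_two hη) (by linarith : 0 ≤ 1 - q))
    have h6 := mul_nonneg (mul_nonneg (mul_nonneg zero_le_two hη) hq0.le) h4
    nlinarith
  have h := integral_mean_le (hS.trans hSN) fun i => (integral_sqDist_trackedStep (φ := φ) (η := η)
    (α := α) (reuse := reuse) hf hG hC hω hb hS hSN s i).imp_right fun e => e.trans_le
      (add_le_add (key i) le_rfl)
  refine ⟨h.1, h.2.trans_eq ?_⟩
  simp only [meanSqDist, meanValue, Finset.sum_add_distrib, ← Finset.mul_sum]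
  ring

theorem integral_meanValue_le (hS : 1 ≤ S) (hSN : S ≤ N) (s : TrackedState d N) :
    Integrable (fun r => (trackedStep S b G C f φ η α reuse s r).meanValue)
        (roundLaw S b D κ) ∧
      ∫ r, (trackedStep S b G C f φ η α reuse s r).meanValue ∂(roundLaw S b D κ)
      ≤ (1 - α * (S / N)) * s.meanValue + α * (S / N) * φ s.1.1 := by
  have h := integral_mean_le (hS.trans hSN) fun i => (integral_value_trackedStep (b := b) (f := f) (φ := φ)
    (η := η) (α := α) (reuse := reuse) (G := G) (C := C) (D := D) (κ := κ)
    hS hSN s i).imp_right le_of_eq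
  refine ⟨h.1, h.2.trans_eq ?_⟩
  simp only [meanValue, ← Finset.mul_sum]
  ring

theorem integral_sq_norm_trackedStep_sub (hf : IsSmoothFamily f L) (hG : IsGradientOracle f D G σ)
    (hC : IsCompressor κ C ω) (hω : 0 ≤ ω) (hb : 1 ≤ b) (hS : 1 ≤ S) (hSN : S ≤ N)
    (s : TrackedState d N) (y : Vec d) :
    Integrable (fun r => ‖(trackedStep S b G C f φ η α reuse s r).1.1 - y‖ ^ 2)
        (roundLaw S b D κ) ∧
      ∫ r, ‖(trackedStep S b G C f φ η α reuse s r).1.1 - y‖ ^ 2 ∂(roundLaw S b D κ)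
      = ‖s.1.1 - y‖ ^ 2 - 2 * η * ⟪gradient (avgLoss f) s.1.1, s.1.1 - y⟫
        + η ^ 2 * gradSecondMoment S b D κ G C s := by
  have := isProbabilityMeasure_uniformOn_card hSN
  have h1 := integral_sq_norm_model_sub (η := η) hf hG hC hω hb hS hSN s y
  have h2 := integral_model (φ := φ) (f := f) (α := α) (reuse := reuse) hSN s
    (ψ := fun x => ‖x - y‖ ^ 2) h1.1 (fun _ => 1)
  simp only [one_mul, h1.2] at h2
  simpa using h2

theorem integral_avgLoss_trackedStep_le (hf : IsSmoothFamily f L) (hG : IsGradientOracle f D G σ)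
    (hC : IsCompressor κ C ω) (hω : 0 ≤ ω) (hb : 1 ≤ b) (hS : 1 ≤ S) (hSN : S ≤ N)
    {m : ℝ} (hm : ∀ x, m ≤ avgLoss f x) (s : TrackedState d N) :
    Integrable (fun r => avgLoss f (trackedStep S b G C f φ η α reuse s r).1.1 - m)
        (roundLaw S b D κ) ∧
      ∫ r, (avgLoss f (trackedStep S b G C f φ η α reuse s r).1.1 - m) ∂(roundLaw S b D κ)
      ≤ avgLoss f s.1.1 - m - η * ‖gradient (avgLoss f) s.1.1‖ ^ 2
        + L / 2 * η ^ 2 * gradSecondMoment S b D κ G C s := by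
  have := isProbabilityMeasure_uniformOn_card hSN
  have hN := hS.trans hSN
  set μ := (uniformOn {t : Finset (Fin N) | t.card = S}).prod (messageLaw b D κ)
  set x := s.1.1 with hx
  set γ := gradient (avgLoss f) x
  have hg := memLp_gradEstimate hG hC hω hb hSN x s.1.2
  have h1 : Integrable (fun u => ⟪γ, gradEstimate S G C x s.1.2 u⟫) μ :=
    (hg.integrable one_le_two).const_inner γ
  have h2 : Integrable (fun u => ‖gradEstimate S G C x s.1.2 u‖ ^ 2) μ :=
    hg.integrable_norm_pow two_ne_zero
  have h4 : Integrable (fun u => avgLoss f x - m - η * ⟪γ, gradEstimate S G C x s.1.2 u⟫) μ :=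
    (integrable_const _).sub (h1.const_mul η)
  have hR : Integrable (fun u => avgLoss f x - m - η * ⟪γ, gradEstimate S G C x s.1.2 u⟫
      + L / 2 * η ^ 2 * ‖gradEstimate S G C x s.1.2 u‖ ^ 2) μ :=
    h4.add (h2.const_mul _)
  have hle : ∀ u, avgLoss f (x - η • gradEstimate S G C x s.1.2 u) - m
      ≤ avgLoss f x - m - η * ⟪γ, gradEstimate S G C x s.1.2 u⟫
      + L / 2 * η ^ 2 * ‖gradEstimate (b := b) S G C x s.1.2 u‖ ^ 2 := by
    intro u
    have := le_quadratic_of_lipschitz_gradient hf.differentiable_avgLoss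
      (hf.lipschitz_avgLoss hN) x (x - η • gradEstimate S G C x s.1.2 u)
    rw [sub_sub_cancel_left, inner_neg_right, inner_smul_right, norm_neg, norm_smul, mul_pow,
      Real.norm_eq_abs, sq_abs] at this
    linarith
  have hi : Integrable (fun u => avgLoss f (x - η • gradEstimate S G C x s.1.2 u) - m) μ := by
    refine hR.mono' ?_ (Filter.Eventually.of_forall fun u => ?_)
    · exact (hf.differentiable_avgLoss.continuous.comp_aestronglyMeasurable
        (aestronglyMeasurable_const.sub (hg.1.const_smul η))).sub aestronglyMeasurable_const
    · rw [Real.norm_of_nonneg (sub_nonneg.2 (hm _))]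
      exact hle u
  have h3 := integral_model (φ := φ) (f := f) (α := α) (reuse := reuse) hSN s
    (ψ := fun x => avgLoss f x - m) hi (fun _ => 1)
  simp only [one_mul] at h3
  refine ⟨h3.1, ?_⟩
  rw [h3.2]
  simp only [integral_const, probReal_univ, smul_eq_mul, one_mul]
  refine (integral_mono hi hR hle).trans_eq ?_
  rw [integral_add h4 (h2.const_mul _),
    integral_sub (integrable_const _) (h1.const_mul η), integral_const_mul, integral_const_mul,
    integral_inner (hg.integrable one_le_two), integral_gradEstimate hf hG hC hω hb hS hSN,
    real_inner_self_eq_norm_sq, gradSecondMoment, integral_const, probReal_univ, one_smul]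

end Drift

/-! ### Real inequalities behind the two Lyapunov functions. -/

section Potential

variable {L η K q : ℝ}

/-- Choosing `B * q = 4Lη²K` makes the loss `B * q / 2` of `B * M` pay for the `M` inside `Γ`. The
weight `8BL²` gives the loss `4BqL²Y`, against `3BqL²Y` from `M'` and at most `BqL²Y/2` from `Γ`.
The hypothesis `h3` serves only the `1/q` term in `P`. -/
theorem nonconvex_potential_decrease (hη : 0 ≤ η) (hL : 0 ≤ L) (hK : 0 ≤ K) (hq0 : 0 < q)
    (hq1 : q ≤ 1) (h1 : L * η ≤ 1 / 20) (h2 : (L * η) ^ 2 * K ≤ q / 400)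
    (h3 : (L * η) ^ 3 * K ≤ q ^ 2 / 8000) {B P Y M Γ F F' Y' M' ν : ℝ}
    (hB : B = 4 * L * η ^ 2 * K / q) (hP : 0 ≤ P) (hY : 0 ≤ Y) (hM : 0 ≤ M) (hν : 0 ≤ ν)
    (hΓ : Γ ≤ P + K * (2 * (L ^ 2 * Y) + 2 * M + ν))
    (hF' : F' ≤ F - η * P + L / 2 * η ^ 2 * Γ)
    (hY' : Y' ≤ (1 - q / 2) * Y + 2 * η ^ 2 / q * P + η ^ 2 * Γ)
    (hM' : M' ≤ (1 - q / 2) * M + 3 * q * (L ^ 2 * Y) + q * ν) :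
    F' + 8 * B * L ^ 2 * Y' + B * M' + η / 2 * P
      ≤ F + 8 * B * L ^ 2 * Y + B * M + 5 * L * η ^ 2 * K * ν := by
  have hB0 : 0 ≤ B := by rw [hB]; positivity
  have hBq : B * q = 4 * L * η ^ 2 * K := by rw [hB]; field_simp
  have hY0 : 0 ≤ L ^ 2 * Y := by positivity
  have hcΓ : 0 ≤ L / 2 * η ^ 2 + 8 * B * L ^ 2 * η ^ 2 := by positivity
  have e1 := mul_le_mul_of_nonneg_left hY' (by positivity : 0 ≤ 8 * B * L ^ 2)
  have e2 := mul_le_mul_of_nonneg_left hM' hB0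
  have e3 := mul_le_mul_of_nonneg_left hΓ hcΓ
  have hcK : (L / 2 * η ^ 2 + 8 * B * L ^ 2 * η ^ 2) * K ≤ B * q / 4 := by
    have h4 := mul_le_mul_of_nonneg_left h2 hB0
    have h5 := mul_nonneg hB0 hq0.le
    linarith
  have e4 := mul_le_mul_of_nonneg_right hcK
    (by positivity : 0 ≤ 2 * (L ^ 2 * Y) + 2 * M + ν)
  have hP1 : 8 * B * L ^ 2 * (2 * η ^ 2 / q) ≤ 8 / 1000 * η := by
    have : 8 * B * L ^ 2 * (2 * η ^ 2 / q) = 64 * η * (((L * η) ^ 3 * K) / q ^ 2) := by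
      rw [hB]; field_simp; ring
    rw [this]
    have h4 : (L * η) ^ 3 * K / q ^ 2 ≤ 1 / 8000 := by
      rw [div_le_iff₀ (by positivity)]; linarith
    have h5 := mul_le_mul_of_nonneg_left h4 hη
    linarith
  have hP2 : 8 * B * L ^ 2 * η ^ 2 ≤ 8 / 1000 * η := by
    refine le_trans ?_ hP1
    have : η ^ 2 ≤ 2 * η ^ 2 / q := by
      rw [le_div_iff₀ hq0]; nlinarith [sq_nonneg η]
    exact mul_le_mul_of_nonneg_left this (by positivity)
  have hP3 : L / 2 * η ^ 2 ≤ η / 40 := by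
    have := mul_le_mul_of_nonneg_right h1 hη
    linarith
  have e5 : (8 * B * L ^ 2 * (2 * η ^ 2 / q) + 8 * B * L ^ 2 * η ^ 2 + L / 2 * η ^ 2) * P
      ≤ η / 2 * P := mul_le_mul_of_nonneg_right (by linarith) hP
  have e6 : 0 ≤ B * q * (L ^ 2 * Y) := by positivity
  have e7 : 5 * L * η ^ 2 * K * ν = 5 / 4 * (B * q * ν) := by rw [hBq]; ring
  rw [e7]
  -- Only the bounds on this coefficient matter from here on; as an atom it keeps the goal linear in
  -- the collected products.
  generalize 2 * η ^ 2 / q = c at *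
  linarith

/-- Here `Y` contracts at rate `q`, so the weight `4BL²` suffices. `E` is chosen so that the loss `E
* q * Φ` cancels the tracked value entering through `Y'`; the price `E * q * φ`, like the `2Lφ`
bounding `P`, is absorbed by half of the gain `2ηφ`. -/
theorem convex_potential_decrease (hη : 0 ≤ η) (hL : 0 ≤ L) (hK : 0 ≤ K) (hq0 : 0 < q)
    (h1 : L * η ≤ 1 / 20) (h2 : (L * η) ^ 2 * K ≤ q / 400)
    {B E P Y M Γ R φ Φ R' Y' M' Φ' ν : ℝ}
    (hB : B = 8 * η ^ 2 * K / q) (hE : E = 8 * B * L ^ 2 * η / q) (hφ : 0 ≤ φ) (hY : 0 ≤ Y)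
    (hM : 0 ≤ M) (hν : 0 ≤ ν) (hP : P ≤ 2 * L * φ)
    (hΓ : Γ ≤ P + K * (2 * (L ^ 2 * Y) + 2 * M + ν))
    (hR' : R' ≤ R - 2 * η * φ + η ^ 2 * Γ)
    (hY' : Y' ≤ (1 - q) * Y + 2 * η * Φ + η ^ 2 * Γ)
    (hM' : M' ≤ (1 - q / 2) * M + 3 * q * (L ^ 2 * Y) + q * ν)
    (hΦ' : Φ' ≤ (1 - q) * Φ + q * φ) :
    R' + 4 * B * L ^ 2 * Y' + B * M' + E * Φ' + η * φ
      ≤ R + 4 * B * L ^ 2 * Y + B * M + E * Φ + 10 * η ^ 2 * K * ν := by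
  have hB0 : 0 ≤ B := by rw [hB]; positivity
  have hBq : B * q = 8 * η ^ 2 * K := by rw [hB]; field_simp
  have hE0 : 0 ≤ E := by rw [hE]; positivity
  have hEq : E * q = 8 * B * L ^ 2 * η := by rw [hE]; field_simp
  have hBL : B * L ^ 2 ≤ 1 / 50 := by
    have : B * L ^ 2 = 8 * (((L * η) ^ 2 * K) / q) := by rw [hB]; ring
    rw [this]
    have : (L * η) ^ 2 * K / q ≤ 1 / 400 := by
      rw [div_le_iff₀ hq0]; linarith
    linarith
  have hcΓ : 0 ≤ η ^ 2 + 4 * B * L ^ 2 * η ^ 2 := by positivity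
  have e1 := mul_le_mul_of_nonneg_left hY' (by positivity : 0 ≤ 4 * B * L ^ 2)
  have e2 := mul_le_mul_of_nonneg_left hM' hB0
  have e3 := mul_le_mul_of_nonneg_left (hΓ.trans (add_le_add hP le_rfl)) hcΓ
  have e0 := mul_le_mul_of_nonneg_left hΦ' hE0
  have hcK : (η ^ 2 + 4 * B * L ^ 2 * η ^ 2) * K ≤ 3 / 16 * (B * q) := by
    have h4 := mul_le_mul_of_nonneg_left h2 hB0
    have h5 := mul_nonneg hB0 hq0.le
    linarith
  have e4 := mul_le_mul_of_nonneg_right hcK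
    (by positivity : 0 ≤ 2 * (L ^ 2 * Y) + 2 * M + ν)
  have hη1 : η ^ 2 * (2 * L) ≤ η / 10 := by
    have := mul_le_mul_of_nonneg_right h1 hη
    linarith
  have hη2 : 4 * B * L ^ 2 * η ^ 2 * (2 * L) ≤ η / 10 := by
    have := mul_le_mul hBL hη1 (by positivity) (by norm_num)
    linarith
  have hη3 : 8 * B * L ^ 2 * η ≤ η / 5 := by
    have := mul_le_mul_of_nonneg_right hBL hη
    linarith
  have e5 : ((η ^ 2 + 4 * B * L ^ 2 * η ^ 2) * (2 * L) + E * q) * φ ≤ η * φ :=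
    mul_le_mul_of_nonneg_right (by rw [hEq]; linarith) hφ
  have e6 : 0 ≤ B * q * (L ^ 2 * Y) := by positivity
  have e7 : 0 ≤ B * q * M := by positivity
  have e8 : 0 ≤ B * q * ν := by positivity
  have e9 : 10 * η ^ 2 * K * ν = 5 / 4 * (B * q * ν) := by rw [hBq]; ring
  have e10 : E * q * Φ = 4 * B * L ^ 2 * (2 * η * Φ) := by rw [hEq]; ring
  rw [e9]
  linarith

end Potential

/-! ### Summed bounds along the iteration. -/

section Rates

open TrackedState

variable {d N S b : ℕ} {A Z Ω : Type*} [MeasurableSpace A] [MeasurableSpace Z]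
  [MeasurableSpace Ω] {f : Fin N → Vec d → ℝ} {D : Fin N → Measure A}
  [∀ i, IsProbabilityMeasure (D i)] {G : Fin N → Vec d → A → Vec d} {κ : Measure Z}
  [IsProbabilityMeasure κ] {C : Vec d → Z → Vec d} {P : Measure Ω} [IsProbabilityMeasure P]
  {ρ : ℕ → Ω → RoundDraw N b A Z} {σ ω L η ε a : ℝ} {reuse : Bool} {x₀ : Vec d}
  {h₀ : Fin N → Vec d}

theorem selection_rate_bounds (hS : 1 ≤ S) (hSN : S ≤ N) (hω : 0 ≤ ω) :
    0 < 1 / (1 + ω) * (S / N : ℝ) ∧ 1 / (1 + ω) * (S / N : ℝ) ≤ 1 ∧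
      1 / (1 + ω) * (S / N : ℝ) * (N * ((1 + ω) / S)) = 1 := by
  have hS0 : (0 : ℝ) < S := by exact_mod_cast hS
  have hN0 : (0 : ℝ) < N := by exact_mod_cast hS.trans hSN
  refine ⟨by positivity, ?_, by field_simp⟩
  exact mul_le_one₀ ((div_le_one (by positivity)).2 (by linarith)) (by positivity)
    ((div_le_one hN0).2 (by exact_mod_cast hSN))

/-- Since `q * n * K = 1`, the claim is `(e * K)² * n ≤ 1/400`; this is why `a` need only be of size
`√n`. -/
theorem sq_mul_le_of_rate {e K q n : ℝ} (hq0 : 0 < q) (hqK : q * (n * K) = 1) (hNa : n ≤ a ^ 2)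
    (he0 : 0 ≤ e) (hK : 0 ≤ K) (ha : 0 ≤ a) (he : e * (K * a) ≤ 1 / 20) :
    e ^ 2 * K ≤ q / 400 := by
  have h1 : e ^ 2 * K = q * ((e * K) ^ 2 * n) := by
    linear_combination (-e ^ 2 * K) * hqK
  have h2 : (e * K) ^ 2 * n ≤ (1 / 20) ^ 2 := by
    calc (e * K) ^ 2 * n ≤ (e * K) ^ 2 * a ^ 2 := by gcongr
      _ = (e * (K * a)) ^ 2 := by ring
      _ ≤ _ := by gcongr
  rw [h1]
  have := mul_le_mul_of_nonneg_left h2 hq0.le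
  linarith

theorem initial_meanSqShift (F : Vec d → ℝ) (x y : Vec d) :
    meanSqShift (((x, h₀), fun i => Tracker.dirac (f i) F y) : TrackedState d N)
      = (N : ℝ)⁻¹ * ∑ i, ‖h₀ i - gradient (f i) y‖ ^ 2 := rfl

theorem initial_meanSqDist (hN : 1 ≤ N) (F : Vec d → ℝ) (x y : Vec d) :
    meanSqDist (((x, h₀), fun i => Tracker.dirac (f i) F y) : TrackedState d N)
      = ‖x - y‖ ^ 2 := by
  have : (N : ℝ) ≠ 0 := by positivity
  simp [meanSqDist, Tracker.sqDist_dirac, this]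

theorem cofig_sum_sq_norm_gradient_le (hS : 1 ≤ S) (hSN : S ≤ N) (hb : 1 ≤ b) (hL : 0 < L)
    (hω : 0 ≤ ω) (hη : 0 < η) (ha : 0 ≤ a) (hNa : (N : ℝ) ≤ a ^ 2) (hNa' : (N : ℝ) ^ 2 ≤ a ^ 3)
    (hη1 : L * η ≤ 1 / 20) (hη2 : L * η * ((1 + ω) / S * a) ≤ 1 / 20)
    (hσ : σ ^ 2 / b ≤ ε ^ 2 * a)
    (hf : IsSmoothFamily f L) (hG : IsGradientOracle f D G σ) (hC : IsCompressor κ C ω)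
    (hρ : IsRoundSampling S b D κ P ρ) (hbdd : BddBelow (Set.range (avgLoss f))) :
    (∀ t, Integrable (fun w => η / 2 * ‖gradient (avgLoss f)
        (cofig S b G C η (1 / (1 + ω)) reuse x₀ h₀ (fun s => ρ s w) t).x‖ ^ 2) P) ∧
      ∀ T, ∑ t ∈ Finset.range T, ∫ w, η / 2 * ‖gradient (avgLoss f)
        (cofig S b G C η (1 / (1 + ω)) reuse x₀ h₀ (fun s => ρ s w) t).x‖ ^ 2 ∂P
        ≤ (avgLoss f x₀ - ⨅ x, avgLoss f x) + initialShiftError f x₀ h₀ / L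
          + T * (η * ε ^ 2 / 4) := by
  have hN := hS.trans hSN
  have hS0 : (0 : ℝ) < S := by exact_mod_cast hS
  obtain ⟨hq0, hq1, hqK⟩ := selection_rate_bounds hS hSN hω
  set α := 1 / (1 + ω) with hα
  have hα0 : 0 < α := by positivity
  have hα1 : α ≤ 1 := (div_le_one (by positivity)).2 (by linarith)
  set q := α * (S / N : ℝ) with hq
  set K := (1 + ω) / S with hK
  have hK0 : 0 ≤ K := by positivity
  set m := ⨅ x, avgLoss f x with hm
  have hmle : ∀ x, m ≤ avgLoss f x := fun x => ciInf_le hbdd x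
  set B := 4 * L * η ^ 2 * K / q with hB
  have hB0 : 0 ≤ B := by positivity
  have h2 : (L * η) ^ 2 * K ≤ q / 400 :=
    sq_mul_le_of_rate hq0 hqK hNa (by positivity) hK0 ha hη2
  have h3 : (L * η) ^ 3 * K ≤ q ^ 2 / 8000 := by
    -- Two uses of `q * N * K = 1`; the factor `N²` under a third power is what asks for `a` of size
    -- `N^{2/3}`.
    have h3 : (L * η) ^ 3 * K = q ^ 2 * ((L * η * K) ^ 3 * N ^ 2) := by
      linear_combination (-(L * η) ^ 3 * K * (q * (N * K) + 1)) * hqK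
    have h4 : (L * η * K) ^ 3 * (N : ℝ) ^ 2 ≤ (1 / 20) ^ 3 := by
      calc (L * η * K) ^ 3 * (N : ℝ) ^ 2 ≤ (L * η * K) ^ 3 * a ^ 3 := by gcongr
        _ = (L * η * (K * a)) ^ 3 := by ring
        _ ≤ _ := by gcongr
    rw [h3]
    have := mul_le_mul_of_nonneg_left h4 (sq_nonneg q)
    linarith
  let φ : Vec d → ℝ := fun _ => 0
  let step := trackedStep S b G C f φ η α reuse
  let V : TrackedState d N → ℝ := fun s =>
    avgLoss f s.1.1 - m + 8 * B * L ^ 2 * s.meanSqDist + B * s.meanSqShift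
  let W : TrackedState d N → ℝ := fun s => η / 2 * ‖gradient (avgLoss f) s.1.1‖ ^ 2
  let I : TrackedState d N → Prop := fun s => ∀ i, (s.2 i).Valid (f i) L
  -- Trackers concentrated at `x₀` have distance 0 to the model, and their shift error is the
  -- initial one.
  let a₀ : Fin N → Tracker d := fun i => Tracker.dirac (f i) φ x₀
  have hprob := isProbabilityMeasure_roundLaw (b := b) (D := D) (κ := κ) hSN
  have hV : Measurable V := by
    have h1 : Measurable fun s : TrackedState d N => s.1.1 := by fun_prop
    exact ((hf.differentiable_avgLoss.continuous.measurable.comp h1).sub_const m).add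
      (measurable_meanSqDist.const_mul _) |>.add (measurable_meanSqShift.const_mul B)
  have hW : Measurable W := by
    have h1 : Measurable fun s : TrackedState d N => s.1.1 := by fun_prop
    exact ((((hf.continuous_gradient_avgLoss hL.le).measurable.comp h1).norm).pow_const 2).const_mul _
  have hV0 : ∀ s, I s → 0 ≤ V s := fun s hs =>
    add_nonneg (add_nonneg (sub_nonneg.2 (hmle _))
      (mul_nonneg (by positivity) (meanSqDist_nonneg hs)))
      (mul_nonneg hB0 (meanSqShift_nonneg s))
  have hint : ∀ s, I s → Integrable (fun r => V (step s r)) (roundLaw S b D κ) ∧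
      ∫ r, V (step s r) ∂(roundLaw S b D κ) + W s ≤ V s + η * ε ^ 2 / 4 := by
    intro s hs
    have i1 := integral_avgLoss_trackedStep_le (φ := φ) (η := η) (α := α) (reuse := reuse) hf hG hC
      hω hb hS hSN hmle s
    have i2 := integral_meanSqDist_le (φ := φ) (η := η) (reuse := reuse) hf hG hC hω hb hS hSN
      hα0 hα1 hs
    have i3 := integral_meanSqShift_le (φ := φ) (η := η) (reuse := reuse) hG hC hω hb hS hSN hα hs
    have i4 := gradSecondMoment_le hf hG hC hω hb hS hSN hs
    have j2 := i2.1.const_mul (8 * B * L ^ 2)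
    have j3 := i3.1.const_mul B
    have j12 := i1.1.add j2
    refine ⟨j12.add j3, ?_⟩
    have key := nonconvex_potential_decrease hη.le hL.le hK0 hq0 hq1 hη1 h2 h3 hB (sq_nonneg _)
      (meanSqDist_nonneg hs) (meanSqShift_nonneg s) (by positivity) i4 i1.2 i2.2 i3.2
    have e : ∫ r, V (step s r) ∂(roundLaw S b D κ)
        = ∫ r, (avgLoss f (step s r).1.1 - m) ∂(roundLaw S b D κ)
          + 8 * B * L ^ 2 * ∫ r, (step s r).meanSqDist ∂(roundLaw S b D κ)
          + B * ∫ r, (step s r).meanSqShift ∂(roundLaw S b D κ) := by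
      rw [← integral_const_mul, ← integral_const_mul, ← integral_add i1.1 j2]
      exact integral_add j12 j3
    have hnoise : 5 * L * η ^ 2 * K * (σ ^ 2 / b) ≤ η * ε ^ 2 / 4 := by
      calc 5 * L * η ^ 2 * K * (σ ^ 2 / b) ≤ 5 * L * η ^ 2 * K * (ε ^ 2 * a) := by gcongr
        _ = 5 * η * ε ^ 2 * (L * η * (K * a)) := by ring
        _ ≤ 5 * η * ε ^ 2 * (1 / 20) := by gcongr
        _ = _ := by ring
    rw [e]
    exact key.trans (add_le_add le_rfl hnoise)
  have main := sum_integral_le_of_lyapunov (s₀ := ((x₀, h₀), a₀)) (P := P) (ρ := ρ)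
    (measurable_trackedStep (φ := φ) (η := η) (α := α) (reuse := reuse) hL.le hf measurable_const
      hG hC) hρ.measurable hρ.indep hρ.law (I := I) (V := V) (W := W)
    (fun i => Tracker.valid_dirac (hf.lipschitz i) φ x₀)
    (fun s r hs => valid_trackedStep hf hα0.le hα1 hs r) hV hW hV0
    (fun s _ => by positivity) (by positivity : 0 ≤ η * ε ^ 2 / 4)
    (fun s hs => (hint s hs).1) (fun s hs => (hint s hs).2)
  have hx : ∀ t w, (cofig S b G C η α reuse x₀ h₀ (fun s => ρ s w) t).x
      = (randomIterate step ((x₀, h₀), a₀) (fun s => ρ s w) t).1.1 := fun t w => by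
    rw [cofig_eq_randomIterate (f := f) (φ := φ) hN x₀ h₀ a₀]
  simp only [hx]
  refine ⟨main.1, fun T => (main.2 T).trans (add_le_add ?_ le_rfl)⟩
  have hV₀ : V ((x₀, h₀), a₀) = avgLoss f x₀ - m + B * initialShiftError f x₀ h₀ := by
    simp only [V, a₀]
    rw [initial_meanSqDist hN, initial_meanSqShift, initialShiftError]
    simp
  rw [hV₀, div_eq_inv_mul]
  have hG0 : 0 ≤ initialShiftError f x₀ h₀ := by unfold initialShiftError; positivity
  refine add_le_add le_rfl (mul_le_mul_of_nonneg_right ?_ hG0)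
  rw [← one_div, le_div_iff₀ hL, hB, div_mul_eq_mul_div, div_le_one hq0]
  linarith

/-- The potential used in the convex case. -/
noncomputable def convexPotential (L B E : ℝ) (xstar : Vec d) (s : TrackedState d N) : ℝ :=
  ‖s.1.1 - xstar‖ ^ 2 + 4 * B * L ^ 2 * s.meanSqDist + B * s.meanSqShift + E * s.meanValue

theorem integral_convexPotential_le {xstar : Vec d} {α q K B E : ℝ} {φ : Vec d → ℝ}
    (hS : 1 ≤ S) (hSN : S ≤ N) (hb : 1 ≤ b) (hL : 0 ≤ L) (hω : 0 ≤ ω) (hη : 0 ≤ η)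
    (hα : α = 1 / (1 + ω)) (hq : q = α * (S / N)) (hK : K = (1 + ω) / S)
    (hB : B = 8 * η ^ 2 * K / q) (hE : E = 8 * B * L ^ 2 * η / q) (hη1 : L * η ≤ 1 / 20)
    (h2 : (L * η) ^ 2 * K ≤ q / 400)
    (hf : IsSmoothFamily f L) (hG : IsGradientOracle f D G σ) (hC : IsCompressor κ C ω)
    (hmin : ∀ x, avgLoss f xstar ≤ avgLoss f x)
    (hφ : φ = fun x => avgLoss f x - avgLoss f xstar)
    (hφgrad : ∀ x y, φ y + ⟪gradient (avgLoss f) y, x - y⟫ ≤ φ x) {s : TrackedState d N}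
    (hs : ∀ i, (s.2 i).Valid (f i) L) (hs' : ∀ i, (s.2 i).ConvexValid (avgLoss f) φ) :
    Integrable (fun r => convexPotential L B E xstar (trackedStep S b G C f φ η α reuse s r))
        (roundLaw S b D κ) ∧
      ∫ r, convexPotential L B E xstar (trackedStep S b G C f φ η α reuse s r) ∂(roundLaw S b D κ)
        + η * φ s.1.1 ≤ convexPotential L B E xstar s + 10 * η ^ 2 * K * (σ ^ 2 / b) := by
  have hN := hS.trans hSN
  have hS0 : (0 : ℝ) < S := by exact_mod_cast hS
  obtain ⟨hq0, -, -⟩ := selection_rate_bounds hS hSN hω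
  rw [← hα, ← hq] at hq0
  have hα0 : 0 < α := by rw [hα]; positivity
  have hα1 : α ≤ 1 := by rw [hα]; exact (div_le_one (by positivity)).2 (by linarith)
  have hK0 : 0 ≤ K := by rw [hK]; positivity
  have hφ0 : ∀ x, 0 ≤ φ x := fun x => by rw [hφ]; exact sub_nonneg.2 (hmin x)
  have i1 := integral_sq_norm_trackedStep_sub (φ := φ) (η := η) (α := α) (reuse := reuse) hf hG
    hC hω hb hS hSN s xstar
  have i2 := integral_meanSqDist_le_of_convex (reuse := reuse) hf hG hC hω hb hS hSN
    hα0 hα1 hη hφ0 hs'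
  have i3 := integral_meanSqShift_le (φ := φ) (η := η) (reuse := reuse) hG hC hω hb hS hSN hα hs
  have i5 := integral_meanValue_le (b := b) (D := D) (κ := κ) (G := G) (C := C) (f := f)
    (φ := φ) (η := η) (α := α) (reuse := reuse) hS hSN s
  have i4 := gradSecondMoment_le hf hG hC hω hb hS hSN hs
  rw [← hq] at i2 i3 i5
  rw [← hK] at i4
  have j2 := i2.1.const_mul (4 * B * L ^ 2)
  have j3 := i3.1.const_mul B
  have j5 := i5.1.const_mul E
  have j12 := i1.1.add j2
  have j123 := j12.add j3
  refine ⟨j123.add j5, ?_⟩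
  have i1' : ∫ r, ‖(trackedStep S b G C f φ η α reuse s r).1.1 - xstar‖ ^ 2 ∂(roundLaw S b D κ)
      ≤ ‖s.1.1 - xstar‖ ^ 2 - 2 * η * φ s.1.1 + η ^ 2 * gradSecondMoment S b D κ G C s := by
    rw [i1.2]
    have h5 := hφgrad xstar s.1.1
    have h6 : φ xstar = 0 := by rw [hφ]; exact sub_self _
    rw [← neg_sub, inner_neg_right, h6] at h5
    have h7 := mul_le_mul_of_nonneg_left h5 (by positivity : 0 ≤ 2 * η)
    linarith
  have hP : ‖gradient (avgLoss f) s.1.1‖ ^ 2 ≤ 2 * L * φ s.1.1 := by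
    rw [hφ]
    exact sq_norm_gradient_le_of_lower_bound hf.differentiable_avgLoss
      (hf.lipschitz_avgLoss hN) hL hmin s.1.1
  have key := convex_potential_decrease hη hL hK0 hq0 hη1 h2 hB hE (hφ0 _)
    (meanSqDist_nonneg hs) (meanSqShift_nonneg s) (by positivity) hP i4 i1' i2.2 i3.2 i5.2
  refine le_trans (le_of_eq ?_) key
  rw [← integral_const_mul, ← integral_const_mul, ← integral_const_mul, ← integral_add i1.1 j2]
  exact congrArg (· + _) ((integral_add j123 j5).trans (congrArg (· + _) (integral_add j12 j3)))

theorem mean_sq_norm_sub_le (hN : 1 ≤ N) (hf : IsSmoothFamily f L) (y : Vec d) :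
    (N : ℝ)⁻¹ * ∑ i, ‖h₀ i - gradient (f i) y‖ ^ 2
      ≤ 2 * initialShiftError f x₀ h₀ + 2 * (L ^ 2 * ‖x₀ - y‖ ^ 2) := by
  have hNne : (N : ℝ) ≠ 0 := by positivity
  calc _ ≤ (N : ℝ)⁻¹ * ∑ i, (2 * ‖h₀ i - gradient (f i) x₀‖ ^ 2
        + 2 * (L ^ 2 * ‖x₀ - y‖ ^ 2)) := by
        refine mul_le_mul_of_nonneg_left (Finset.sum_le_sum fun i _ => ?_) (by positivity)
        have h3 := norm_sub_le_norm_sub_add_norm_sub (h₀ i) (gradient (f i) x₀) (gradient (f i) y)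
        have h4 := pow_le_pow_left₀ (norm_nonneg _) h3 2
        have h5 := pow_le_pow_left₀ (norm_nonneg _) (hf.lipschitz i x₀ y) 2
        rw [mul_pow] at h5
        have h6 := sq_nonneg (‖h₀ i - gradient (f i) x₀‖ - ‖gradient (f i) x₀ - gradient (f i) y‖)
        linarith
    _ = _ := by
        rw [initialShiftError]
        simp [Finset.sum_add_distrib, ← Finset.mul_sum, mul_add, hNne]
        ring

/-- Starting the trackers at the minimizer makes the tracked value 0. Starting at `x₀` would cost `E
* φ x₀`, where `E` carries an extra `1/q`; instead there is only an initial distance of order `‖x₀ -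
xstar‖²`. -/
theorem initial_convexPotential_le {xstar : Vec d} {φ : Vec d → ℝ} {B E : ℝ} (hN : 1 ≤ N)
    (hL : 0 < L) (hf : IsSmoothFamily f L)
    (hφ : φ = fun x => avgLoss f x - avgLoss f xstar) (hB0 : 0 ≤ B) (hBL : B * L ^ 2 ≤ 1 / 50) :
    convexPotential L B E xstar
        (((x₀, h₀), fun i => Tracker.dirac (f i) φ xstar) : TrackedState d N)
      ≤ 2 * (‖x₀ - xstar‖ ^ 2 + initialShiftError f x₀ h₀ / L ^ 2) := by
  have hG0 : 0 ≤ initialShiftError f x₀ h₀ / L ^ 2 := by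
    rw [initialShiftError]
    positivity
  have h1 : meanValue (((x₀, h₀), fun i => Tracker.dirac (f i) φ xstar) : TrackedState d N)
      = 0 := by
    simp [meanValue, Tracker.dirac, hφ]
  have h2 := mul_le_mul_of_nonneg_left (mean_sq_norm_sub_le (x₀ := x₀) (h₀ := h₀) hN hf xstar) hB0
  have h3 := mul_le_mul_of_nonneg_right hBL hG0
  have h4 : B * L ^ 2 * (initialShiftError f x₀ h₀ / L ^ 2) = B * initialShiftError f x₀ h₀ := by
    field_simp
  have h5 := mul_le_mul_of_nonneg_right hBL (sq_nonneg ‖x₀ - xstar‖)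
  rw [convexPotential, h1, initial_meanSqDist hN, initial_meanSqShift]
  linarith [sq_nonneg ‖x₀ - xstar‖]

theorem cofig_sum_suboptimality_le {xstar : Vec d} (hS : 1 ≤ S) (hSN : S ≤ N) (hb : 1 ≤ b)
    (hL : 0 < L) (hω : 0 ≤ ω) (hη : 0 < η) (hε : 0 ≤ ε) (ha : 0 ≤ a) (hNa : (N : ℝ) ≤ a ^ 2)
    (hη1 : L * η ≤ 1 / 20) (hη2 : L * η * ((1 + ω) / S * a) ≤ 1 / 20)
    (hη3 : ε * η * ((1 + ω) / S * a) ≤ 1 / 20) (hσ : σ ^ 2 / b ≤ ε ^ 2 * a)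
    (hf : IsSmoothFamily f L) (hG : IsGradientOracle f D G σ) (hC : IsCompressor κ C ω)
    (hρ : IsRoundSampling S b D κ P ρ) (hconv : ConvexOn ℝ Set.univ (avgLoss f))
    (hmin : ∀ x, avgLoss f xstar ≤ avgLoss f x) :
    (∀ t, Integrable (fun w => η * (avgLoss f
        (cofig S b G C η (1 / (1 + ω)) reuse x₀ h₀ (fun s => ρ s w) t).x - avgLoss f xstar)) P) ∧
      ∀ T, ∑ t ∈ Finset.range T, ∫ w, η * (avgLoss f
        (cofig S b G C η (1 / (1 + ω)) reuse x₀ h₀ (fun s => ρ s w) t).x - avgLoss f xstar) ∂P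
        ≤ 2 * (‖x₀ - xstar‖ ^ 2 + initialShiftError f x₀ h₀ / L ^ 2) + T * (η * ε / 2) := by
  have hN := hS.trans hSN
  have hS0 : (0 : ℝ) < S := by exact_mod_cast hS
  obtain ⟨hq0, hq1, hqK⟩ := selection_rate_bounds hS hSN hω
  set α := 1 / (1 + ω) with hα
  have hα0 : 0 < α := by positivity
  have hα1 : α ≤ 1 := (div_le_one (by positivity)).2 (by linarith)
  set q := α * (S / N : ℝ) with hq
  set K := (1 + ω) / S with hK
  have hK0 : 0 ≤ K := by positivity
  set B := 8 * η ^ 2 * K / q with hB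
  have hB0 : 0 ≤ B := by positivity
  set E := 8 * B * L ^ 2 * η / q with hE
  have hE0 : 0 ≤ E := by positivity
  have h2 : (L * η) ^ 2 * K ≤ q / 400 :=
    sq_mul_le_of_rate hq0 hqK hNa (by positivity) hK0 ha hη2
  let φ : Vec d → ℝ := fun x => avgLoss f x - avgLoss f xstar
  have hφ0 : ∀ x, 0 ≤ φ x := fun x => sub_nonneg.2 (hmin x)
  have hφgrad : ∀ x y, φ y + ⟪gradient (avgLoss f) y, x - y⟫ ≤ φ x := by
    intro x y
    have := hconv.add_inner_gradient_le hf.differentiable_avgLoss y x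
    simp only [φ]
    linarith
  have hφm : Measurable φ := hf.differentiable_avgLoss.continuous.measurable.sub_const _
  let step := trackedStep S b G C f φ η α reuse
  let V : TrackedState d N → ℝ := convexPotential L B E xstar
  let W : TrackedState d N → ℝ := fun s => η * φ s.1.1
  let I : TrackedState d N → Prop := fun s =>
    (∀ i, (s.2 i).Valid (f i) L) ∧ ∀ i, (s.2 i).ConvexValid (avgLoss f) φ
  -- The trackers start at `xstar`, not at `x₀`, so that the initial tracked value vanishes.
  let a₀ : Fin N → Tracker d := fun i => Tracker.dirac (f i) φ xstar
  have hprob := isProbabilityMeasure_roundLaw (b := b) (D := D) (κ := κ) hSN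
  have hx1 : Measurable fun s : TrackedState d N => s.1.1 := by fun_prop
  have hV : Measurable V :=
    ((((hx1.sub_const xstar).norm.pow_const 2).add (measurable_meanSqDist.const_mul _)).add
      (measurable_meanSqShift.const_mul B)).add (measurable_meanValue.const_mul E)
  have hW : Measurable W := (hφm.comp hx1).const_mul η
  have hval : ∀ s, I s → 0 ≤ s.meanValue := fun s hs =>
    mul_nonneg (by positivity) (Finset.sum_nonneg fun i _ => (hs.2 i).value_nonneg hφ0)
  have hV0 : ∀ s, I s → 0 ≤ V s := fun s hs =>
    add_nonneg (add_nonneg (add_nonneg (sq_nonneg _)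
      (mul_nonneg (by positivity) (meanSqDist_nonneg hs.1)))
      (mul_nonneg hB0 (meanSqShift_nonneg s))) (mul_nonneg hE0 (hval s hs))
  have hint : ∀ s, I s → Integrable (fun r => V (step s r)) (roundLaw S b D κ) ∧
      ∫ r, V (step s r) ∂(roundLaw S b D κ) + W s ≤ V s + η * ε / 2 := by
    intro s hs
    have h := integral_convexPotential_le (reuse := reuse) hS hSN hb hL.le hω hη.le hα hq hK hB hE
      hη1 h2 hf hG hC hmin (φ := φ) rfl hφgrad hs.1 hs.2
    refine ⟨h.1, h.2.trans (add_le_add le_rfl ?_)⟩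
    calc 10 * η ^ 2 * K * (σ ^ 2 / b) ≤ 10 * η ^ 2 * K * (ε ^ 2 * a) := by gcongr
      _ = 10 * η * ε * (ε * η * (K * a)) := by ring
      _ ≤ 10 * η * ε * (1 / 20) := by gcongr
      _ = _ := by ring
  have main := sum_integral_le_of_lyapunov (s₀ := ((x₀, h₀), a₀)) (P := P) (ρ := ρ)
    (measurable_trackedStep (φ := φ) (η := η) (α := α) (reuse := reuse) hL.le hf hφm
      hG hC) hρ.measurable hρ.indep hρ.law (I := I) (V := V) (W := W)
    ⟨fun i => Tracker.valid_dirac (hf.lipschitz i) φ xstar, fun i => hφgrad xstar⟩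
    (fun s r hs => ⟨valid_trackedStep hf hα0.le hα1 hs.1 r,
      convexValid_trackedStep hα0.le hα1 hφgrad hs.2 r⟩) hV hW hV0
    (fun s _ => mul_nonneg hη.le (hφ0 _)) (by positivity : 0 ≤ η * ε / 2)
    (fun s hs => (hint s hs).1) (fun s hs => (hint s hs).2)
  have hx : ∀ t w, (cofig S b G C η α reuse x₀ h₀ (fun s => ρ s w) t).x
      = (randomIterate step ((x₀, h₀), a₀) (fun s => ρ s w) t).1.1 := fun t w => by
    rw [cofig_eq_randomIterate (f := f) (φ := φ) hN x₀ h₀ a₀]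
  simp only [hx]
  refine ⟨main.1, fun T => (main.2 T).trans (add_le_add ?_ le_rfl)⟩
  have hBL : 8 * η ^ 2 * K / q * L ^ 2 ≤ 1 / 50 := by
    rw [div_mul_eq_mul_div, div_le_iff₀ hq0]
    linarith
  exact initial_convexPotential_le hN hL hf rfl hB0 hBL

end Rates

/-- The pointwise bound `X ≤ ε/2 + X²/(2ε)` replaces Jensen's inequality for the double average over
time and chance. -/
theorem integrable_and_mean_le_of_mean_sq_le {Ω : Type*} [MeasurableSpace Ω] {P : Measure Ω}
    [IsProbabilityMeasure P] {X : ℕ → Ω → ℝ} {ε : ℝ} {T : ℕ} (hX : ∀ t w, 0 ≤ X t w) (hε : 0 < ε)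
    (hint : ∀ t, Integrable (fun w => X t w ^ 2) P)
    (hsum : ∑ t ∈ Finset.range (T + 1), ∫ w, X t w ^ 2 ∂P ≤ (T + 1) * ε ^ 2) :
    (∀ t, Integrable (X t) P) ∧
      (∑ t ∈ Finset.range (T + 1), ∫ w, X t w ∂P) / (T + 1) ≤ ε := by
  have hXint : ∀ t, Integrable (X t) P := by
    intro t
    have hm : AEStronglyMeasurable (X t) P := by
      have h := Real.continuous_sqrt.comp_aestronglyMeasurable (hint t).aestronglyMeasurable
      exact h.congr (.of_forall fun w => Real.sqrt_sq (hX t w))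
    exact ((memLp_two_iff_integrable_sq hm).2 (hint t)).integrable one_le_two
  refine ⟨hXint, ?_⟩
  have h1 : ∀ t, ∫ w, X t w ∂P ≤ ε / 2 + (2 * ε)⁻¹ * ∫ w, X t w ^ 2 ∂P := by
    intro t
    calc ∫ w, X t w ∂P ≤ ∫ w, (ε / 2 + (2 * ε)⁻¹ * X t w ^ 2) ∂P := by
          refine integral_mono (hXint t) ((integrable_const _).add ((hint t).const_mul _))
            fun w => ?_
          have h2 : ε / 2 + (2 * ε)⁻¹ * X t w ^ 2 - X t w = (2 * ε)⁻¹ * (X t w - ε) ^ 2 := by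
            field_simp
            ring
          have h3 : 0 ≤ (2 * ε)⁻¹ * (X t w - ε) ^ 2 := by positivity
          show X t w ≤ ε / 2 + (2 * ε)⁻¹ * X t w ^ 2
          linarith
      _ = _ := by
          rw [integral_add (integrable_const _) ((hint t).const_mul _), integral_const_mul]
          simp
  rw [div_le_iff₀ (by positivity)]
  calc _ ≤ ∑ t ∈ Finset.range (T + 1), (ε / 2 + (2 * ε)⁻¹ * ∫ w, X t w ^ 2 ∂P) :=
        Finset.sum_le_sum fun t _ => h1 t
    _ = (T + 1) * (ε / 2) + (2 * ε)⁻¹ * ∑ t ∈ Finset.range (T + 1), ∫ w, X t w ^ 2 ∂P := by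
        simp [Finset.sum_add_distrib, ← Finset.mul_sum]
    _ ≤ (T + 1) * (ε / 2) + (2 * ε)⁻¹ * ((T + 1) * ε ^ 2) := by gcongr
    _ = _ := by
        field_simp
        ring

theorem uniformIterateLE_zero {d : ℕ} {Ω : Type*} [MeasurableSpace Ω] {P : Measure Ω}
    [IsProbabilityMeasure P] {X : ℕ → Ω → Vec d} {φ : Vec d → ℝ} {x₀ : Vec d} {ε : ℝ}
    (hX : ∀ w, X 0 w = x₀) (h : φ x₀ ≤ ε) : UniformIterateLE P X φ 0 ε := by
  refine ⟨fun t ht => ?_, ?_⟩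
  · obtain rfl := Nat.le_zero.1 ht
    simp only [hX]
    exact integrable_const _
  · simpa [hX] using h

theorem initialShiftError_nonneg {d N : ℕ} (f : Fin N → Vec d → ℝ) (x₀ : Vec d)
    (h₀ : Fin N → Vec d) : 0 ≤ initialShiftError f x₀ h₀ := by
  unfold initialShiftError
  positivity

theorem IsSmoothFamily.sub_le_of_minimizer {d N : ℕ} {f : Fin N → Vec d → ℝ} {L : ℝ}
    {xstar : Vec d} (hf : IsSmoothFamily f L) (hN : 1 ≤ N) (hL : 0 ≤ L)
    (hmin : ∀ x, avgLoss f xstar ≤ avgLoss f x) (x : Vec d) :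
    avgLoss f x - avgLoss f xstar ≤ L / 2 * ‖x - xstar‖ ^ 2 := by
  have h1 := sq_norm_gradient_le_of_lower_bound hf.differentiable_avgLoss
    (hf.lipschitz_avgLoss hN) hL hmin xstar
  rw [sub_self, mul_zero] at h1
  have h2 : gradient (avgLoss f) xstar = 0 := by
    have := sq_nonneg ‖gradient (avgLoss f) xstar‖
    simpa using le_antisymm h1 this
  have h3 := le_quadratic_of_lipschitz_gradient hf.differentiable_avgLoss
    (hf.lipschitz_avgLoss hN) xstar x
  rw [h2, inner_zero_left] at h3
  linarith

/-! ### From the summed bounds to the number of rounds. -/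

section Rounds

variable {d N S b : ℕ} {A Z Ω : Type*} [MeasurableSpace A] [MeasurableSpace Z]
  [MeasurableSpace Ω] {f : Fin N → Vec d → ℝ} {D : Fin N → Measure A}
  [∀ i, IsProbabilityMeasure (D i)] {G : Fin N → Vec d → A → Vec d} {κ : Measure Z}
  [IsProbabilityMeasure κ] {C : Vec d → Z → Vec d} {P : Measure Ω} [IsProbabilityMeasure P]
  {ρ : ℕ → Ω → RoundDraw N b A Z} {σ ω L η ε a X : ℝ} {reuse : Bool} {x₀ : Vec d}
  {h₀ : Fin N → Vec d}

/-- The noise accounts for `ε²/2` of the mean squared gradient. The initial potential accounts for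
the other half once `T + 1 ≥ 4Δ/(ηε²)`; with `1/η = 20L(1 + Ka)` this is the constant 80. -/
theorem cofig_uniformIterateLE_norm_gradient (hS : 1 ≤ S) (hSN : S ≤ N) (hb : 1 ≤ b) (hL : 0 < L)
    (hω : 0 ≤ ω) (hε : 0 < ε) (ha : 0 ≤ a) (hNa : (N : ℝ) ≤ a ^ 2) (hNa' : (N : ℝ) ^ 2 ≤ a ^ 3)
    (hη : η = (20 * (L * (1 + (1 + ω) / S * a)))⁻¹) (hσ : σ ^ 2 / b ≤ ε ^ 2 * a)
    (hf : IsSmoothFamily f L) (hG : IsGradientOracle f D G σ) (hC : IsCompressor κ C ω)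
    (hρ : IsRoundSampling S b D κ P ρ) (hbdd : BddBelow (Set.range (avgLoss f)))
    (hX0 : 0 ≤ X)
    (hX : 80 * ((avgLoss f x₀ - ⨅ x, avgLoss f x) + initialShiftError f x₀ h₀ / L) *
      (L / ε ^ 2 * (1 + (1 + ω) / S * a)) ≤ X) :
    ∃ T : ℕ, (T : ℝ) ≤ X ∧ UniformIterateLE P
      (fun t w => (cofig S b G C η (1 / (1 + ω)) reuse x₀ h₀ (fun s => ρ s w) t).x)
      (fun x => ‖gradient (avgLoss f) x‖) T ε := by
  have hK : 0 ≤ (1 + ω) / S * a := by positivity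
  have hη0 : 0 < η := by rw [hη]; positivity
  have hη1 : L * η * (1 + (1 + ω) / S * a) = 1 / 20 := by
    rw [hη]
    field_simp
  have hLη : 0 ≤ L * η := by positivity
  have hLK := mul_nonneg hLη hK
  obtain ⟨hint, hsum⟩ := cofig_sum_sq_norm_gradient_le (reuse := reuse) (x₀ := x₀) (h₀ := h₀)
    hS hSN hb hL hω hη0 ha hNa hNa' (by linarith) (by linarith) hσ hf hG hC hρ hbdd
  refine ⟨⌊X⌋₊, Nat.floor_le hX0, ?_⟩
  have key := integrable_and_mean_le_of_mean_sq_le (P := P) (T := ⌊X⌋₊) (X := fun t w =>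
    ‖gradient (avgLoss f) (cofig S b G C η (1 / (1 + ω)) reuse x₀ h₀ (fun s => ρ s w) t).x‖)
    (fun _ _ => norm_nonneg _) hε ?_ ?_
  · exact ⟨fun t _ => key.1 t, key.2⟩
  · intro t
    refine ((hint t).const_mul (2 / η)).congr (.of_forall fun w => ?_)
    field_simp
  · have h1 := hsum (⌊X⌋₊ + 1)
    simp only [integral_const_mul, ← Finset.mul_sum] at h1
    -- With `T = ⌊X⌋` the average runs over the `T + 1 > X` iterates from 0 to `T`.
    have h2 := hX.trans (Nat.lt_floor_add_one X).le
    set Δ := (avgLoss f x₀ - ⨅ x, avgLoss f x) + initialShiftError f x₀ h₀ / L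
    have h3 : Δ ≤ (⌊X⌋₊ + 1) * (η * ε ^ 2 / 4) := by
      have h4 := mul_le_mul_of_nonneg_right h2 (by positivity : 0 ≤ η * ε ^ 2 / 4)
      have h5 : 80 * Δ * (L / ε ^ 2 * (1 + (1 + ω) / S * a)) * (η * ε ^ 2 / 4)
          = 20 * Δ * (L * η * (1 + (1 + ω) / S * a)) := by
        field_simp
        ring
      rw [h5, hη1] at h4
      linarith
    push_cast at h1
    refine le_of_mul_le_mul_left (h1.trans ?_) (half_pos hη0)
    linarith

/-- The step size must control both `LηKa`, for stability, and `εηKa`, for the noise; hence `max L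
ε`. It may not depend on `x₀`, and `hεR` converts the maximum into `L(1 + R²)` afterwards, which
produces the factor `1 + R²`. -/
theorem cofig_uniformIterateLE_suboptimality {xstar : Vec d} (hS : 1 ≤ S) (hSN : S ≤ N)
    (hb : 1 ≤ b) (hL : 0 < L) (hω : 0 ≤ ω) (hε : 0 < ε) (ha : 0 ≤ a) (hNa : (N : ℝ) ≤ a ^ 2)
    (hη : η = (20 * (L + (1 + ω) / S * a * max L ε))⁻¹) (hσ : σ ^ 2 / b ≤ ε ^ 2 * a)
    (hf : IsSmoothFamily f L) (hG : IsGradientOracle f D G σ) (hC : IsCompressor κ C ω)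
    (hρ : IsRoundSampling S b D κ P ρ) (hconv : ConvexOn ℝ Set.univ (avgLoss f))
    (hmin : ∀ x, avgLoss f xstar ≤ avgLoss f x) (hεR : ε < L / 2 * ‖x₀ - xstar‖ ^ 2)
    (hX0 : 0 ≤ X)
    (hX : 80 * (1 + ‖x₀ - xstar‖ ^ 2) *
      (‖x₀ - xstar‖ ^ 2 + initialShiftError f x₀ h₀ / L ^ 2) *
      (L / ε * (1 + (1 + ω) / S * a)) ≤ X) :
    ∃ T : ℕ, (T : ℝ) ≤ X ∧ UniformIterateLE P
      (fun t w => (cofig S b G C η (1 / (1 + ω)) reuse x₀ h₀ (fun s => ρ s w) t).x)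
      (fun x => avgLoss f x - avgLoss f xstar) T ε := by
  have hK : 0 ≤ (1 + ω) / S * a := by positivity
  have hM0 : 0 < L + (1 + ω) / S * a * max L ε := by positivity
  have hη0 : 0 < η := by rw [hη]; positivity
  have hη1 : η * (L + (1 + ω) / S * a * max L ε) = 1 / 20 := by
    rw [hη]
    field_simp
  have h0 : 0 ≤ η * ((1 + ω) / S * a) := by positivity
  have hmL := mul_le_mul_of_nonneg_left (le_max_left L ε) h0
  have hmε := mul_le_mul_of_nonneg_left (le_max_right L ε) h0
  have hLη : 0 ≤ η * L := by positivity
  have h0L := mul_nonneg h0 hL.le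
  obtain ⟨hint, hsum⟩ := cofig_sum_suboptimality_le (reuse := reuse) (x₀ := x₀) (h₀ := h₀)
    hS hSN hb hL hω hη0 hε.le ha hNa (by linarith) (by linarith) (by linarith) hσ hf hG hC hρ
    hconv hmin
  refine ⟨⌊X⌋₊, Nat.floor_le hX0, fun t _ => ?_, ?_⟩
  · refine ((hint t).const_mul η⁻¹).congr (.of_forall fun w => ?_)
    field_simp
  · have h1 := hsum (⌊X⌋₊ + 1)
    simp only [integral_const_mul, ← Finset.mul_sum] at h1
    have h2 := hX.trans (Nat.lt_floor_add_one X).le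
    have hV0 : 0 ≤ ‖x₀ - xstar‖ ^ 2 + initialShiftError f x₀ h₀ / L ^ 2 :=
      add_nonneg (sq_nonneg _) (div_nonneg (initialShiftError_nonneg f x₀ h₀) (sq_nonneg _))
    set V := ‖x₀ - xstar‖ ^ 2 + initialShiftError f x₀ h₀ / L ^ 2
    have hR0 := sq_nonneg ‖x₀ - xstar‖
    set R := ‖x₀ - xstar‖ ^ 2
    have hLR : 0 ≤ L * R := by positivity
    have hmax : max L ε ≤ L * (1 + R) := max_le (by linarith) (by linarith)
    have h3 : 1 / 20 ≤ η * (L * (1 + R) * (1 + (1 + ω) / S * a)) := by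
      have h4 := mul_le_mul_of_nonneg_left hmax h0
      have h5 := mul_nonneg hη0.le hLR
      linarith
    have h6 : 2 * V ≤ (⌊X⌋₊ + 1) * (η * ε / 2) := by
      have h4 := mul_le_mul_of_nonneg_right h2 (by positivity : 0 ≤ η * ε / 2)
      have h5 : 80 * (1 + R) * V * (L / ε * (1 + (1 + ω) / S * a)) * (η * ε / 2)
          = 40 * V * (η * (L * (1 + R) * (1 + (1 + ω) / S * a))) := by
        field_simp
        ring
      have h7 := mul_le_mul_of_nonneg_left h3 (by positivity : 0 ≤ 40 * V)
      rw [h5] at h4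
      linarith
    push_cast at h1
    rw [div_le_iff₀ (by positivity)]
    refine le_of_mul_le_mul_left (h1.trans ?_) hη0
    linarith

end Rounds

theorem variance_div_le {σ ε a b : ℝ} (hε : 0 < ε) (ha : 0 < a) (hb : 0 < b)
    (h : σ ^ 2 / (ε ^ 2 * a) ≤ b) : σ ^ 2 / b ≤ ε ^ 2 * a := by
  rw [div_le_iff₀ (by positivity)] at h ⊢
  linarith

theorem mainTheorem4 :
    -- the nonconvex case
    (∃ c : ℝ, 0 < c ∧
      ∀ (N S b : ℕ) (L ω σ ε : ℝ), 1 ≤ S → S ≤ N → 1 ≤ b → 0 ≤ L → 0 ≤ ω → 0 ≤ σ → 0 < ε →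
        σ ^ 2 / (ε ^ 2 * (N : ℝ) ^ (2 / 3 : ℝ)) ≤ (b : ℝ) →
        ∃ η : ℝ, 0 < η ∧
          ∀ (d : ℕ) (A Z Ω : Type*) [MeasurableSpace A] [MeasurableSpace Z] [MeasurableSpace Ω]
            (f : Fin N → Vec d → ℝ)
            (D : Fin N → Measure A) [∀ i, IsProbabilityMeasure (D i)]
            (G : Fin N → Vec d → A → Vec d)
            (κ : Measure Z) [IsProbabilityMeasure κ] (C : Vec d → Z → Vec d)
            (P : Measure Ω) [IsProbabilityMeasure P] (ρ : ℕ → Ω → RoundDraw N b A Z)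
            (reuse : Bool) (x₀ : Vec d) (h₀ : Fin N → Vec d),
            IsSmoothFamily f L → IsGradientOracle f D G σ → IsCompressor κ C ω →
            IsRoundSampling S b D κ P ρ →
            BddBelow (Set.range (avgLoss f)) →
            ∃ T : ℕ,
              (T : ℝ) ≤ c * ((avgLoss f x₀ - ⨅ x, avgLoss f x) + initialShiftError f x₀ h₀ / L) *
                (L / ε ^ 2 + L * (1 + ω) * (N : ℝ) ^ (2 / 3 : ℝ) / (S * ε ^ 2)
                  + L * (1 + ω) ^ (3 / 2 : ℝ) * √N / (S * ε ^ 2)) ∧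
              UniformIterateLE P
                (fun t w => (cofig S b G C η (1 / (1 + ω)) reuse x₀ h₀ (fun s => ρ s w) t).x)
                (fun x => ‖gradient (avgLoss f) x‖) T ε) ∧
    -- the convex case
    (∃ c : ℝ, 0 < c ∧
      ∀ (N S b : ℕ) (L ω σ ε : ℝ), 1 ≤ S → S ≤ N → 1 ≤ b → 0 ≤ L → 0 ≤ ω → 0 ≤ σ → 0 < ε →
        σ ^ 2 / (ε ^ 2 * √N) ≤ (b : ℝ) →
        ∃ η : ℝ, 0 < η ∧
          ∀ (d : ℕ) (A Z Ω : Type*) [MeasurableSpace A] [MeasurableSpace Z] [MeasurableSpace Ω]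
            (f : Fin N → Vec d → ℝ)
            (D : Fin N → Measure A) [∀ i, IsProbabilityMeasure (D i)]
            (G : Fin N → Vec d → A → Vec d)
            (κ : Measure Z) [IsProbabilityMeasure κ] (C : Vec d → Z → Vec d)
            (P : Measure Ω) [IsProbabilityMeasure P] (ρ : ℕ → Ω → RoundDraw N b A Z)
            (reuse : Bool) (x₀ : Vec d) (h₀ : Fin N → Vec d) (xstar : Vec d),
            IsSmoothFamily f L → IsGradientOracle f D G σ → IsCompressor κ C ω →
            IsRoundSampling S b D κ P ρ →
            ConvexOn ℝ Set.univ (avgLoss f) → (∀ x, avgLoss f xstar ≤ avgLoss f x) →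
            ∃ T : ℕ,
              (T : ℝ) ≤ c * (1 + ‖x₀ - xstar‖ ^ 2) *
                (‖x₀ - xstar‖ ^ 2 + initialShiftError f x₀ h₀ / L ^ 2) *
                (L / ε + (1 + ω) * √N * L / (S * ε)) ∧
              UniformIterateLE P
                (fun t w => (cofig S b G C η (1 / (1 + ω)) reuse x₀ h₀ (fun s => ρ s w) t).x)
                (fun x => avgLoss f x - avgLoss f xstar) T ε) := by
  refine ⟨⟨80, by norm_num, ?_⟩, ⟨80, by norm_num, ?_⟩⟩
  · intro N S b L ω σ ε hS hSN hb hL hω hσ hε hbσ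
    have hN := hS.trans hSN
    have hN1 : (1 : ℝ) ≤ N := by exact_mod_cast hN
    have hS0 : (0 : ℝ) < S := by exact_mod_cast hS
    have hb0 : (0 : ℝ) < b := by exact_mod_cast hb
    have hNa' : (N : ℝ) ^ 2 = ((N : ℝ) ^ (2 / 3 : ℝ)) ^ 3 := by
      rw [← Real.rpow_natCast, ← Real.rpow_natCast, ← Real.rpow_mul (by positivity)]
      norm_num
    have hNa : (N : ℝ) ≤ ((N : ℝ) ^ (2 / 3 : ℝ)) ^ 2 := by
      rw [← Real.rpow_natCast, ← Real.rpow_mul (by positivity)]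
      exact Real.self_le_rpow_of_one_le hN1 (by norm_num)
    have ha0 : 0 < (N : ℝ) ^ (2 / 3 : ℝ) := by positivity
    set a := (N : ℝ) ^ (2 / 3 : ℝ)
    rcases hL.eq_or_lt with rfl | hL
    -- For `L = 0` the gradient of a function bounded below vanishes, so zero rounds suffice and any
    -- step size serves.
    · refine ⟨1, one_pos, ?_⟩
      intro d A Z Ω _ _ _ f D _ G κ _ C P _ ρ reuse x₀ h₀ hf hG hC hρ hbdd
      refine ⟨0, by simp, uniformIterateLE_zero (x₀ := x₀) (fun w => rfl) ?_⟩
      have h := sq_norm_gradient_le_of_lower_bound hf.differentiable_avgLoss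
        (hf.lipschitz_avgLoss hN) le_rfl (ciInf_le hbdd) x₀
      have h1 : ‖gradient (avgLoss f) x₀‖ = 0 :=
        pow_eq_zero_iff two_ne_zero |>.1 (le_antisymm (by linarith) (sq_nonneg _))
      rw [h1]
      exact hε.le
    · refine ⟨(20 * (L * (1 + (1 + ω) / S * a)))⁻¹, by positivity, ?_⟩
      intro d A Z Ω _ _ _ f D _ G κ _ C P _ ρ reuse x₀ h₀ hf hG hC hρ hbdd
      have hΔ : 0 ≤ (avgLoss f x₀ - ⨅ x, avgLoss f x) + initialShiftError f x₀ h₀ / L :=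
        add_nonneg (sub_nonneg.2 (ciInf_le hbdd x₀))
          (div_nonneg (initialShiftError_nonneg f x₀ h₀) hL.le)
      refine cofig_uniformIterateLE_norm_gradient hS hSN hb hL hω hε ha0.le hNa hNa'.le rfl
        (variance_div_le hε ha0 hb0 hbσ) hf hG hC hρ hbdd (by positivity)
        (mul_le_mul_of_nonneg_left ?_ (by positivity))
      have h1 : L / ε ^ 2 * (1 + (1 + ω) / S * a)
          = L / ε ^ 2 + L * (1 + ω) * a / (S * ε ^ 2) := by
        field_simp
      rw [h1]
      -- The first two terms of the rate already suffice; the term with `(1 + ω)^{3/2}√N` is slack.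
      exact le_add_of_nonneg_right (by positivity)
  · intro N S b L ω σ ε hS hSN hb hL hω hσ hε hbσ
    have hN := hS.trans hSN
    have hN0 : (0 : ℝ) < N := by exact_mod_cast hN
    have hS0 : (0 : ℝ) < S := by exact_mod_cast hS
    have hb0 : (0 : ℝ) < b := by exact_mod_cast hb
    have ha0 : 0 < √(N : ℝ) := Real.sqrt_pos.2 hN0
    have hNa : (N : ℝ) ≤ √(N : ℝ) ^ 2 := (Real.sq_sqrt hN0.le).ge
    refine ⟨(20 * (L + (1 + ω) / S * √N * max L ε))⁻¹, ?_, ?_⟩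
    · have h1 : 0 < (1 + ω) / S * √N * max L ε :=
        mul_pos (by positivity) (hε.trans_le (le_max_right _ _))
      positivity
    intro d A Z Ω _ _ _ f D _ G κ _ C P _ ρ reuse x₀ h₀ xstar hf hG hC hρ hconv hmin
    have hV : 0 ≤ ‖x₀ - xstar‖ ^ 2 + initialShiftError f x₀ h₀ / L ^ 2 :=
      add_nonneg (sq_nonneg _) (div_nonneg (initialShiftError_nonneg f x₀ h₀) (sq_nonneg _))
    -- In the first case `x₀` is already `ε`-optimal and `T = 0`; this includes `L = 0`. In the
    -- second, `L > 0` and `ε < L R² / 2`.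
    rcases le_or_gt (L / 2 * ‖x₀ - xstar‖ ^ 2) ε with h | h
    · refine ⟨0, ?_, uniformIterateLE_zero (x₀ := x₀) (fun w => rfl)
        ((hf.sub_le_of_minimizer hN hL hmin x₀).trans h)⟩
      rw [Nat.cast_zero]
      positivity
    · have hL : 0 < L := by
        rcases hL.eq_or_lt with rfl | hL
        · rw [zero_div, zero_mul] at h
          exact absurd h hε.not_gt
        · exact hL
      refine cofig_uniformIterateLE_suboptimality hS hSN hb hL hω hε ha0.le hNa rfl
        (variance_div_le hε ha0 hb0 hbσ) hf hG hC hρ hconv hmin h (by positivity)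
        (mul_le_mul_of_nonneg_left (le_of_eq ?_) (by positivity))
      field_simp
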